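/- Let $L>0$, let $S=\mathbb R/L\mathbb Z$, let $H^k(S)$ be the real Sobolev space (with $H^0=L^2$), and let $V^k(S)=\{f\in H^k(S): \frac1L\int_0^L f\,dz=0\}$. Consider the 1D model $$u_t+v\,u_z=0,\qquad \omega_t+v\,\omega_z=u_z,\qquad v_z=H\omega:=\frac1L\,\mathrm{P.V.}\!\int_0^L \omega(y)\cot\Bigl[\frac{\pi}{L}(z-y)\Bigr]dy,$$ where $v(\cdot,t)$ is $L$-periodic with mean zero. For an integer $m\ge 1$ and a time interval $I$, a solution $(u,\omega)$ is in class $CV^m$ on $I$ if $$u\in C(I;H^{m+1}(S))\cap C^1(I;H^{m}(S)),\qquad \omega\in C(I;V^{m}(S))\cap C^1(I;V^{m-1}(S)).$$ Let $u_0\in H^{m+1}(S)$ (in particular, $u_0\in V^{m+1}(S)$ is allowed), let $\omega_0\in V^m(S)$, let $0<T<\infty$, and let $(u,\omega)$ be a solution in class $CV^m$ on $[0,T)$ with $u(\cdot,0)=u_0$, $\omega(\cdot,0)=\omega_0$. Then $(u,\omega)$ cannot be continued in class $CV^m$ up to and beyond $T$ (that is, for no $T'>T$ is there a solution in class $CV^m$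 on $[0,T']$ that coincides with $(u,\omega)$ on $[0,T)$) if and only if $$\int_0^T\|H\omega(\cdot,t)\|_{L^\infty}\,dt=\infty .$$ -/

import Mathlib

open MeasureTheory Filter Topology Set
open scoped ENNReal

noncomputable section

namespace OneDModel

variable (L : ℝ) [hL : Fact (0 < L)]

/-- Real `L²` on the circle of circumference `L`; `volume` has total mass `L`. -/
abbrev L2 : Type := Lp ℝ 2 (volume : Measure (AddCircle L))

variable {L}

/-- `g` is the weak derivative of `f` on the circle: integration by parts against every smooth
`L`-periodic test function. -/
def HasWeakDeriv (f g : L2 L) : Prop :=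
  ∀ φ : ℝ → ℝ, ContDiff ℝ (⊤ : ℕ∞) φ → Function.Periodic φ L →
    ∫ x in (0 : ℝ)..L, f (x : AddCircle L) * deriv φ x =
      -∫ x in (0 : ℝ)..L, g (x : AddCircle L) * φ x

theorem measurePreserving_coe :
    MeasurePreserving (fun x : ℝ => (x : AddCircle L)) (volume.restrict (Ioc 0 L)) volume := by
  simpa using AddCircle.measurePreserving_mk L 0

theorem intervalIntegrable_coe_mul (f : L2 L) {ψ : ℝ → ℝ} (hψ : Continuous ψ) :
    IntervalIntegrable (fun x : ℝ => f (x : AddCircle L) * ψ x) volume 0 L := by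
  refine IntervalIntegrable.mul_continuousOn ?_ hψ.continuousOn
  rw [intervalIntegrable_iff_integrableOn_Ioc_of_le hL.out.le]
  exact (measurePreserving_coe (L := L)).integrable_comp_of_integrable
    ((Lp.memLp f).integrable (by norm_num))

theorem integral_coe_add_mul (f g : L2 L) {ψ : ℝ → ℝ} (hψ : Continuous ψ) :
    ∫ x in (0 : ℝ)..L, (f + g : L2 L) (x : AddCircle L) * ψ x =
      (∫ x in (0 : ℝ)..L, f (x : AddCircle L) * ψ x) +
        ∫ x in (0 : ℝ)..L, g (x : AddCircle L) * ψ x := by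
  rw [← intervalIntegral.integral_add (intervalIntegrable_coe_mul f hψ)
    (intervalIntegrable_coe_mul g hψ)]
  simp only [intervalIntegral.integral_of_le hL.out.le]
  refine integral_congr_ae ?_
  filter_upwards [(measurePreserving_coe (L := L)).quasiMeasurePreserving.ae
    (Lp.coeFn_add f g)] with x hx
  rw [hx, Pi.add_apply, add_mul]

theorem integral_coe_smul_mul (c : ℝ) (f : L2 L) (ψ : ℝ → ℝ) :
    ∫ x in (0 : ℝ)..L, (c • f : L2 L) (x : AddCircle L) * ψ x =
      c * ∫ x in (0 : ℝ)..L, f (x : AddCircle L) * ψ x := by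
  rw [← intervalIntegral.integral_const_mul]
  simp only [intervalIntegral.integral_of_le hL.out.le]
  refine integral_congr_ae ?_
  filter_upwards [(measurePreserving_coe (L := L)).quasiMeasurePreserving.ae
    (Lp.coeFn_smul c f)] with x hx
  rw [hx, Pi.smul_apply, smul_eq_mul, mul_assoc]

theorem HasWeakDeriv.add {f g f' g' : L2 L} (h : HasWeakDeriv f g) (h' : HasWeakDeriv f' g') :
    HasWeakDeriv (f + f') (g + g') := by
  intro φ hφ hp
  rw [integral_coe_add_mul _ _ (hφ.continuous_deriv (by simp)),
    integral_coe_add_mul _ _ hφ.continuous, h φ hφ hp, h' φ hφ hp, neg_add]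

theorem HasWeakDeriv.smul {f g : L2 L} (c : ℝ) (h : HasWeakDeriv f g) :
    HasWeakDeriv (c • f) (c • g) := by
  intro φ hφ hp
  rw [integral_coe_smul_mul, integral_coe_smul_mul, h φ hφ hp, mul_neg]

variable (L) in
/-- The real Sobolev space `Hᵏ` of the circle. A function `f` is stored together with its weak
derivatives as `(f, ∂f, …, ∂ᵏf)`, so that the norm inherited from `PiLp 2` is
`(∑_{j ≤ k} ‖∂ʲf‖²_{L²})^{1/2}`. -/
def Sobolev (k : ℕ) : Submodule ℝ (PiLp 2 (fun _ : Fin (k + 1) => L2 L)) where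
  carrier := {F | ∀ j : Fin k, HasWeakDeriv (F j.castSucc) (F j.succ)}
  add_mem' := fun ha hb j => (ha j).add (hb j)
  zero_mem' := by
    intro j φ hφ hp
    have h0 : ∀ ψ : ℝ → ℝ, ∫ x in (0 : ℝ)..L, (0 : L2 L) (x : AddCircle L) * ψ x = 0 := by
      intro ψ
      have h := integral_coe_smul_mul (L := L) 0 0 ψ
      rwa [zero_smul, zero_mul] at h
    simp only [PiLp.zero_apply, h0, neg_zero]
  smul_mem' := fun c _ ha j => (ha j).smul c

namespace Sobolev

variable {k : ℕ}

/-- The `j`-th weak derivative `∂ʲF`, for `j ≤ k`. -/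
def wderiv (F : Sobolev L k) (j : ℕ) (hj : j ≤ k) : L2 L := F.1 ⟨j, Nat.lt_succ_of_le hj⟩

/-- The underlying function of an element of `Hᵏ` (defined up to null sets). -/
def fn (F : Sobolev L k) : AddCircle L → ℝ := wderiv F 0 (Nat.zero_le k)

/-- The inclusion `Hᵏ ⊆ Hʲ` for `j ≤ k`. -/
def incl {j : ℕ} (hj : j ≤ k) : Sobolev L k →ₗ[ℝ] Sobolev L j where
  toFun F := ⟨WithLp.toLp 2 fun i => F.1 (Fin.castLE (Nat.succ_le_succ hj) i),
    fun i => F.2 (Fin.castLE hj i)⟩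
  map_add' _ _ := rfl
  map_smul' _ _ := rfl

end Sobolev

variable (L) in
/-- `Vᵏ`: the elements of `Hᵏ` with mean zero. -/
def V (k : ℕ) : Set (Sobolev L k) := {F | (1 / L) * ∫ x : AddCircle L, Sobolev.fn F x = 0}

theorem periodic_cot : Function.Periodic (fun x : ℝ => Real.cot (Real.pi / L * x)) L := by
  intro x
  have h0 : L ≠ 0 := hL.out.ne'
  have h : Real.pi / L * (x + L) = Real.pi / L * x + Real.pi := by field_simp
  simp only [h, Real.cot_eq_cos_div_sin, Real.cos_add_pi, Real.sin_add_pi, neg_div_neg_eq]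

variable (L) in
/-- `cot(μ z)`, `μ = π / L`, as a function on the circle. -/
def cotKernel : AddCircle L → ℝ := (periodic_cot (L := L)).lift

/-- `(1/L) ∫_{dist(y,z) > ε} f(y) cot(μ (z - y)) dy`. -/
def truncatedHilbert (f : AddCircle L → ℝ) (z : AddCircle L) (ε : ℝ) : ℝ :=
  (1 / L) * ∫ y in {y : AddCircle L | ε < ‖z - y‖}, f y * cotKernel L (z - y)

/-- The periodic Hilbert transform `Hf(z) = (1/L) PV ∫ f(y) cot(μ (z - y)) dy`. -/
def hilbert (f : AddCircle L → ℝ) (z : AddCircle L) : ℝ :=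
  limUnder (𝓝[>] (0 : ℝ)) (truncatedHilbert f z)

/-- `g = Hf` almost everywhere, the principal value being convergent almost everywhere. -/
def IsHilbertTransform (f g : AddCircle L → ℝ) : Prop :=
  ∀ᵐ z : AddCircle L, Tendsto (truncatedHilbert f z) (𝓝[>] (0 : ℝ)) (𝓝 (g z))

/-- The zero-mean velocity `v ∈ V^{m+1}` with `v_z = Hω`. -/
def IsVelocity {m : ℕ} (ω : Sobolev L m) (v : Sobolev L (m + 1)) : Prop :=
  v ∈ V L (m + 1) ∧ IsHilbertTransform (Sobolev.fn ω) (Sobolev.wderiv v 1 (Nat.le_add_left 1 m))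

/-- `(u, ω)` belongs to the class `CVᵐ` on the time interval `I`:
`u ∈ C(I; H^{m+1}) ∩ C¹(I; H^m)` and `ω ∈ C(I; V^m) ∩ C¹(I; V^{m-1})`. (The time derivative of
`ω` automatically has mean zero. Only `ω` and the velocity are zero-mean: the equations do not
preserve the mean of `u`.) -/
structure InClassCV (m : ℕ) (I : Set ℝ) (u : ℝ → Sobolev L (m + 1)) (ω : ℝ → Sobolev L m) :
    Prop where
  mean_zero : ∀ t ∈ I, ω t ∈ V L m
  continuous_u : ContinuousOn u I
  continuous_ω : ContinuousOn ω I
  contDiff_u : ContDiffOn ℝ 1 (fun t => Sobolev.incl (Nat.le_succ m) (u t)) I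
  contDiff_ω : ContDiffOn ℝ 1 (fun t => Sobolev.incl (Nat.sub_le m 1) (ω t)) I

/-- `(u, ω)` is a solution of class `CVᵐ` on `I` of
`u_t + v u_z = 0`, `ω_t + v ω_z = u_z`, `v_z = Hω`, `v` of mean zero, with data `(u₀, ω₀)`. -/
structure IsSolution {m : ℕ} (hm : 1 ≤ m) (u₀ : Sobolev L (m + 1)) (ω₀ : Sobolev L m)
    (I : Set ℝ) (u : ℝ → Sobolev L (m + 1)) (ω : ℝ → Sobolev L m) : Prop where
  inClass : InClassCV m I u ω
  init_u : u 0 = u₀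
  init_ω : ω 0 = ω₀
  eqn : ∀ t ∈ I, ∃ v : Sobolev L (m + 1), IsVelocity (ω t) v ∧
    (∀ᵐ z : AddCircle L,
      Sobolev.fn (derivWithin (fun s => Sobolev.incl (Nat.le_succ m) (u s)) I t) z
        + Sobolev.fn v z * Sobolev.wderiv (u t) 1 (Nat.le_add_left 1 m) z = 0) ∧
    (∀ᵐ z : AddCircle L,
      Sobolev.fn (derivWithin (fun s => Sobolev.incl (Nat.sub_le m 1) (ω s)) I t) z
        + Sobolev.fn v z * Sobolev.wderiv (ω t) 1 hm z
          = Sobolev.wderiv (u t) 1 (Nat.le_add_left 1 m) z)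

/-- The solution `(u, ω)` on `[0,T)` can be continued in class `CVᵐ` up to and beyond `T`. -/
def Continuable {m : ℕ} (hm : 1 ≤ m) (u₀ : Sobolev L (m + 1)) (ω₀ : Sobolev L m)
    (T : ℝ) (u : ℝ → Sobolev L (m + 1)) (ω : ℝ → Sobolev L m) : Prop :=
  ∃ T' > T, ∃ (U : ℝ → Sobolev L (m + 1)) (W : ℝ → Sobolev L m),
    IsSolution hm u₀ ω₀ (Icc 0 T') U W ∧ ∀ t ∈ Ico 0 T, U t = u t ∧ W t = ω t

end OneDModel

end

set_option linter.unusedSectionVars false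

noncomputable section

namespace OneDModel

variable {L : ℝ} [hL : Fact (0 < L)]

/-! In Lagrangian coordinates the model becomes an ordinary differential equation without loss of
derivatives. Let `φ` be the flow of `v`, `S` the logarithm of its Jacobian and `W = ω ∘ φ`. Since
`u` is transported, `u_z ∘ φ = e^{-S} u₀'`, so that `S_t = (Hω) ∘ φ` and `W_t = e^{-S} u₀'`. The
first right-hand side is the Hilbert transform conjugated by `φ`, applied to `W`; as `H` commutes
with translations it depends on `φ` only through `S`. Hence `(S, W)` solves an autonomous equation
in `Hᵐ × Hᵐ`, whose vector field is `field`.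

This field is locally Lipschitz (`exists_field_lipschitz`). In `L²` the point is that the kernels
`q(β) cot(π(φ(α) - φ(β))/L)` of two diffeomorphisms have the same leading singularity; since `H¹`
embeds in the `1/2`-Hölder functions, their difference is `O(‖α - β‖^{-1/2})`, which is integrable
(`CDiff.abs_kernel_sub_le`, `norm_le_of_weakly_singular`). Higher derivatives follow from `∂(φ^* H
φ_* f) = e^S φ^* H φ_* (e^{-S} ∂f)`, which is `hasWeakDeriv_conj_diffeo`.

Suppose the time integral of `‖Hω‖_∞` is finite. As `S_t` is `Hω` along the flow, `S` is bounded by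
that integral (`enorm_logJac_le`). A bound for `sup |S|` propagates to `Hᵐ` one derivative at a
time: given `Hᵏ` control of `S`, the equations for `(∂S, ∂W)` obey a bound in `Hᵏ` that is affine in
`(∂S, ∂W)`, so Grönwall applies (`exists_sobB_bound`). Solutions of the Lagrangian equation
therefore stay in a ball up to time `T`, and one exists beyond `T` (`exists_solves_beyond`).
Returning to Eulerian coordinates gives a solution of class `CVᵐ` (`isSolution_eul`), which agrees
with the given one on `[0,T)` by an `L²` energy estimate for `(u, u_z, ω)` (`IsSolution.unique`).
The same uniqueness statement lets `‖Hω‖_∞` of the given solution control the Lagrangian one during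
the continuation argument.

Conversely, for a solution on `[0,T']` with `T' > T`, `ω` is bounded in `Hᵐ` by compactness. Since
`H` is bounded on `H¹`, which embeds in `L^∞`, the integral is finite
(`lintegral_lt_top_of_continuable`). -/

/-! ### Fourier coefficients of real `L²` functions on the circle -/

/-- The `n`-th Fourier coefficient of a real `L²` function. -/
def fc (f : L2 L) (n : ℤ) : ℂ := fourierCoeff (fun x => ((f x : ℝ) : ℂ)) n

theorem L2.integrable (f : L2 L) : Integrable f volume := (Lp.memLp f).integrable (by norm_num)

theorem L2.memLp_ofReal (f : L2 L) :
    MemLp (fun x => ((f x : ℝ) : ℂ)) 2 (AddCircle.haarAddCircle (T := L)) :=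
  (Lp.memLp f).ofReal.haarAddCircle

theorem fc_eq_integral (f : L2 L) (n : ℤ) :
    fc f n = ((L⁻¹ : ℝ) : ℂ) * ∫ x : AddCircle L, fourier (-n) x * ((f x : ℝ) : ℂ) := by
  rw [fc, fourierCoeff, AddCircle.integral_haarAddCircle]
  simp [Complex.real_smul]

theorem fc_congr {f : L2 L} {F : AddCircle L → ℝ} (h : f =ᵐ[volume] F) (n : ℤ) :
    fc f n = ((L⁻¹ : ℝ) : ℂ) * ∫ x : AddCircle L, fourier (-n) x * ((F x : ℝ) : ℂ) := by
  rw [fc_eq_integral]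
  congr 1
  refine integral_congr_ae ?_
  filter_upwards [h] with x hx
  rw [hx]

theorem fc_integrable (f : L2 L) (n : ℤ) :
    Integrable (fun x => fourier n x * ((f x : ℝ) : ℂ)) (volume : Measure (AddCircle L)) := by
  refine Integrable.bdd_mul (c := 1) (L2.integrable f).ofReal
    (map_continuous (fourier n)).aestronglyMeasurable ?_
  exact Eventually.of_forall fun x => by rw [fourier_apply, Circle.norm_coe]

theorem fc_add (f g : L2 L) (n : ℤ) : fc (f + g) n = fc f n + fc g n := by
  rw [fc_congr (Lp.coeFn_add f g), fc_eq_integral, fc_eq_integral, ← mul_add,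
    ← integral_add (fc_integrable f _) (fc_integrable g _)]
  simp [mul_add]

theorem fc_smul (c : ℝ) (f : L2 L) (n : ℤ) : fc (c • f) n = c * fc f n := by
  rw [fc_congr (Lp.coeFn_smul c f), fc_eq_integral, mul_left_comm (c : ℂ),
    ← integral_const_mul (c : ℂ)]
  congr 1
  refine integral_congr_ae (Eventually.of_forall fun x => ?_)
  simp only [Pi.smul_apply, smul_eq_mul, Complex.ofReal_mul]
  ring

theorem fc_sub (f g : L2 L) (n : ℤ) : fc (f - g) n = fc f n - fc g n := by
  have h : f - g = f + (-1 : ℝ) • g := by rw [neg_one_smul, sub_eq_add_neg]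
  rw [h, fc_add, fc_smul]
  push_cast
  ring

theorem fc_neg_index (f : L2 L) (n : ℤ) : fc f (-n) = (starRingEnd ℂ) (fc f n) := by
  rw [fc_eq_integral, fc_eq_integral, map_mul, Complex.conj_ofReal, ← integral_conj]
  congr 1
  refine integral_congr_ae (Eventually.of_forall fun x => ?_)
  simp [fourier_neg, -fourier_apply]

/-- The complexification of a real `L²` function. -/
def complexify (f : L2 L) : Lp ℂ 2 (AddCircle.haarAddCircle (T := L)) :=
  (L2.memLp_ofReal f).toLp _

theorem ae_haar_iff {p : AddCircle L → Prop} :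
    (∀ᵐ x ∂(AddCircle.haarAddCircle (T := L)), p x) ↔ ∀ᵐ x : AddCircle L, p x := by
  have h : (ENNReal.ofReal L) ≠ 0 := by simpa using hL.out
  rw [AddCircle.volume_eq_smul_haarAddCircle]
  exact (Measure.ae_ennreal_smul_measure_iff h).symm

theorem coeFn_complexify (f : L2 L) :
    ∀ᵐ x : AddCircle L, complexify f x = ((f x : ℝ) : ℂ) :=
  ae_haar_iff.1 (MemLp.coeFn_toLp _)

theorem fourierCoeff_complexify (f : L2 L) (n : ℤ) :
    fourierCoeff (complexify f) n = fc f n :=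
  congrFun (fourierCoeff_congr_ae (MemLp.coeFn_toLp (L2.memLp_ofReal f))) n

theorem norm_sq_eq_integral (f : L2 L) : ‖f‖ ^ 2 = ∫ x : AddCircle L, f x ^ 2 := by
  have h := real_inner_self_eq_norm_sq f
  rw [← h, L2.inner_def]
  simp [pow_two]

theorem inner_eq_integral (f g : L2 L) : inner ℝ f g = ∫ x : AddCircle L, f x * g x := by
  rw [L2.inner_def]
  refine integral_congr_ae (Eventually.of_forall fun x => ?_)
  simp [mul_comm]

theorem hasSum_norm_sq_fc (f : L2 L) : HasSum (fun n => ‖fc f n‖ ^ 2) (L⁻¹ * ‖f‖ ^ 2) := by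
  have h := hasSum_sq_fourierCoeff (complexify f)
  simp only [fourierCoeff_complexify] at h
  convert h using 1
  rw [norm_sq_eq_integral, AddCircle.integral_haarAddCircle, smul_eq_mul]
  congr 1
  refine integral_congr_ae ?_
  filter_upwards [coeFn_complexify f] with x hx
  rw [hx, Complex.norm_real, Real.norm_eq_abs, sq_abs]

theorem hasSum_fc_mul_fc (f g : L2 L) :
    HasSum (fun n => (starRingEnd ℂ) (fc f n) * fc g n) ((L⁻¹ * inner ℝ f g : ℝ) : ℂ) := by
  have h := fourierBasis.hasSum_inner_mul_inner (complexify f) (complexify g)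
  have h1 : ∀ n, inner ℂ (complexify f) (fourierBasis n) * inner ℂ (fourierBasis n) (complexify g)
      = (starRingEnd ℂ) (fc f n) * fc g n := by
    intro n
    rw [← fourierBasis.repr_apply_apply, fourierBasis_repr, fourierCoeff_complexify,
      ← inner_conj_symm, ← fourierBasis.repr_apply_apply, fourierBasis_repr,
      fourierCoeff_complexify]
  simp only [h1] at h
  suffices h2 : inner ℂ (complexify f) (complexify g) = ((L⁻¹ * inner ℝ f g : ℝ) : ℂ) by
    rwa [h2] at h
  rw [inner_eq_integral, L2.inner_def, AddCircle.integral_haarAddCircle, Complex.ofReal_mul,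
    Complex.real_smul, ← integral_complex_ofReal]
  congr 1
  refine integral_congr_ae ?_
  filter_upwards [coeFn_complexify f, coeFn_complexify g] with x hx hy
  rw [hx, hy]
  simp [mul_comm]

theorem ext_fc {f g : L2 L} (h : ∀ n, fc f n = fc g n) : f = g := by
  have h1 := hasSum_norm_sq_fc (f - g)
  simp only [fc_sub, h, sub_self, norm_zero, ne_eq, OfNat.ofNat_ne_zero, not_false_eq_true,
    zero_pow] at h1
  have h2 := h1.unique hasSum_zero
  have h3 : L⁻¹ ≠ 0 := inv_ne_zero hL.out.ne'
  have h4 : ‖f - g‖ ^ 2 = 0 := by simpa [h3] using h2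
  exact sub_eq_zero.1 (norm_eq_zero.1 (pow_eq_zero_iff (two_ne_zero) |>.1 h4))

/-- Riesz–Fischer for real functions. -/
theorem exists_fc_eq {a : ℤ → ℂ} (ha : Summable fun n => ‖a n‖ ^ 2)
    (hs : ∀ n, a (-n) = (starRingEnd ℂ) (a n)) : ∃ f : L2 L, ∀ n, fc f n = a n := by
  have hm : Memℓp a 2 := by
    rw [memℓp_gen_iff (by norm_num)]
    simpa using ha
  set G : Lp ℂ 2 (AddCircle.haarAddCircle (T := L)) := fourierBasis.repr.symm ⟨a, hm⟩ with hG
  have hc : ∀ n, fourierCoeff G n = a n := by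
    intro n
    rw [← fourierBasis_repr, hG, LinearIsometryEquiv.apply_symm_apply]
  have hGm : MemLp G 2 (volume : Measure (AddCircle L)) :=
    memLp_haarAddCircle_iff.1 (Lp.memLp G)
  have hGi : Integrable G (volume : Measure (AddCircle L)) := hGm.integrable (by norm_num)
  -- The real part has coefficients `(a n + conj (a (-n))) / 2`, which equal `a n` by the symmetry
  -- `hs`.
  refine ⟨hGm.re.toLp _, fun n => ?_⟩
  rw [fc_congr (MemLp.coeFn_toLp hGm.re)]
  have hint : ∀ k : ℤ, Integrable (fun x => fourier k x * G x)
      (volume : Measure (AddCircle L)) := fun k =>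
    Integrable.bdd_mul (c := 1) hGi (map_continuous (fourier k)).aestronglyMeasurable
      (Eventually.of_forall fun x => by rw [fourier_apply, Circle.norm_coe])
  have hce : ∀ k, ((L⁻¹ : ℝ) : ℂ) * ∫ x : AddCircle L, fourier (-k) x * G x = a k := by
    intro k
    rw [← hc k, fourierCoeff, AddCircle.integral_haarAddCircle]
    simp [Complex.real_smul]
  have hre : ∀ x, fourier (-n) x * ((RCLike.re (G x) : ℝ) : ℂ)
      = (1 / 2 : ℂ) * (fourier (-n) x * G x)
        + (1 / 2 : ℂ) * (starRingEnd ℂ) (fourier (-(-n)) x * G x) := by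
    intro x
    have h1 : ((RCLike.re (G x) : ℝ) : ℂ) = (G x + (starRingEnd ℂ) (G x)) / 2 := by
      rw [Complex.add_conj]; simp
    rw [h1, map_mul, ← fourier_neg]
    simp only [neg_neg]
    ring
  simp only [hre]
  have hcj : Integrable (fun x => (starRingEnd ℂ) (fourier (-(-n)) x * G x))
      (volume : Measure (AddCircle L)) := by
    have := (hint (-(-n)))
    exact (Complex.conjLIE.integrable_comp_iff).2 this
  rw [integral_add ((hint _).const_mul _) (hcj.const_mul _), integral_const_mul,
    integral_const_mul, integral_conj]
  have h1 := hce n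
  have h2 := congrArg (starRingEnd ℂ) (hce (-n))
  rw [map_mul, Complex.conj_ofReal, hs, Complex.conj_conj] at h2
  linear_combination (1 / 2 : ℂ) * h1 + (1 / 2 : ℂ) * h2

theorem fc_multiplier_summable (f : L2 L) {c : ℤ → ℂ} (hc : ∀ n, ‖c n‖ ≤ 1) :
    Summable fun n => ‖c n * fc f n‖ ^ 2 := by
  refine Summable.of_nonneg_of_le (fun n => by positivity) (fun n => ?_)
    (hasSum_norm_sq_fc f).summable
  rw [norm_mul]
  gcongr
  exact mul_le_of_le_one_left (norm_nonneg _) (hc n)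

/-- Symmetry of the symbol under conjugation keeps the result real. This yields both the Hilbert
transform and the frequency truncations used for density. -/
theorem exists_fc_multiplier (f : L2 L) {c : ℤ → ℂ} (hc : ∀ n, ‖c n‖ ≤ 1)
    (hs : ∀ n, c (-n) = (starRingEnd ℂ) (c n)) : ∃ g : L2 L, ∀ n, fc g n = c n * fc f n := by
  refine exists_fc_eq (fc_multiplier_summable f hc) fun n => ?_
  rw [map_mul, hs, fc_neg_index]

/-! ### Continuous functions as elements of `L²`, and multiplication by them -/

/-- The class in `L²` of a continuous function. -/
def toL : C(AddCircle L, ℝ) →L[ℝ] L2 L := ContinuousMap.toLp 2 volume ℝ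

theorem coeFn_toL (F : C(AddCircle L, ℝ)) : toL F =ᵐ[volume] F :=
  ContinuousMap.coeFn_toLp volume F

theorem toL_injective : Function.Injective (toL (L := L)) :=
  ContinuousMap.toLp_injective volume

theorem memLp_mulc (F : C(AddCircle L, ℝ)) (f : L2 L) :
    MemLp (fun x => F x * f x) 2 (volume : Measure (AddCircle L)) := by
  refine MemLp.of_le_mul (c := ‖F‖) (Lp.memLp f)
    ((map_continuous F).aestronglyMeasurable.mul (Lp.aestronglyMeasurable f)) ?_
  refine Eventually.of_forall fun x => ?_
  rw [norm_mul]
  gcongr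
  exact F.norm_coe_le_norm x

/-- The product of a continuous function and an `L²` function. -/
def mulc (F : C(AddCircle L, ℝ)) (f : L2 L) : L2 L := (memLp_mulc F f).toLp _

theorem coeFn_mulc (F : C(AddCircle L, ℝ)) (f : L2 L) :
    mulc F f =ᵐ[volume] fun x => F x * f x := MemLp.coeFn_toLp _

theorem mulc_add (F : C(AddCircle L, ℝ)) (f g : L2 L) : mulc F (f + g) = mulc F f + mulc F g := by
  refine Lp.ext ?_
  filter_upwards [coeFn_mulc F (f + g), coeFn_mulc F f, coeFn_mulc F g, Lp.coeFn_add f g,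
    Lp.coeFn_add (mulc F f) (mulc F g)] with x h1 h2 h3 h4 h5
  simp only [h1, h5, h4, Pi.add_apply, h2, h3, mul_add]

theorem mulc_smul (F : C(AddCircle L, ℝ)) (c : ℝ) (f : L2 L) : mulc F (c • f) = c • mulc F f := by
  refine Lp.ext ?_
  filter_upwards [coeFn_mulc F (c • f), coeFn_mulc F f, Lp.coeFn_smul c f,
    Lp.coeFn_smul c (mulc F f)] with x h1 h2 h4 h5
  simp only [h1, h5, h4, Pi.smul_apply, h2, smul_eq_mul]
  ring

theorem add_mulc (F G : C(AddCircle L, ℝ)) (f : L2 L) : mulc (F + G) f = mulc F f + mulc G f := by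
  refine Lp.ext ?_
  filter_upwards [coeFn_mulc (F + G) f, coeFn_mulc F f, coeFn_mulc G f,
    Lp.coeFn_add (mulc F f) (mulc G f)] with x h1 h2 h3 h5
  simp only [h1, h5, Pi.add_apply, h2, h3, ContinuousMap.add_apply, add_mul]

theorem smul_mulc (c : ℝ) (F : C(AddCircle L, ℝ)) (f : L2 L) : mulc (c • F) f = c • mulc F f := by
  refine Lp.ext ?_
  filter_upwards [coeFn_mulc (c • F) f, coeFn_mulc F f, Lp.coeFn_smul c (mulc F f)]
    with x h1 h2 h5
  simp only [h1, h5, Pi.smul_apply, h2, smul_eq_mul, ContinuousMap.smul_apply]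
  ring

theorem mulc_mulc (F G : C(AddCircle L, ℝ)) (f : L2 L) : mulc F (mulc G f) = mulc (F * G) f := by
  refine Lp.ext ?_
  filter_upwards [coeFn_mulc (F * G) f, coeFn_mulc F (mulc G f), coeFn_mulc G f]
    with x h1 h2 h3
  simp only [h1, h2, h3, ContinuousMap.mul_apply]
  ring

theorem mulc_toL (F G : C(AddCircle L, ℝ)) : mulc F (toL G) = toL (F * G) := by
  refine Lp.ext ?_
  filter_upwards [coeFn_mulc F (toL G), coeFn_toL G, coeFn_toL (F * G)] with x h1 h2 h3
  rw [h1, h2, h3, ContinuousMap.mul_apply]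

theorem norm_mulc_le {F : C(AddCircle L, ℝ)} {c : ℝ} (hF : ∀ x, |F x| ≤ c) (f : L2 L) :
    ‖mulc F f‖ ≤ c * ‖f‖ := by
  refine Lp.norm_le_mul_norm_of_ae_le_mul ?_
  filter_upwards [coeFn_mulc F f] with x h1
  rw [h1, norm_mul]
  gcongr
  exact hF x

theorem norm_toL_le {F : C(AddCircle L, ℝ)} {c : ℝ} (hF : ∀ x, |F x| ≤ c) :
    ‖toL F‖ ≤ √L * c := by
  have hc : 0 ≤ c := (abs_nonneg _).trans (hF 0)
  have h : ‖toL F‖ ^ 2 ≤ (√L * c) ^ 2 := by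
    rw [norm_sq_eq_integral, mul_pow, Real.sq_sqrt hL.out.le]
    have h1 : ∫ x : AddCircle L, toL F x ^ 2 ≤ ∫ _ : AddCircle L, c ^ 2 := by
      refine integral_mono_ae ?_ (integrable_const _) ?_
      · exact (Lp.memLp (toL F)).integrable_sq
      · filter_upwards [coeFn_toL F] with x hx
        rw [hx]
        exact sq_le_sq' (neg_le_of_abs_le (hF x)) (le_of_abs_le (hF x))
    refine h1.trans (le_of_eq ?_)
    simp [Measure.real, AddCircle.measure_univ, hL.out.le]
  exact le_of_sq_le_sq h (by positivity)

/-! ### Passing between the circle and the line -/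

theorem ae_coe {p : AddCircle L → Prop} (h : ∀ᵐ z : AddCircle L, p z) :
    ∀ᵐ x : ℝ, p (x : AddCircle L) := by
  have h1 : ∀ n : ℤ, ∀ᵐ x : ℝ ∂(volume.restrict (Ioc (n • L) ((n + 1) • L))), p (x : AddCircle L) := by
    intro n
    have := (AddCircle.measurePreserving_mk L (n • L)).quasiMeasurePreserving.ae h
    rwa [add_zsmul, one_zsmul]
  have h2 : (⋃ n : ℤ, Ioc (n • L) ((n + 1) • L)) = univ := iUnion_Ioc_zsmul hL.out
  rw [← Measure.restrict_univ (μ := (volume : Measure ℝ)), ← h2]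
  exact (ae_restrict_iUnion_iff (fun n : ℤ => Ioc (n • L) ((n + 1) • L))
    (fun x : ℝ => p (x : AddCircle L))).2 h1

theorem periodic_coe {E : Type*} (g : AddCircle L → E) :
    Function.Periodic (fun s : ℝ => g (s : AddCircle L)) L := fun x => by simp

theorem intervalIntegrable_coe (g : L2 L) (a b : ℝ) :
    IntervalIntegrable (fun s : ℝ => g (s : AddCircle L)) volume a b := by
  refine (periodic_coe g).intervalIntegrable₀ hL.out.ne' ?_ a b
  have := intervalIntegrable_coe_mul g (continuous_const (y := (1 : ℝ)))
  simpa using this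

theorem intervalIntegrable_coe_sq (g : L2 L) (a b : ℝ) :
    IntervalIntegrable (fun s : ℝ => g (s : AddCircle L) ^ 2) volume a b := by
  refine (periodic_coe fun z => g z ^ 2).intervalIntegrable₀ hL.out.ne' ?_ a b
  rw [intervalIntegrable_iff_integrableOn_Ioc_of_le hL.out.le]
  exact (measurePreserving_coe (L := L)).integrable_comp_of_integrable (Lp.memLp g).integrable_sq

theorem integral_coe {E : Type*} [NormedAddCommGroup E] [NormedSpace ℝ E] (g : AddCircle L → E) :
    ∫ s in (0 : ℝ)..L, g s = ∫ z : AddCircle L, g z := by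
  simpa using AddCircle.intervalIntegral_preimage L 0 g

theorem locallyIntegrable_coe (g : L2 L) :
    LocallyIntegrable (fun s : ℝ => g (s : AddCircle L)) volume := by
  rw [locallyIntegrable_iff]
  intro K hK
  obtain ⟨a, b, h⟩ : ∃ a b : ℝ, K ⊆ Ioc a b := by
    obtain ⟨r, hr⟩ := hK.isBounded.subset_ball 0
    rw [Real.ball_eq_Ioo] at hr
    exact ⟨_, _, hr.trans Ioo_subset_Ioc_self⟩
  exact ((intervalIntegrable_coe g a b).1).mono_set h

/-! ### Primitives -/

/-- `F` is a primitive of the `L²` function `g`. -/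
def IsPrim (F : C(AddCircle L, ℝ)) (g : L2 L) : Prop :=
  ∀ x : ℝ, F (x : AddCircle L) = F 0 + ∫ s in (0 : ℝ)..x, g (s : AddCircle L)

theorem IsPrim.sub_eq {F : C(AddCircle L, ℝ)} {g : L2 L} (h : IsPrim F g) (x y : ℝ) :
    F (y : AddCircle L) - F (x : AddCircle L) = ∫ s in x..y, g (s : AddCircle L) := by
  rw [h x, h y, ← intervalIntegral.integral_add_adjacent_intervals
    (intervalIntegrable_coe g 0 x) (intervalIntegrable_coe g x y)]
  ring

/-- Absolute continuity gives the product rule, the chain rule and integration by parts although the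
derivative is only square integrable. -/
theorem IsPrim.ac {F : C(AddCircle L, ℝ)} {g : L2 L} (h : IsPrim F g) (a b : ℝ) :
    AbsolutelyContinuousOnInterval (fun x : ℝ => F (x : AddCircle L)) a b := by
  have h1 := ((intervalIntegrable_coe g a b).absolutelyContinuousOnInterval_intervalIntegral
    (c := a) (by simp))
  have h2 : AbsolutelyContinuousOnInterval (fun _ : ℝ => F (a : AddCircle L)) a b :=
    (contDiff_const (n := 1)).contDiffOn.absolutelyContinuousOnInterval
  have h3 : (fun x : ℝ => F (x : AddCircle L))
      = fun x : ℝ => F (a : AddCircle L) + ∫ s in a..x, g (s : AddCircle L) := by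
    funext x
    rw [← h.sub_eq]
    ring
  rw [h3]
  exact h2.add h1

theorem IsPrim.ae_hasDerivAt {F : C(AddCircle L, ℝ)} {g : L2 L} (h : IsPrim F g) :
    ∀ᵐ x : ℝ, HasDerivAt (fun x : ℝ => F (x : AddCircle L)) (g (x : AddCircle L)) x := by
  filter_upwards [LocallyIntegrable.ae_hasDerivAt_integral (locallyIntegrable_coe g)] with x hx
  have h1 := (hx 0).const_add (F 0)
  exact h1.congr_of_eventuallyEq (Eventually.of_forall fun y => h y)

/-- The fundamental theorem of calculus for absolutely continuous functions. With `IsPrim.ac` and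
`IsPrim.ae_hasDerivAt` it reduces the calculus of `IsPrim` to pointwise derivatives. -/
theorem isPrim_of_ac {F : C(AddCircle L, ℝ)} {g : L2 L}
    (hac : ∀ a b, AbsolutelyContinuousOnInterval (fun x : ℝ => F (x : AddCircle L)) a b)
    (hd : ∀ᵐ x : ℝ, HasDerivAt (fun x : ℝ => F (x : AddCircle L)) (g (x : AddCircle L)) x) :
    IsPrim F g := by
  intro x
  have h1 := (hac 0 x).integral_deriv_eq_sub
  have h2 : ∫ s in (0 : ℝ)..x, g (s : AddCircle L)
      = ∫ s in (0 : ℝ)..x, deriv (fun x : ℝ => F (x : AddCircle L)) s := by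
    refine intervalIntegral.integral_congr_ae ?_
    filter_upwards [hd] with s hs _
    exact hs.deriv.symm
  rw [h2, h1]
  simp

theorem IsPrim.mul {F G : C(AddCircle L, ℝ)} {f g : L2 L} (hF : IsPrim F f) (hG : IsPrim G g) :
    IsPrim (F * G) (mulc F g + mulc G f) := by
  refine isPrim_of_ac (fun a b => (hF.ac a b).fun_mul (hG.ac a b)) ?_
  filter_upwards [hF.ae_hasDerivAt, hG.ae_hasDerivAt, ae_coe (coeFn_mulc F g),
    ae_coe (coeFn_mulc G f), ae_coe (Lp.coeFn_add (mulc F g) (mulc G f))] with x h1 h2 h3 h4 h5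
  rw [h5, Pi.add_apply, h3, h4]
  rw [add_comm, mul_comm (G _)]
  exact h1.mul h2

theorem ac_comp_lipschitz {f φ : ℝ → ℝ} {a b : ℝ} (hf : AbsolutelyContinuousOnInterval f a b)
    {K : ℝ} (hK : 0 < K) (hφ : ∀ x y, |φ (f x) - φ (f y)| ≤ K * |f x - f y|) :
    AbsolutelyContinuousOnInterval (fun x => φ (f x)) a b := by
  rw [absolutelyContinuousOnInterval_iff] at hf ⊢
  intro ε hε
  obtain ⟨δ, hδ, h⟩ := hf (ε / K) (by positivity)
  refine ⟨δ, hδ, fun E hE hs => ?_⟩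
  have h1 := h E hE hs
  calc _ ≤ ∑ i ∈ Finset.range E.1, K * dist (f (E.2 i).1) (f (E.2 i).2) :=
        Finset.sum_le_sum fun i _ => hφ _ _
    _ = K * ∑ i ∈ Finset.range E.1, dist (f (E.2 i).1) (f (E.2 i).2) := by rw [Finset.mul_sum]
    _ < K * (ε / K) := by gcongr
    _ = ε := by field_simp

/-- `exp ∘ F`. -/
def cexp (F : C(AddCircle L, ℝ)) : C(AddCircle L, ℝ) := ⟨fun x => Real.exp (F x), by fun_prop⟩

@[simp] theorem cexp_apply (F : C(AddCircle L, ℝ)) (x : AddCircle L) :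
    cexp F x = Real.exp (F x) := rfl

theorem abs_exp_sub_exp_le {a b M : ℝ} (ha : |a| ≤ M) (hb : |b| ≤ M) :
    |Real.exp a - Real.exp b| ≤ Real.exp M * |a - b| := by
  wlog h : b ≤ a generalizing a b
  · rw [abs_sub_comm, abs_sub_comm a]
    exact this hb ha (le_of_not_ge h)
  have h1 : Real.exp a - Real.exp b ≤ Real.exp a * (a - b) := by
    have h2 := Real.add_one_le_exp (b - a)
    have h3 : Real.exp b = Real.exp a * Real.exp (b - a) := by rw [← Real.exp_add]; ring_nf
    have := mul_le_mul_of_nonneg_left h2 (Real.exp_pos a).le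
    rw [h3]
    linarith
  rw [abs_of_nonneg (sub_nonneg.2 (Real.exp_le_exp.2 h)), abs_of_nonneg (sub_nonneg.2 h)]
  refine h1.trans ?_
  have h2 : 0 ≤ a - b := sub_nonneg.2 h
  have h3 := le_of_abs_le ha
  gcongr

theorem IsPrim.exp {F : C(AddCircle L, ℝ)} {f : L2 L} (hF : IsPrim F f) :
    IsPrim (cexp F) (mulc (cexp F) f) := by
  refine isPrim_of_ac (fun a b => ?_) ?_
  · exact ac_comp_lipschitz (φ := Real.exp) (hF.ac a b) (Real.exp_pos ‖F‖) fun x y =>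
      abs_exp_sub_exp_le (F.norm_coe_le_norm _) (F.norm_coe_le_norm _)
  · filter_upwards [hF.ae_hasDerivAt, ae_coe (coeFn_mulc (cexp F) f)] with x h1 h3
    rw [h3]
    exact h1.exp

/-- Integration by parts over one period; the boundary terms cancel by periodicity. -/
theorem IsPrim.hasWeakDeriv {F : C(AddCircle L, ℝ)} {g : L2 L} (h : IsPrim F g) :
    HasWeakDeriv (toL F) g := by
  intro φ hφ hp
  have hφac : AbsolutelyContinuousOnInterval φ 0 L :=
    (hφ.of_le (by simp : (1 : WithTop ℕ∞) ≤ ((⊤ : ℕ∞) : WithTop ℕ∞))).contDiffOn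
      |>.absolutelyContinuousOnInterval
  have h1 := (h.ac 0 L).integral_mul_deriv_eq_deriv_mul hφac
  have h2 : φ L = φ 0 := by simpa using hp 0
  have h3 : ∫ x in (0 : ℝ)..L, toL F (x : AddCircle L) * deriv φ x
      = ∫ x in (0 : ℝ)..L, F (x : AddCircle L) * deriv φ x := by
    refine intervalIntegral.integral_congr_ae ?_
    filter_upwards [ae_coe (coeFn_toL F)] with x hx _
    rw [hx]
  have h4 : ∫ x in (0 : ℝ)..L, g (x : AddCircle L) * φ x
      = ∫ x in (0 : ℝ)..L, deriv (fun x : ℝ => F (x : AddCircle L)) x * φ x := by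
    refine intervalIntegral.integral_congr_ae ?_
    filter_upwards [h.ae_hasDerivAt] with x hx _
    rw [hx.deriv]
  rw [h3, h4, h1, h2, AddCircle.coe_period, AddCircle.coe_zero]
  ring

theorem exists_isPrim {g : L2 L} (hg : ∫ s in (0 : ℝ)..L, g (s : AddCircle L) = 0) :
    ∃ F : C(AddCircle L, ℝ), IsPrim F g ∧ F 0 = 0 := by
  have hc : Continuous fun x : ℝ => ∫ s in (0 : ℝ)..x, g (s : AddCircle L) :=
    intervalIntegral.continuous_primitive (intervalIntegrable_coe g) 0
  have hp : Function.Periodic (fun x : ℝ => ∫ s in (0 : ℝ)..x, g (s : AddCircle L)) L := by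
    intro x
    have := intervalIntegral.integral_add_adjacent_intervals
      (intervalIntegrable_coe g 0 x) (intervalIntegrable_coe g x (x + L))
    have h2 := (periodic_coe g).intervalIntegral_add_eq x 0
    rw [zero_add, hg] at h2
    simp only [← this, h2, add_zero]
  refine ⟨⟨hp.lift, ?_⟩, fun x => ?_, ?_⟩
  · exact continuous_coinduced_dom.2 hc
  · have h0 : hp.lift (0 : AddCircle L) = 0 := by
      rw [← AddCircle.coe_zero, Function.Periodic.lift_coe]; simp
    simp only [ContinuousMap.coe_mk, Function.Periodic.lift_coe, h0, zero_add]
  · simp only [ContinuousMap.coe_mk]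
    rw [← AddCircle.coe_zero, Function.Periodic.lift_coe]; simp

/-! ### Weak derivatives and Fourier coefficients -/

/-- Weak derivatives are tested against real functions only, so the exponential is split into cosine
and sine. -/
theorem fc_eq_cos_sin (f : L2 L) (n : ℤ) :
    fc f n = ((L⁻¹ : ℝ) : ℂ) *
      (((∫ x in (0 : ℝ)..L, f (x : AddCircle L) * Real.cos (2 * Real.pi * n / L * x) : ℝ) : ℂ)
        - Complex.I *
        ((∫ x in (0 : ℝ)..L, f (x : AddCircle L) * Real.sin (2 * Real.pi * n / L * x) : ℝ) : ℂ)) := by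
  have hc : Continuous fun x : ℝ => Real.cos (2 * Real.pi * n / L * x) := by fun_prop
  have hs : Continuous fun x : ℝ => Real.sin (2 * Real.pi * n / L * x) := by fun_prop
  rw [fc, fourierCoeff_eq_intervalIntegral _ n 0, ← intervalIntegral.integral_ofReal,
    ← intervalIntegral.integral_ofReal, ← intervalIntegral.integral_const_mul,
    ← intervalIntegral.integral_sub]
  · rw [zero_add, Complex.real_smul, one_div]
    congr 1
    refine intervalIntegral.integral_congr fun x _ => ?_
    simp only [fourier_coe_apply, smul_eq_mul, Complex.ofReal_mul]
    have h1 : 2 * (Real.pi : ℂ) * Complex.I * ((-n : ℤ) : ℂ) * (x : ℂ) / (L : ℂ)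
        = (((-(2 * Real.pi * n / L * x) : ℝ)) : ℂ) * Complex.I := by
      push_cast; ring
    rw [h1, Complex.exp_mul_I, ← Complex.ofReal_cos, ← Complex.ofReal_sin, Real.cos_neg,
      Real.sin_neg, Complex.ofReal_neg]
    ring
  · exact ⟨(intervalIntegrable_coe_mul f hc).1.ofReal, (intervalIntegrable_coe_mul f hc).2.ofReal⟩
  · exact IntervalIntegrable.const_mul ⟨(intervalIntegrable_coe_mul f hs).1.ofReal,
      (intervalIntegrable_coe_mul f hs).2.ofReal⟩ _

/-- The frequency `2πn/L`. -/
def freq (L : ℝ) (n : ℤ) : ℝ := 2 * Real.pi * n / L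

theorem freq_ne_zero {n : ℤ} (hn : n ≠ 0) : freq L n ≠ 0 := by
  have h1 : (n : ℝ) ≠ 0 := Int.cast_ne_zero.2 hn
  have h2 := hL.out.ne'
  have h3 := Real.pi_ne_zero
  unfold freq
  positivity

theorem fc_of_hasWeakDeriv {f g : L2 L} (h : HasWeakDeriv f g) (n : ℤ) :
    fc g n = (freq L n * Complex.I) * fc f n := by
  set κ := freq L n with hκ
  have hL0 := hL.out.ne'
  have hper : κ * L = n * (2 * Real.pi) := by
    rw [hκ, freq]
    field_simp
  have h1 := h (fun x => Real.cos (κ * x)) (by fun_prop) (fun x => by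
    simp only [mul_add, hper, Real.cos_add_int_mul_two_pi])
  have h2 := h (fun x => Real.sin (κ * x)) (by fun_prop) (fun x => by
    simp only [mul_add, hper, Real.sin_add_int_mul_two_pi])
  have d1 : (deriv fun x => Real.cos (κ * x)) = fun x => (-κ) * Real.sin (κ * x) := by
    funext x
    have : HasDerivAt (fun x => Real.cos (κ * x)) (-Real.sin (κ * x) * (κ * 1)) x :=
      ((hasDerivAt_id x).const_mul κ).cos
    rw [this.deriv]
    ring
  have d2 : (deriv fun x => Real.sin (κ * x)) = fun x => κ * Real.cos (κ * x) := by
    funext x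
    have : HasDerivAt (fun x => Real.sin (κ * x)) (Real.cos (κ * x) * (κ * 1)) x :=
      ((hasDerivAt_id x).const_mul κ).sin
    rw [this.deriv]
    ring
  simp only [d1, d2, mul_left_comm _ (-κ), mul_left_comm _ κ,
    intervalIntegral.integral_const_mul] at h1 h2
  rw [fc_eq_cos_sin, fc_eq_cos_sin]
  change _ * (((∫ x in (0 : ℝ)..L, g (x : AddCircle L) * Real.cos (κ * x) : ℝ) : ℂ) - _ *
    ((∫ x in (0 : ℝ)..L, g (x : AddCircle L) * Real.sin (κ * x) : ℝ) : ℂ)) = _ * (_ *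
    (((∫ x in (0 : ℝ)..L, f (x : AddCircle L) * Real.cos (κ * x) : ℝ) : ℂ) - _ *
    ((∫ x in (0 : ℝ)..L, f (x : AddCircle L) * Real.sin (κ * x) : ℝ) : ℂ)))
  rw [show (∫ x in (0 : ℝ)..L, g (x : AddCircle L) * Real.cos (κ * x))
      = κ * ∫ x in (0 : ℝ)..L, f (x : AddCircle L) * Real.sin (κ * x) by linarith,
    show (∫ x in (0 : ℝ)..L, g (x : AddCircle L) * Real.sin (κ * x))
      = -(κ * ∫ x in (0 : ℝ)..L, f (x : AddCircle L) * Real.cos (κ * x)) by linarith]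
  push_cast
  linear_combination (((L : ℂ)⁻¹) * κ *
    ((∫ x in (0 : ℝ)..L, f (x : AddCircle L) * Real.sin (κ * x) : ℝ) : ℂ)) * Complex.I_sq

theorem HasWeakDeriv.unique {f g g' : L2 L} (h : HasWeakDeriv f g) (h' : HasWeakDeriv f g') :
    g = g' :=
  ext_fc fun n => by rw [fc_of_hasWeakDeriv h, fc_of_hasWeakDeriv h']

theorem fc_zero_eq (f : L2 L) : fc f 0 = ((L⁻¹ * ∫ x : AddCircle L, f x : ℝ) : ℂ) := by
  rw [fc_eq_integral, Complex.ofReal_mul, ← integral_complex_ofReal]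
  simp

theorem isPrim_const (c : ℝ) : IsPrim (ContinuousMap.const (AddCircle L) c) 0 := by
  intro x
  simp

theorem fc_const (c : ℝ) (n : ℤ) :
    fc (toL (ContinuousMap.const (AddCircle L) c)) n = if n = 0 then (c : ℂ) else 0 := by
  split_ifs with hn
  · subst hn
    have h : ∫ x : AddCircle L, toL (ContinuousMap.const (AddCircle L) c) x = L * c := by
      rw [integral_congr_ae (coeFn_toL _)]
      simp [Measure.real, AddCircle.measure_univ, hL.out.le]
    rw [fc_zero_eq, h]
    congr 1
    field_simp [hL.out.ne']
  · have h1 := fc_of_hasWeakDeriv (isPrim_const (L := L) c).hasWeakDeriv n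
    have h2 : fc (0 : L2 L) n = 0 := by
      have := fc_smul (0 : ℝ) (0 : L2 L) n
      simpa using this
    rw [h2] at h1
    have h3 : ((freq L n : ℝ) : ℂ) * Complex.I ≠ 0 :=
      mul_ne_zero (Complex.ofReal_ne_zero.2 (freq_ne_zero hn)) Complex.I_ne_zero
    exact (mul_eq_zero.1 h1.symm).resolve_left h3

theorem IsPrim.add {F G : C(AddCircle L, ℝ)} {f g : L2 L} (hF : IsPrim F f) (hG : IsPrim G g) :
    IsPrim (F + G) (f + g) := by
  intro x
  have h : ∫ s in (0 : ℝ)..x, (f + g : L2 L) (s : AddCircle L)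
      = (∫ s in (0 : ℝ)..x, f (s : AddCircle L)) + ∫ s in (0 : ℝ)..x, g (s : AddCircle L) := by
    rw [← intervalIntegral.integral_add (intervalIntegrable_coe _ _ _)
      (intervalIntegrable_coe _ _ _)]
    refine intervalIntegral.integral_congr_ae ?_
    filter_upwards [ae_coe (Lp.coeFn_add f g)] with s hs _
    rw [hs]; rfl
  rw [h, ContinuousMap.add_apply, ContinuousMap.add_apply, hF x, hG x]
  ring

theorem IsPrim.smul {F : C(AddCircle L, ℝ)} {f : L2 L} (c : ℝ) (hF : IsPrim F f) :
    IsPrim (c • F) (c • f) := by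
  intro x
  have h : ∫ s in (0 : ℝ)..x, (c • f : L2 L) (s : AddCircle L)
      = c * ∫ s in (0 : ℝ)..x, f (s : AddCircle L) := by
    rw [← intervalIntegral.integral_const_mul]
    refine intervalIntegral.integral_congr_ae ?_
    filter_upwards [ae_coe (Lp.coeFn_smul c f)] with s hs _
    rw [hs]; rfl
  rw [h, ContinuousMap.smul_apply, ContinuousMap.smul_apply, hF x, smul_eq_mul, smul_eq_mul]
  ring

/-- At `n = 0` the relation says that `g` has mean zero, so its primitive is periodic. Off `n = 0`
the frequency is invertible, so the primitive has the coefficients of `f`; a constant corrects the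
mean. Weak derivatives, Fourier coefficients and primitives are thus interchangeable descriptions.
-/
theorem exists_isPrim_of_fc {f g : L2 L} (h : ∀ n, fc g n = (freq L n * Complex.I) * fc f n) :
    ∃ F : C(AddCircle L, ℝ), f = toL F ∧ IsPrim F g := by
  have h0 : ∫ s in (0 : ℝ)..L, g (s : AddCircle L) = 0 := by
    have h1 := h 0
    rw [fc_zero_eq] at h1
    have h2 : freq L 0 = 0 := by simp [freq]
    rw [h2] at h1
    rw [integral_coe (fun z => g z)]
    have h3 : L⁻¹ * ∫ x : AddCircle L, g x = 0 := by
      apply Complex.ofReal_injective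
      rw [h1]; simp
    exact (mul_eq_zero.1 h3).resolve_left (inv_ne_zero hL.out.ne')
  obtain ⟨F, hF, -⟩ := exists_isPrim h0
  set c : ℝ := L⁻¹ * (∫ x : AddCircle L, f x) - L⁻¹ * ∫ x : AddCircle L, toL F x with hc
  refine ⟨F + ContinuousMap.const _ c, ext_fc fun n => ?_, ?_⟩
  · rw [map_add, fc_add, fc_const]
    split_ifs with hn
    · subst hn
      rw [fc_zero_eq, fc_zero_eq, hc]
      push_cast
      ring
    · have h1 := fc_of_hasWeakDeriv hF.hasWeakDeriv n
      have h3 : ((freq L n : ℝ) : ℂ) * Complex.I ≠ 0 :=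
        mul_ne_zero (Complex.ofReal_ne_zero.2 (freq_ne_zero hn)) Complex.I_ne_zero
      rw [h n] at h1
      rw [add_zero]
      exact mul_left_cancel₀ h3 h1
  · have := hF.add (isPrim_const (L := L) c)
    rwa [add_zero] at this

theorem HasWeakDeriv.exists_isPrim {f g : L2 L} (h : HasWeakDeriv f g) :
    ∃ F : C(AddCircle L, ℝ), f = toL F ∧ IsPrim F g :=
  exists_isPrim_of_fc (fc_of_hasWeakDeriv h)

theorem hasWeakDeriv_of_fc {f g : L2 L} (h : ∀ n, fc g n = (freq L n * Complex.I) * fc f n) :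
    HasWeakDeriv f g := by
  obtain ⟨F, rfl, hF⟩ := exists_isPrim_of_fc h
  exact hF.hasWeakDeriv

theorem hasWeakDeriv_toL {F : C(AddCircle L, ℝ)} {g : L2 L} :
    HasWeakDeriv (toL F) g ↔ IsPrim F g := by
  refine ⟨fun h => ?_, fun h => h.hasWeakDeriv⟩
  obtain ⟨G, h1, h2⟩ := h.exists_isPrim
  rwa [toL_injective h1]

theorem HasWeakDeriv.integral_eq_zero {f g : L2 L} (h : HasWeakDeriv f g) :
    ∫ x : AddCircle L, g x = 0 := by
  obtain ⟨F, -, hF⟩ := h.exists_isPrim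
  have := hF L
  rw [AddCircle.coe_period, integral_coe (fun z => g z)] at this
  linarith

/-- Trigonometric polynomials, hence functions with a weak derivative, are dense in `L²`. -/
theorem exists_hasWeakDeriv_near (f : L2 L) {ε : ℝ} (hε : 0 < ε) :
    ∃ g g' : L2 L, HasWeakDeriv g g' ∧ ‖f - g‖ ≤ ε := by
  have hsum := hasSum_norm_sq_fc f
  have hL0 := hL.out
  have hε2 : 0 < L⁻¹ * ε ^ 2 := by positivity
  obtain ⟨s, hs⟩ := (Metric.tendsto_atTop.1 hsum) _ hε2
  obtain ⟨N, hN⟩ : ∃ N : ℤ, ∀ n ∈ s, |n| ≤ N :=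
    ⟨∑ n ∈ s, |n|, fun n hn => Finset.single_le_sum (f := fun n : ℤ => |n|)
      (fun _ _ => abs_nonneg _) hn⟩
  -- The truncation must be symmetric under `n ↦ -n` for the truncated function to be real.
  set t : Finset ℤ := Finset.Icc (-N) N with ht
  have hst : s ⊆ t := fun n hn => Finset.mem_Icc.2 (abs_le.1 (hN n hn))
  have hneg : ∀ n, -n ∈ t ↔ n ∈ t := fun n => by
    simp only [ht, Finset.mem_Icc]; constructor <;> rintro ⟨h1, h2⟩ <;> constructor <;> linarith
  set c : ℤ → ℂ := fun n => if n ∈ t then 1 else 0 with hc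
  obtain ⟨g, hg⟩ := exists_fc_multiplier f (c := c)
    (fun n => by simp only [hc]; split_ifs <;> simp)
    (fun n => by simp only [hc, hneg]; split_ifs <;> simp)
  have hfin : Summable fun n => ‖(freq L n * Complex.I) * fc g n‖ ^ 2 := by
    refine summable_of_ne_finset_zero (s := t) fun n hn => ?_
    simp [hg, hc, hn]
  obtain ⟨g', hg'⟩ := exists_fc_eq (L := L) hfin fun n => by
    rw [fc_neg_index, map_mul, map_mul, Complex.conj_ofReal, Complex.conj_I]
    simp [freq, mul_div_assoc, neg_div]
  refine ⟨g, g', hasWeakDeriv_of_fc hg', ?_⟩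
  have h1 := hasSum_norm_sq_fc (f - g)
  have h2 : HasSum (fun n => if n ∈ t then ‖fc f n‖ ^ 2 else 0) (∑ n ∈ t, ‖fc f n‖ ^ 2) := by
    have := hasSum_sum_of_ne_finset_zero (s := t) (L := SummationFilter.unconditional ℤ)
      (f := fun n => if n ∈ t then ‖fc f n‖ ^ 2 else 0) (fun n hn => by simp [hn])
    rwa [Finset.sum_congr rfl (fun n hn => if_pos hn)] at this
  have heq : (fun n => ‖fc f n‖ ^ 2 - if n ∈ t then ‖fc f n‖ ^ 2 else 0)
      = fun n => ‖fc (f - g) n‖ ^ 2 := by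
    funext n
    rw [fc_sub, hg]
    simp only [hc]
    split_ifs <;> simp
  have h3' := hsum.sub h2
  rw [heq] at h3'
  have h3 := h3'.unique h1
  have h4 := hs t hst
  rw [Real.dist_eq, abs_sub_comm, h3] at h4
  have h5 := (le_abs_self _).trans_lt h4
  have h6 : ‖f - g‖ ^ 2 < ε ^ 2 := lt_of_mul_lt_mul_left h5 (inv_nonneg.2 hL0.le)
  exact (lt_of_pow_lt_pow_left₀ 2 hε.le h6).le

/-! ### Pointwise bounds -/

/-- Cauchy–Schwarz, by expanding the integral of `(g - m)²` with `m` the mean of `g` over `[x, y]`.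
The bound `y ≤ x + L` ensures that no point of the circle is counted twice. -/
theorem sq_integral_le_of_periodic (g : L2 L) {x y : ℝ} (hxy : x ≤ y) (hyL : y ≤ x + L) :
    (∫ s in x..y, g (s : AddCircle L)) ^ 2 ≤ (y - x) * ‖g‖ ^ 2 := by
  rcases hxy.eq_or_lt with rfl | hlt
  · simp
  have hpos : 0 < y - x := sub_pos.2 hlt
  set I := ∫ s in x..y, g (s : AddCircle L) with hI
  set m := I / (y - x)
  have h1 : 0 ≤ ∫ s in x..y, (g (s : AddCircle L) - m) ^ 2 :=
    intervalIntegral.integral_nonneg hxy fun s _ => sq_nonneg _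
  have h2 : ∫ s in x..y, (g (s : AddCircle L) - m) ^ 2
      = (∫ s in x..y, g (s : AddCircle L) ^ 2) - 2 * m * I + m ^ 2 * (y - x) := by
    have : ∀ s : ℝ, (g (s : AddCircle L) - m) ^ 2
        = g (s : AddCircle L) ^ 2 - 2 * m * g (s : AddCircle L) + m ^ 2 := fun s => by ring
    simp only [this]
    rw [intervalIntegral.integral_add, intervalIntegral.integral_sub,
      intervalIntegral.integral_const_mul, intervalIntegral.integral_const, smul_eq_mul,
      mul_comm (y - x)]
    · exact intervalIntegrable_coe_sq g _ _
    · exact (intervalIntegrable_coe g _ _).const_mul _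
    · exact (intervalIntegrable_coe_sq g _ _).sub ((intervalIntegrable_coe g _ _).const_mul _)
    · exact intervalIntegrable_const
  have h3 : ∫ s in x..y, g (s : AddCircle L) ^ 2 ≤ ‖g‖ ^ 2 := by
    rw [norm_sq_eq_integral, ← AddCircle.intervalIntegral_preimage L x]
    refine intervalIntegral.integral_mono_interval le_rfl hxy hyL
      (Eventually.of_forall fun s => sq_nonneg _) (intervalIntegrable_coe_sq g _ _)
  have h4 : m * (y - x) = I := by simp only [m]; field_simp
  rw [h2] at h1
  have h5 : m * I ≤ ‖g‖ ^ 2 := by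
    have h6 : m ^ 2 * (y - x) = m * I := by rw [← h4]; ring
    linarith
  calc I ^ 2 = (y - x) * (m * I) := by rw [← h4]; ring
    _ ≤ _ := by gcongr

theorem exists_coe_eq_add (z w : AddCircle L) :
    ∃ x s : ℝ, (x : AddCircle L) = w ∧ ((x + s : ℝ) : AddCircle L) = z ∧ |s| = ‖z - w‖ := by
  obtain ⟨x, rfl⟩ := QuotientAddGroup.mk_surjective w
  obtain ⟨y, rfl⟩ := QuotientAddGroup.mk_surjective z
  refine ⟨x, (y - x) - round (L⁻¹ * (y - x)) * L, rfl, ?_, ?_⟩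
  · have : x + ((y - x) - round (L⁻¹ * (y - x)) * L) = y - (round (L⁻¹ * (y - x)) : ℤ) • L := by
      rw [zsmul_eq_mul]; ring
    rw [this, AddCircle.coe_sub]
    have h2 : ((((round (L⁻¹ * (y - x)) : ℤ) • L : ℝ)) : AddCircle L) = 0 :=
      (AddCircle.coe_eq_zero_iff L).2 ⟨_, rfl⟩
    rw [h2, sub_zero]
  · have := AddCircle.norm_eq L (x := y - x)
    exact this.symm

theorem norm_le_half (z : AddCircle L) : ‖z‖ ≤ L / 2 := by
  have := AddCircle.norm_le_half_period L (x := z) hL.out.ne'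
  rwa [abs_of_pos hL.out] at this

/-- The embedding of `H¹` in the `1/2`-Hölder functions, from Cauchy–Schwarz on the shorter arc. The
exponent turns the `1/‖s‖` singularity of the cotangent into an integrable `‖s‖^{-1/2}`. -/
theorem IsPrim.holder {F : C(AddCircle L, ℝ)} {g : L2 L} (h : IsPrim F g) (z w : AddCircle L) :
    |F z - F w| ≤ ‖g‖ * √‖z - w‖ := by
  obtain ⟨x, s, rfl, rfl, hs⟩ := exists_coe_eq_add z w
  rw [h.sub_eq, ← hs]
  have hsL : |s| ≤ L := by
    rw [hs]
    exact (norm_le_half _).trans (by linarith [hL.out])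
  have key : (∫ t in x..(x + s), g (t : AddCircle L)) ^ 2 ≤ |s| * ‖g‖ ^ 2 := by
    rcases le_total 0 s with h0 | h0
    · have := sq_integral_le_of_periodic g (x := x) (y := x + s) (by linarith)
        (by linarith [le_abs_self s])
      rw [add_sub_cancel_left] at this
      rwa [abs_of_nonneg h0]
    · have := sq_integral_le_of_periodic g (x := x + s) (y := x) (by linarith)
        (by linarith [neg_abs_le s])
      rw [intervalIntegral.integral_symm, neg_sq]
      have h3 : x - (x + s) = |s| := by rw [abs_of_nonpos h0]; ring
      rwa [h3] at this
  refine abs_le_of_sq_le_sq ?_ (by positivity)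
  rw [mul_pow, Real.sq_sqrt (abs_nonneg s)]
  linarith

theorem IsPrim.abs_sub_le {F : C(AddCircle L, ℝ)} {g : L2 L} (h : IsPrim F g)
    (z w : AddCircle L) : |F z - F w| ≤ √L * ‖g‖ := by
  refine (h.holder z w).trans ?_
  rw [mul_comm]
  gcongr
  exact (norm_le_half _).trans (by linarith [hL.out])

theorem integral_toL (F : C(AddCircle L, ℝ)) :
    ∫ x : AddCircle L, toL F x = ∫ x : AddCircle L, F x := integral_congr_ae (coeFn_toL F)

theorem exists_eq_mean (F : C(AddCircle L, ℝ)) :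
    ∃ z, F z = L⁻¹ * ∫ x : AddCircle L, F x := by
  have hc : ContinuousOn (fun x : ℝ => F (x : AddCircle L)) (uIcc 0 L) :=
    ((map_continuous F).comp (AddCircle.continuous_mk' L)).continuousOn
  obtain ⟨c, -, hc⟩ := exists_eq_interval_average hL.out.ne hc
  refine ⟨c, ?_⟩
  rw [hc, interval_average_eq, integral_coe (fun z => F z)]
  simp

/-- Poincaré-type bound for functions of mean zero. -/
theorem IsPrim.abs_le_of_mean_zero {F : C(AddCircle L, ℝ)} {g : L2 L} (h : IsPrim F g)
    (hm : ∫ x : AddCircle L, F x = 0) (z : AddCircle L) : |F z| ≤ √L * ‖g‖ := by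
  obtain ⟨w, hw⟩ := exists_eq_mean F
  have := h.abs_sub_le z w
  rwa [hw, hm, mul_zero, sub_zero] at this

theorem abs_mean_le (f : L2 L) : |L⁻¹ * ∫ x : AddCircle L, f x| ≤ (√L)⁻¹ * ‖f‖ := by
  have h1 := sq_integral_le_of_periodic f (x := 0) (y := L) hL.out.le (by simp)
  rw [integral_coe (fun z => f z), sub_zero] at h1
  have hL0 := hL.out
  refine abs_le_of_sq_le_sq ?_ (by positivity)
  rw [mul_pow, mul_pow, inv_pow, inv_pow, Real.sq_sqrt hL0.le]
  calc (L ^ 2)⁻¹ * (∫ x : AddCircle L, f x) ^ 2 ≤ (L ^ 2)⁻¹ * (L * ‖f‖ ^ 2) := by gcongr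
    _ = L⁻¹ * ‖f‖ ^ 2 := by field_simp

/-- A continuous function attains its mean, so it is bounded by its mean plus its oscillation. -/
theorem IsPrim.abs_le {F : C(AddCircle L, ℝ)} {g : L2 L} (h : IsPrim F g) (z : AddCircle L) :
    |F z| ≤ (√L)⁻¹ * ‖toL F‖ + √L * ‖g‖ := by
  obtain ⟨w, hw⟩ := exists_eq_mean F
  have h1 := h.abs_sub_le z w
  have h2 := abs_mean_le (toL F)
  rw [integral_toL, ← hw] at h2
  have h3 := abs_add_le (F z - F w) (F w)
  rw [sub_add_cancel] at h3
  linarith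

/-! ### The cotangent kernel -/

/-- Equivalent to `x ≤ tan x` on `(0, π/2)`, extended by parity. -/
theorem abs_cot_le {x : ℝ} (hx : |x| ≤ Real.pi / 2) : |Real.cot x| ≤ 1 / |x| := by
  wlog h : 0 ≤ x generalizing x
  · have h1 := this (x := -x) (by rwa [abs_neg]) (by linarith)
    rwa [Real.cot_eq_cos_div_sin, Real.cos_neg, Real.sin_neg, div_neg, abs_neg, abs_neg,
      ← Real.cot_eq_cos_div_sin] at h1
  rw [abs_of_nonneg h] at hx ⊢
  rcases h.eq_or_lt with rfl | hpos
  · simp [Real.cot_eq_cos_div_sin]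
  rcases hx.eq_or_lt with rfl | hlt
  · simp only [Real.cot_eq_cos_div_sin, Real.cos_pi_div_two, zero_div, abs_zero]
    positivity
  have h1 := Real.lt_tan hpos hlt
  rw [← Real.tan_inv_eq_cot, abs_of_pos (inv_pos.2 (hpos.trans h1)), one_div]
  exact inv_anti₀ hpos h1.le

theorem cotKernel_coe (x : ℝ) : cotKernel L (x : AddCircle L) = Real.cot (Real.pi / L * x) := rfl

theorem exists_coe_eq (z : AddCircle L) : ∃ x : ℝ, (x : AddCircle L) = z ∧ |x| = ‖z‖ := by
  obtain ⟨x, s, h0, h1, h2⟩ := exists_coe_eq_add z 0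
  refine ⟨s, ?_, by rw [h2, sub_zero]⟩
  rw [← h1, AddCircle.coe_add, h0, zero_add]

theorem abs_cotKernel_le (s : AddCircle L) : |cotKernel L s| ≤ L / Real.pi / ‖s‖ := by
  obtain ⟨x, rfl, hx⟩ := exists_coe_eq s
  have hL0 := hL.out
  have hp := Real.pi_pos
  have h1 : |Real.pi / L * x| = Real.pi / L * ‖(x : AddCircle L)‖ := by
    rw [abs_mul, abs_of_pos (by positivity), hx]
  have h2 := norm_le_half (x : AddCircle L)
  rw [cotKernel_coe]
  refine (abs_cot_le ?_).trans (le_of_eq ?_)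
  · rw [h1]
    calc Real.pi / L * ‖(x : AddCircle L)‖ ≤ Real.pi / L * (L / 2) := by gcongr
      _ = Real.pi / 2 := by field_simp
  · rw [h1]
    field_simp

theorem cotKernel_neg (s : AddCircle L) : cotKernel L (-s) = -cotKernel L s := by
  obtain ⟨x, rfl, -⟩ := exists_coe_eq s
  rw [← AddCircle.coe_neg, cotKernel_coe, cotKernel_coe, mul_neg, Real.cot_eq_cos_div_sin,
    Real.cot_eq_cos_div_sin, Real.cos_neg, Real.sin_neg, div_neg]

theorem measurable_cotKernel : Measurable (cotKernel L) := by
  have h1 : Measurable fun x : ℝ => Real.cot (Real.pi / L * x) := by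
    simp only [Real.cot_eq_cos_div_sin]
    fun_prop
  have h2 : cotKernel L = fun z => Real.cot (Real.pi / L * (AddCircle.measurableEquivIoc L 0 z : ℝ)) := by
    funext z
    rw [← cotKernel_coe]
    congr 1
    exact ((AddCircle.equivIoc L 0).symm_apply_apply z).symm
  rw [h2]
  exact h1.comp (measurable_subtype_coe.comp (AddCircle.measurableEquivIoc L 0).measurable)

/-- Euler's formula: `e^{2iθ} - 1` and `e^{2iθ} + 1` are `2i sin θ` and `2 cos θ` times `e^{iθ}`.
This identity produces the recursion for the Fourier symbol of the kernel. -/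
theorem fourier_one_mul_cotKernel {s : AddCircle L} (hs : s ≠ 0) :
    ((fourier 1 s : ℂ) - 1) * (cotKernel L s : ℂ) = Complex.I * ((fourier 1 s : ℂ) + 1) := by
  obtain ⟨x, rfl, hx⟩ := exists_coe_eq s
  have hL0 := hL.out
  set θ := Real.pi / L * x with hθ
  have hsin : Real.sin θ ≠ 0 := by
    have hne : x ≠ 0 := by rintro rfl; exact hs (by simp)
    have h2 := norm_le_half (x : AddCircle L)
    have hp := Real.pi_pos
    have hb : |θ| < Real.pi := by
      rw [hθ, abs_mul, abs_of_pos (by positivity), hx]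
      calc Real.pi / L * ‖(x : AddCircle L)‖ ≤ Real.pi / L * (L / 2) := by gcongr
        _ = Real.pi / 2 := by field_simp
        _ < Real.pi := by linarith
    rw [abs_lt] at hb
    intro h0
    rw [Real.sin_eq_zero_iff_of_lt_of_lt hb.1 hb.2] at h0
    have : Real.pi / L ≠ 0 := by positivity
    exact hne ((mul_eq_zero.1 h0).resolve_left this)
  have he : (fourier 1 (x : AddCircle L) : ℂ) = (Real.cos θ + Real.sin θ * Complex.I) ^ 2 := by
    rw [fourier_coe_apply, Complex.ofReal_cos, Complex.ofReal_sin, ← Complex.exp_mul_I, ← Complex.exp_nat_mul]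
    congr 1
    rw [hθ]
    push_cast
    field_simp
  have hsq : (Real.cos θ : ℂ) ^ 2 + (Real.sin θ : ℂ) ^ 2 = 1 := by
    exact_mod_cast Real.cos_sq_add_sin_sq θ
  have hs' : (Real.sin θ : ℂ) ≠ 0 := Complex.ofReal_ne_zero.2 hsin
  rw [he, cotKernel_coe, Real.cot_eq_cos_div_sin, ← hθ, Complex.ofReal_div]
  field_simp
  set c : ℂ := (Real.cos θ : ℂ)
  set d : ℂ := (Real.sin θ : ℂ)
  have hI := Complex.I_sq
  linear_combination (c + Complex.I * d) * hsq + (-c * d ^ 2 - Complex.I * d ^ 3) * hI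

/-! ### The integrable singularity -/

/-- The function `‖s‖^{-1/2}` on the circle. -/
def sing (s : AddCircle L) : ℝ := (√‖s‖)⁻¹

theorem sing_nonneg (s : AddCircle L) : 0 ≤ sing s := by unfold sing; positivity

theorem measurable_sing : Measurable (sing (L := L)) := by unfold sing; fun_prop

theorem integrable_sing : Integrable (sing (L := L)) volume := by
  have hmp := AddCircle.measurePreserving_mk L (-(L / 2))
  have hL0 := hL.out
  rw [← hmp.integrable_comp measurable_sing.aestronglyMeasurable]
  have h1 : IntervalIntegrable (fun x : ℝ => (√|x|)⁻¹) volume 0 (L / 2) := by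
    have := intervalIntegral.intervalIntegrable_rpow' (a := 0) (b := L / 2)
      (r := -(1 / 2)) (by norm_num)
    refine this.congr fun x hx => ?_
    rw [uIoc_of_le (by positivity)] at hx
    simp only [abs_of_pos hx.1, Real.sqrt_eq_rpow, ← Real.rpow_neg hx.1.le]
  have h2 : IntervalIntegrable (fun x : ℝ => (√|x|)⁻¹) volume (-(L / 2)) 0 := by
    have := (IntervalIntegrable.iff_comp_neg (f := fun x : ℝ => (√|x|)⁻¹)).1 h1
    simp only [abs_neg, neg_zero] at this
    exact this.symm
  have h3 := (h2.trans h1).1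
  have h4 : -(L / 2) + L = L / 2 := by ring
  rw [h4]
  refine IntegrableOn.congr_fun h3 (fun x hx => ?_) measurableSet_Ioc
  have : ‖(x : AddCircle L)‖ = |x| := by
    rw [AddCircle.norm_coe_eq_abs_iff L hL0.ne', abs_of_pos hL0]
    exact abs_le.2 ⟨hx.1.le, hx.2⟩
  simp only [Function.comp, sing, this]

theorem integrable_sing_sub (z : AddCircle L) : Integrable (fun y => sing (z - y)) volume :=
  integrable_sing.comp_sub_left z

theorem integral_sing_sub (z : AddCircle L) :
    ∫ y, sing (z - y) = ∫ y : AddCircle L, sing y := integral_sub_left_eq_self _ _ _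

theorem sqrt_mul_inv_norm (s : AddCircle L) : √‖s‖ * (L / Real.pi / ‖s‖) = L / Real.pi * sing s := by
  unfold sing
  rcases eq_or_ne ‖s‖ 0 with h | h
  · simp [h]
  have h1 : 0 < ‖s‖ := lt_of_le_of_ne (norm_nonneg _) (Ne.symm h)
  have h2 : √‖s‖ ≠ 0 := (Real.sqrt_pos.2 h1).ne'
  field_simp
  rw [Real.sq_sqrt h1.le, mul_comm]

theorem null_singleton (z : AddCircle L) : volume ({z} : Set (AddCircle L)) = 0 := by
  obtain ⟨x, rfl, -⟩ := exists_coe_eq z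
  have h := AddCircle.volume_closedBall L (x := (x : AddCircle L)) 0
  simpa using h

theorem ae_ne (z : AddCircle L) : ∀ᵐ y : AddCircle L, y ≠ z := by
  rw [ae_iff]
  simpa using null_singleton z

/-! ### The Fourier symbol of the Hilbert transform -/

theorem norm_fourier_sub_one_le (n : ℤ) (s : AddCircle L) :
    ‖(fourier n s : ℂ) - 1‖ ≤ |freq L n| * ‖s‖ := by
  obtain ⟨x, rfl, hx⟩ := exists_coe_eq s
  have h : (2 * Real.pi * Complex.I * n * x / L : ℂ) = Complex.I * ((freq L n * x : ℝ) : ℂ) := by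
    rw [freq]; push_cast; ring
  rw [fourier_coe_apply, h, ← hx, ← abs_mul]
  exact Real.norm_exp_I_mul_ofReal_sub_one_le

theorem integrable_fourier_sub_one_mul_cot (n : ℤ) :
    Integrable (fun s : AddCircle L => ((fourier n s : ℂ) - 1) * (cotKernel L s : ℂ)) volume := by
  refine Integrable.mono' (g := fun _ => |freq L n| * (L / Real.pi)) (integrable_const _) ?_ ?_
  · refine AEStronglyMeasurable.mul ?_ ?_
    · exact ((map_continuous (fourier n)).sub continuous_const).aestronglyMeasurable
    · exact (Complex.measurable_ofReal.comp measurable_cotKernel).aestronglyMeasurable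
  · filter_upwards with s
    have hL0 := hL.out
    have hp := Real.pi_pos
    rw [norm_mul, Complex.norm_real, Real.norm_eq_abs]
    calc _ ≤ (|freq L n| * ‖s‖) * (L / Real.pi / ‖s‖) := by
          gcongr
          · exact norm_fourier_sub_one_le n s
          · exact abs_cotKernel_le s
      _ = |freq L n| * (‖s‖ / ‖s‖ * (L / Real.pi)) := by ring
      _ ≤ |freq L n| * (1 * (L / Real.pi)) := by
          gcongr
          exact div_self_le_one _
      _ = _ := by ring

/-- `(1/L) ∫ (e_n(s) - 1) cot(μ s) ds`. -/
def cotCoeff (L : ℝ) [Fact (0 < L)] (n : ℤ) : ℂ :=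
  ((L⁻¹ : ℝ) : ℂ) * ∫ s : AddCircle L, ((fourier n s : ℂ) - 1) * (cotKernel L s : ℂ)

theorem mean_fourier (n : ℤ) :
    ((L⁻¹ : ℝ) : ℂ) * ∫ s : AddCircle L, (fourier n s : ℂ) = if n = 0 then 1 else 0 := by
  have h := congrFun (fourierCoeff_fourier (T := L) n) 0
  rw [fourierCoeff, AddCircle.integral_haarAddCircle, Pi.single_apply] at h
  simp only [neg_zero, fourier_zero, one_smul, Complex.real_smul, eq_comm (a := (0 : ℤ))] at h
  exact h

theorem integrable_fourier (n : ℤ) :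
    Integrable (fun s : AddCircle L => (fourier n s : ℂ)) volume :=
  (map_continuous (fourier n)).integrable_of_hasCompactSupport
    (HasCompactSupport.of_compactSpace _)

/-- Multiplying the identity for `(e_1 - 1) cot` by `e_n` shows that consecutive integrands differ
by `i(e_{n+1} + e_n)`, whose mean vanishes unless one of the indices is zero. -/
theorem cotCoeff_succ (n : ℤ) : cotCoeff L (n + 1) - cotCoeff L n
    = Complex.I * ((if n + 1 = 0 then 1 else 0) + if n = 0 then 1 else 0) := by
  rw [← mean_fourier (L := L) (n + 1), ← mean_fourier (L := L) n, cotCoeff, cotCoeff, ← mul_sub,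
    ← mul_add, ← integral_sub (integrable_fourier_sub_one_mul_cot _)
    (integrable_fourier_sub_one_mul_cot _), ← integral_add (integrable_fourier _)
    (integrable_fourier _), mul_left_comm, ← integral_const_mul Complex.I]
  congr 1
  refine integral_congr_ae ?_
  filter_upwards [ae_ne (0 : AddCircle L)] with s hs
  have h := fourier_one_mul_cotKernel hs
  rw [fourier_add]
  linear_combination (fourier n s : ℂ) * h

/-- The symbol `-i sgn n` of the Hilbert transform. -/
def hilbertSymbol (n : ℤ) : ℂ := -Complex.I * (n.sign : ℂ)

/-- Starting from the value `0` at `n = 0`, the recursion jumps by `i` only across the two steps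
adjacent to `0` and is constant beyond them. -/
theorem cotCoeff_eq (n : ℤ) : cotCoeff L n = Complex.I * (n.sign : ℂ) := by
  have h0 : cotCoeff L 0 = 0 := by simp [cotCoeff]
  have hpos : ∀ k : ℕ, cotCoeff L ((k : ℤ) + 1) = Complex.I := by
    intro k
    induction k with
    | zero =>
      have := cotCoeff_succ (L := L) 0
      simpa [h0] using this
    | succ k ih =>
      have := cotCoeff_succ (L := L) ((k : ℤ) + 1)
      rw [ih, if_neg (by omega), if_neg (by omega), add_zero, mul_zero, sub_eq_zero] at this
      exact_mod_cast this
  have hneg : ∀ k : ℕ, cotCoeff L (-((k : ℤ) + 1)) = -Complex.I := by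
    intro k
    induction k with
    | zero =>
      have := cotCoeff_succ (L := L) (-1)
      simp only [Int.reduceNeg, neg_add_cancel, h0, zero_sub, if_true] at this
      rw [if_neg (by norm_num), add_zero, mul_one] at this
      simp only [Nat.cast_zero, zero_add]
      rw [← this, neg_neg]
    | succ k ih =>
      have := cotCoeff_succ (L := L) (-((k : ℤ) + 1 + 1))
      rw [show -((k : ℤ) + 1 + 1) + 1 = -((k : ℤ) + 1) by ring, ih, if_neg (by omega),
        if_neg (by omega), add_zero, mul_zero, sub_eq_zero] at this
      push_cast
      exact this.symm
  rcases lt_trichotomy n 0 with h | rfl | h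
  · obtain ⟨k, rfl⟩ : ∃ k : ℕ, n = -((k : ℤ) + 1) := ⟨(-n - 1).toNat, by omega⟩
    rw [hneg, Int.sign_eq_neg_one_of_neg h]
    simp
  · simp [h0]
  · obtain ⟨k, rfl⟩ : ∃ k : ℕ, n = (k : ℤ) + 1 := ⟨(n - 1).toNat, by omega⟩
    rw [hpos, Int.sign_eq_one_of_pos h]
    simp

theorem norm_hilbertSymbol_le (n : ℤ) : ‖hilbertSymbol n‖ ≤ 1 := by
  rw [hilbertSymbol, norm_mul, norm_neg, Complex.norm_I, one_mul]
  rcases lt_trichotomy n 0 with h | rfl | h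
  · simp [Int.sign_eq_neg_one_of_neg h]
  · simp
  · simp [Int.sign_eq_one_of_pos h]

theorem hilbertSymbol_neg (n : ℤ) : hilbertSymbol (-n) = (starRingEnd ℂ) (hilbertSymbol n) := by
  simp [hilbertSymbol]

/-! ### The Hilbert transform on `L²` -/

/-- The Hilbert transform as an operator on `L²`. -/
def hop (f : L2 L) : L2 L :=
  (exists_fc_multiplier f norm_hilbertSymbol_le hilbertSymbol_neg).choose

theorem fc_hop (f : L2 L) (n : ℤ) : fc (hop f) n = hilbertSymbol n * fc f n :=
  (exists_fc_multiplier f norm_hilbertSymbol_le hilbertSymbol_neg).choose_spec n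

theorem hop_add (f g : L2 L) : hop (f + g) = hop f + hop g :=
  ext_fc fun n => by simp only [fc_hop, fc_add, mul_add]

theorem hop_smul (c : ℝ) (f : L2 L) : hop (c • f) = c • hop f :=
  ext_fc fun n => by simp only [fc_hop, fc_smul]; ring

theorem hop_sub (f g : L2 L) : hop (f - g) = hop f - hop g :=
  ext_fc fun n => by simp only [fc_hop, fc_sub, mul_sub]

theorem norm_hop_le (f : L2 L) : ‖hop f‖ ≤ ‖f‖ := by
  have h1 := hasSum_norm_sq_fc (hop f)
  have h2 := hasSum_norm_sq_fc f
  have h3 : L⁻¹ * ‖hop f‖ ^ 2 ≤ L⁻¹ * ‖f‖ ^ 2 := by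
    refine hasSum_le (fun n => ?_) h1 h2
    rw [fc_hop, norm_mul]
    gcongr
    exact mul_le_of_le_one_left (norm_nonneg _) (norm_hilbertSymbol_le n)
  exact le_of_sq_le_sq (le_of_mul_le_mul_left h3 (inv_pos.2 hL.out)) (norm_nonneg _)

theorem HasWeakDeriv.hop {f g : L2 L} (h : HasWeakDeriv f g) :
    HasWeakDeriv (OneDModel.hop f) (OneDModel.hop g) :=
  hasWeakDeriv_of_fc fun n => by
    rw [fc_hop, fc_hop, fc_of_hasWeakDeriv h]
    ring

/-- The symbol is purely imaginary, so every term of Parseval's sum has zero real part. -/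
theorem inner_hop_self (f : L2 L) : inner ℝ f (hop f) = 0 := by
  have h1 := (Complex.hasSum_iff _ _).1 (hasSum_fc_mul_fc f (hop f))
  have h2 : ∀ n, ((starRingEnd ℂ) (fc f n) * fc (hop f) n).re = 0 := by
    intro n
    rw [fc_hop, hilbertSymbol]
    have : (starRingEnd ℂ) (fc f n) * (-Complex.I * (n.sign : ℂ) * fc f n)
        = ((-(n.sign : ℝ) * Complex.normSq (fc f n) : ℝ) : ℂ) * Complex.I := by
      push_cast
      rw [Complex.normSq_eq_conj_mul_self]
      ring
    rw [this]
    simp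
  have h3 := h1.1
  simp only [h2] at h3
  have h4 := h3.unique hasSum_zero
  rw [Complex.ofReal_re] at h4
  exact (mul_eq_zero.1 h4).resolve_left (inv_ne_zero hL.out.ne')

theorem integral_hop (f : L2 L) : ∫ x : AddCircle L, hop f x = 0 := by
  have h1 := fc_hop f 0
  rw [fc_zero_eq] at h1
  have h2 : L⁻¹ * ∫ x : AddCircle L, hop f x = 0 := by
    apply Complex.ofReal_injective
    rw [h1]; simp [hilbertSymbol]
  exact (mul_eq_zero.1 h2).resolve_left (inv_ne_zero hL.out.ne')

/-! ### The singular integral for functions with a weak derivative -/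

/-- `(1/L) ∫ (F(y) - F(z)) cot(μ (z - y)) dy`. -/
def hilbertFun (F : AddCircle L → ℝ) (z : AddCircle L) : ℝ :=
  L⁻¹ * ∫ y : AddCircle L, (F y - F z) * cotKernel L (z - y)

theorem IsPrim.abs_sub_mul_cot_le {F : C(AddCircle L, ℝ)} {g : L2 L} (h : IsPrim F g)
    (z y : AddCircle L) :
    |(F y - F z) * cotKernel L (z - y)| ≤ L / Real.pi * ‖g‖ * sing (z - y) := by
  have hL0 := hL.out
  have hp := Real.pi_pos
  have h1 := h.holder y z
  rw [← neg_sub z y, norm_neg] at h1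
  rw [abs_mul]
  calc _ ≤ (‖g‖ * √‖z - y‖) * (L / Real.pi / ‖z - y‖) := by
        gcongr
        exact abs_cotKernel_le _
    _ = ‖g‖ * (√‖z - y‖ * (L / Real.pi / ‖z - y‖)) := by ring
    _ = _ := by rw [sqrt_mul_inv_norm]; ring

theorem IsPrim.integrable_sub_mul_cot {F : C(AddCircle L, ℝ)} {g : L2 L} (h : IsPrim F g)
    (z : AddCircle L) : Integrable (fun y => (F y - F z) * cotKernel L (z - y)) volume := by
  refine Integrable.mono' ((integrable_sing_sub z).const_mul (L / Real.pi * ‖g‖)) ?_ ?_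
  · refine AEStronglyMeasurable.mul ?_ ?_
    · exact ((map_continuous F).sub continuous_const).aestronglyMeasurable
    · exact (measurable_cotKernel.comp (measurable_const.sub measurable_id)).aestronglyMeasurable
  · exact Eventually.of_forall fun y => h.abs_sub_mul_cot_le z y

/-- The truncated kernel is odd and integrates to zero, so `F z` may be subtracted from the
integrand. The Hölder bound then dominates it by a multiple of `sing`, and the principal value
becomes an absolutely convergent integral. -/
theorem IsPrim.tendsto_truncatedHilbert {F : C(AddCircle L, ℝ)} {g : L2 L} (h : IsPrim F g)
    {f : AddCircle L → ℝ} (hf : f =ᵐ[volume] F) (z : AddCircle L) :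
    Tendsto (truncatedHilbert f z) (𝓝[>] (0 : ℝ)) (𝓝 (hilbertFun F z)) := by
  have hmeas : ∀ ε : ℝ, MeasurableSet {y : AddCircle L | ε < ‖z - y‖} := fun ε =>
    measurableSet_lt measurable_const (by fun_prop)
  have hcm : Measurable fun y => cotKernel L (z - y) :=
    measurable_cotKernel.comp (measurable_const.sub measurable_id)
  have hodd : ∀ ε : ℝ, ∫ y in {y : AddCircle L | ε < ‖z - y‖}, cotKernel L (z - y) = 0 := by
    intro ε
    rw [← integral_indicator (hmeas ε)]
    set k : AddCircle L → ℝ := fun s => if ε < ‖s‖ then cotKernel L s else 0 with hk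
    have h1 : ({y : AddCircle L | ε < ‖z - y‖}.indicator fun y => cotKernel L (z - y))
        = fun y => k (z - y) := by
      funext y
      simp [indicator, hk]
    rw [h1, integral_sub_left_eq_self k volume z]
    have h2 : ∫ s : AddCircle L, k s = ∫ s : AddCircle L, k (-s) :=
      (integral_neg_eq_self k volume).symm
    have h3 : ∀ s, k (-s) = -k s := by
      intro s
      simp only [hk, norm_neg, cotKernel_neg]
      split_ifs <;> simp
    simp only [h3, integral_neg] at h2
    linarith
  have hci : ∀ ε > 0, IntegrableOn (fun y => cotKernel L (z - y))
      {y : AddCircle L | ε < ‖z - y‖} volume := by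
    intro ε hε
    refine Integrable.mono' (g := fun _ => L / Real.pi / ε) (integrable_const _)
      hcm.aestronglyMeasurable ?_
    refine (ae_restrict_iff' (hmeas ε)).2 (Eventually.of_forall fun y hy => ?_)
    refine (abs_cotKernel_le _).trans ?_
    have hL0 := hL.out
    have hp := Real.pi_pos
    gcongr
    exact (show ε < ‖z - y‖ from hy).le
  have heq : ∀ ε > 0, truncatedHilbert f z ε = L⁻¹ * ∫ y : AddCircle L,
      {y : AddCircle L | ε < ‖z - y‖}.indicator (fun y => (F y - F z) * cotKernel L (z - y)) y := by
    intro ε hε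
    rw [truncatedHilbert, one_div, integral_indicator (hmeas ε)]
    congr 1
    have h1 : ∫ y in {y : AddCircle L | ε < ‖z - y‖}, f y * cotKernel L (z - y)
        = ∫ y in {y : AddCircle L | ε < ‖z - y‖},
          ((F y - F z) * cotKernel L (z - y) + F z * cotKernel L (z - y)) := by
      refine integral_congr_ae (ae_restrict_of_ae ?_)
      filter_upwards [hf] with y hy
      rw [hy]; ring
    rw [h1, integral_add (h.integrable_sub_mul_cot z).integrableOn ((hci ε hε).const_mul _),
      integral_const_mul, hodd, mul_zero, add_zero]
  have hlim : Tendsto (fun ε : ℝ => L⁻¹ * ∫ y : AddCircle L,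
      {y : AddCircle L | ε < ‖z - y‖}.indicator (fun y => (F y - F z) * cotKernel L (z - y)) y)
      (𝓝[>] (0 : ℝ)) (𝓝 (hilbertFun F z)) := by
    refine Tendsto.const_mul _ ?_
    refine tendsto_integral_filter_of_dominated_convergence
      (fun y => L / Real.pi * ‖g‖ * sing (z - y)) ?_ ?_
      ((integrable_sing_sub z).const_mul _) ?_
    · exact Eventually.of_forall fun ε =>
        ((h.integrable_sub_mul_cot z).aestronglyMeasurable.indicator (hmeas ε))
    · refine Eventually.of_forall fun ε => Eventually.of_forall fun y => ?_
      exact (norm_indicator_le_norm_self _ _).trans (h.abs_sub_mul_cot_le z y)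
    · filter_upwards [ae_ne z] with y hy
      have hpos : 0 < ‖z - y‖ := norm_pos_iff.2 (sub_ne_zero.2 (Ne.symm hy))
      refine tendsto_const_nhds.congr' ?_
      filter_upwards [Ioo_mem_nhdsGT hpos] with ε hε
      exact (indicator_of_mem (s := {y : AddCircle L | ε < ‖z - y‖}) (a := y) hε.2
        (fun y => (F y - F z) * cotKernel L (z - y))).symm
  refine hlim.congr' ?_
  filter_upwards [self_mem_nhdsWithin] with ε hε
  exact (heq ε hε).symm

theorem hilbertFun_eq_translate (F : AddCircle L → ℝ) (z : AddCircle L) :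
    hilbertFun F z = L⁻¹ * ∫ s : AddCircle L, (F (z - s) - F z) * cotKernel L s := by
  rw [hilbertFun, ← integral_sub_left_eq_self
    (fun s => (F (z - s) - F z) * cotKernel L s) volume z]
  simp

theorem fourier_add_arg (n : ℤ) (x y : AddCircle L) :
    (fourier n (x + y) : ℂ) = fourier n x * fourier n y := by
  simp [fourier_apply, smul_add, AddCircle.toCircle_add]

/-- Both sides have the same Fourier coefficients: by Fubini, the `n`-th coefficient of the singular
integral integrates `e_{-n}` against translates of `F`, which factors as the coefficient of `F`
times `cotCoeff L (-n)`. -/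
theorem IsPrim.hop_ae_eq {F : C(AddCircle L, ℝ)} {g : L2 L} (h : IsPrim F g) :
    hop (toL F) =ᵐ[volume] hilbertFun F := by
  have hL0 := hL.out
  have hp := Real.pi_pos
  set k : AddCircle L × AddCircle L → ℝ := fun p => (F (p.1 - p.2) - F p.1) * cotKernel L p.2
  have hkm : Measurable k := by
    refine Measurable.mul ?_ (measurable_cotKernel.comp measurable_snd)
    exact (((map_continuous F).measurable.comp (measurable_fst.sub measurable_snd)).sub
      ((map_continuous F).measurable.comp measurable_fst))
  have hkb : ∀ p, |k p| ≤ L / Real.pi * ‖g‖ * sing p.2 := by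
    intro p
    have := h.abs_sub_mul_cot_le p.1 (p.1 - p.2)
    rwa [sub_sub_cancel] at this
  have hmeas : AEStronglyMeasurable (hilbertFun F) volume := by
    have h1 : hilbertFun F = fun z => L⁻¹ * ∫ s : AddCircle L, k (z, s) := by
      funext z
      exact hilbertFun_eq_translate F z
    rw [h1]
    exact (hkm.stronglyMeasurable.integral_prod_right'.const_mul _).aestronglyMeasurable
  have hbound : ∀ z, ‖hilbertFun F z‖
      ≤ L⁻¹ * (L / Real.pi * ‖g‖ * ∫ y : AddCircle L, sing y) := by
    intro z
    rw [hilbertFun, norm_mul, Real.norm_of_nonneg (inv_nonneg.2 hL0.le)]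
    gcongr
    refine (norm_integral_le_of_norm_le ((integrable_sing_sub z).const_mul (L / Real.pi * ‖g‖))
      (Eventually.of_forall fun y => h.abs_sub_mul_cot_le z y)).trans (le_of_eq ?_)
    rw [integral_const_mul, integral_sing_sub]
  have hmem : MemLp (hilbertFun F) 2 (volume : Measure (AddCircle L)) :=
    MemLp.of_bound hmeas _ (Eventually.of_forall hbound)
  suffices hop (toL F) = hmem.toLp _ by
    rw [this]; exact MemLp.coeFn_toLp hmem
  refine ext_fc fun n => ?_
  have hFi : Integrable (fun z => fourier (-n) z * ((F z : ℝ) : ℂ))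
      (volume : Measure (AddCircle L)) :=
    Continuous.integrable_of_hasCompactSupport (by
      exact (map_continuous (fourier (-n))).mul (Complex.continuous_ofReal.comp (map_continuous F)))
      (HasCompactSupport.of_compactSpace _)
  have hnorm : ∀ z : AddCircle L, ‖(fourier (-n) z : ℂ)‖ = 1 := fun z => by
    rw [fourier_apply, Circle.norm_coe]
  rw [fc_hop, fc_congr (coeFn_toL F), fc_congr (MemLp.coeFn_toLp hmem)]
  have hK : Integrable (Function.uncurry fun z s : AddCircle L =>
      fourier (-n) z * ((k (z, s) : ℝ) : ℂ)) ((volume : Measure (AddCircle L)).prod volume) := by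
    refine Integrable.mono' ((integrable_sing.const_mul (L / Real.pi * ‖g‖)).comp_snd volume) ?_ ?_
    · refine AEStronglyMeasurable.mul ?_ ?_
      · exact ((map_continuous (fourier (-n))).comp continuous_fst).aestronglyMeasurable
      · exact (Complex.measurable_ofReal.comp hkm).aestronglyMeasurable
    · refine Eventually.of_forall fun p => ?_
      simp only [Function.uncurry, norm_mul, hnorm, one_mul, Complex.norm_real]
      exact hkb p
  have h1 : ∫ z : AddCircle L, fourier (-n) z * ((hilbertFun F z : ℝ) : ℂ)
      = ((L⁻¹ : ℝ) : ℂ) * ∫ z : AddCircle L, ∫ s : AddCircle L,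
        fourier (-n) z * ((k (z, s) : ℝ) : ℂ) := by
    rw [← integral_const_mul]
    refine integral_congr_ae (Eventually.of_forall fun z => ?_)
    simp only []
    rw [hilbertFun_eq_translate, Complex.ofReal_mul, ← integral_complex_ofReal, integral_const_mul]
    ring
  have h2 : ∀ s : AddCircle L, ∫ z : AddCircle L, fourier (-n) z * ((k (z, s) : ℝ) : ℂ)
      = ((fourier (-n) s : ℂ) - 1) * (cotKernel L s : ℂ)
        * ∫ z : AddCircle L, fourier (-n) z * ((F z : ℝ) : ℂ) := by
    intro s
    have h3 : ∫ z : AddCircle L, fourier (-n) z * ((F (z - s) : ℝ) : ℂ)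
        = fourier (-n) s * ∫ z : AddCircle L, fourier (-n) z * ((F z : ℝ) : ℂ) := by
      rw [← integral_sub_right_eq_self (fun z => fourier (-n) z * ((F z : ℝ) : ℂ)) s,
        ← integral_const_mul]
      refine integral_congr_ae (Eventually.of_forall fun z => ?_)
      simp only []
      have h4 := fourier_add_arg (-n) s (z - s)
      rw [add_sub_cancel] at h4
      rw [h4]
      ring
    have h4 : Integrable (fun z => fourier (-n) z * ((F (z - s) : ℝ) : ℂ))
        (volume : Measure (AddCircle L)) :=
      Continuous.integrable_of_hasCompactSupport (by
        exact (map_continuous (fourier (-n))).mul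
          (Complex.continuous_ofReal.comp ((map_continuous F).comp (continuous_id.sub
            continuous_const)))) (HasCompactSupport.of_compactSpace _)
    have h5 : ∀ z, fourier (-n) z * ((k (z, s) : ℝ) : ℂ) = (cotKernel L s : ℂ) *
        (fourier (-n) z * ((F (z - s) : ℝ) : ℂ) - fourier (-n) z * ((F z : ℝ) : ℂ)) := by
      intro z
      simp only [k]
      push_cast
      ring
    simp only [h5]
    rw [integral_const_mul, integral_sub h4 hFi, h3]
    ring
  rw [h1, integral_integral_swap hK]
  simp only [h2]
  rw [integral_mul_const, ← mul_assoc, ← mul_assoc, ← mul_assoc]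
  have h6 := cotCoeff_eq (L := L) (-n)
  rw [cotCoeff] at h6
  have h7 : hilbertSymbol n = Complex.I * ((-n).sign : ℂ) := by simp [hilbertSymbol]
  rw [h7, ← h6]
  ring

theorem IsPrim.hilbert_eq {F : C(AddCircle L, ℝ)} {g : L2 L} (h : IsPrim F g)
    {f : AddCircle L → ℝ} (hf : f =ᵐ[volume] F) : hilbert f = hilbertFun F :=
  funext fun z => (h.tendsto_truncatedHilbert hf z).limUnder_eq

/-- Identifies the principal value in the equations with the Fourier multiplier; from here on only
`hop` is needed. -/
theorem HasWeakDeriv.isHilbertTransform_iff {f g : L2 L} (h : HasWeakDeriv f g)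
    {k : AddCircle L → ℝ} : IsHilbertTransform f k ↔ OneDModel.hop f =ᵐ[volume] k := by
  obtain ⟨F, rfl, hF⟩ := h.exists_isPrim
  have h1 := hF.tendsto_truncatedHilbert (coeFn_toL F)
  constructor
  · intro hk
    filter_upwards [hk, hF.hop_ae_eq] with z hz h2
    rw [h2]
    exact tendsto_nhds_unique (h1 z) hz
  · intro hk
    unfold IsHilbertTransform
    filter_upwards [hk, hF.hop_ae_eq] with z hz h2
    rw [← hz, h2]
    exact h1 z

theorem HasWeakDeriv.hilbert_ae_eq {f g : L2 L} (h : HasWeakDeriv f g) :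
    hilbert f =ᵐ[volume] OneDModel.hop f := by
  obtain ⟨F, rfl, hF⟩ := h.exists_isPrim
  rw [hF.hilbert_eq (coeFn_toL F)]
  exact hF.hop_ae_eq.symm

/-! ### Diffeomorphisms of the circle -/

variable (L) in
/-- An orientation preserving `C¹` diffeomorphism of the circle of circumference `L`, given by its
derivative `q` and the image `a` of `0` (on the line). -/
structure CDiff where
  /-- the derivative -/
  q : C(AddCircle L, ℝ)
  /-- the image of `0` -/
  a : ℝ
  pos : ∀ x, 0 < q x
  mean : ∫ x : AddCircle L, q x = L

namespace CDiff

theorem continuous_q_coe (q : C(AddCircle L, ℝ)) : Continuous fun s : ℝ => q (s : AddCircle L) :=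
  (map_continuous q).comp (AddCircle.continuous_mk' L)

variable (φ : CDiff L)

/-- The lift to the line. -/
def lift (x : ℝ) : ℝ := φ.a + ∫ s in (0 : ℝ)..x, φ.q (s : AddCircle L)

theorem lift_zero : φ.lift 0 = φ.a := by simp [lift]

theorem lift_sub (x y : ℝ) : φ.lift y - φ.lift x = ∫ s in x..y, φ.q (s : AddCircle L) := by
  have hc := continuous_q_coe φ.q
  rw [lift, lift, ← intervalIntegral.integral_add_adjacent_intervals
    (hc.intervalIntegrable 0 x) (hc.intervalIntegrable x y)]
  ring

theorem hasDerivAt_lift (x : ℝ) : HasDerivAt φ.lift (φ.q (x : AddCircle L)) x := by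
  have hc := continuous_q_coe φ.q
  exact (intervalIntegral.integral_hasDerivAt_right (hc.intervalIntegrable 0 x)
    hc.stronglyMeasurable.stronglyMeasurableAtFilter hc.continuousAt).const_add _

theorem continuous_lift : Continuous φ.lift :=
  continuous_iff_continuousAt.2 fun x => (φ.hasDerivAt_lift x).continuousAt

theorem strictMono_lift : StrictMono φ.lift :=
  strictMono_of_hasDerivAt_pos φ.hasDerivAt_lift fun _ => φ.pos _

theorem lift_add_period (x : ℝ) : φ.lift (x + L) = φ.lift x + L := by
  have h := φ.lift_sub x (x + L)
  rw [(periodic_coe φ.q).intervalIntegral_add_eq x 0, zero_add, integral_coe (fun z => φ.q z),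
    φ.mean] at h
  linarith

theorem lift_add_nat (x : ℝ) (n : ℕ) : φ.lift (x + n * L) = φ.lift x + n * L := by
  induction n with
  | zero => simp
  | succ n ih =>
    have : x + ((n + 1 : ℕ) : ℝ) * L = (x + n * L) + L := by push_cast; ring
    rw [this, lift_add_period, ih]
    push_cast; ring

theorem surjective_lift : Function.Surjective φ.lift := by
  intro y
  have hL0 := hL.out
  obtain ⟨n, hn⟩ := exists_nat_ge (|y - φ.lift 0| / L)
  rw [div_le_iff₀ hL0] at hn
  have h1 := φ.lift_add_nat 0 n
  have h2 := φ.lift_add_nat (0 - n * L) n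
  rw [sub_add_cancel] at h2
  obtain ⟨x, -, hx⟩ := intermediate_value_Icc (a := 0 - n * L) (b := 0 + n * L)
    (by nlinarith [Nat.cast_nonneg (α := ℝ) n]) φ.continuous_lift.continuousOn
    (show y ∈ Icc _ _ from ⟨by linarith [neg_abs_le (y - φ.lift 0)],
      by linarith [le_abs_self (y - φ.lift 0)]⟩)
  exact ⟨x, hx⟩

/-- The lift as an order isomorphism. -/
def liftIso : ℝ ≃o ℝ := φ.strictMono_lift.orderIsoOfSurjective _ φ.surjective_lift

@[simp] theorem liftIso_apply (x : ℝ) : φ.liftIso x = φ.lift x := rfl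

theorem liftIso_symm_add_period (y : ℝ) : φ.liftIso.symm (y + L) = φ.liftIso.symm y + L := by
  rw [φ.liftIso.symm_apply_eq, liftIso_apply, lift_add_period, ← liftIso_apply,
    OrderIso.apply_symm_apply]

/-- The map of the circle induced by a map of the line commuting with the period. -/
def descend (f : ℝ → ℝ) (hf : ∀ x, f (x + L) = f x + L) : AddCircle L → AddCircle L :=
  Function.Periodic.lift (f := fun x : ℝ => (f x : AddCircle L)) (c := L) fun x => by
    simp only [hf, AddCircle.coe_add, AddCircle.coe_period, add_zero]

theorem descend_coe (f : ℝ → ℝ) (hf : ∀ x, f (x + L) = f x + L) (x : ℝ) :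
    descend f hf (x : AddCircle L) = (f x : AddCircle L) := rfl

theorem continuous_descend {f : ℝ → ℝ} (hf : ∀ x, f (x + L) = f x + L) (hc : Continuous f) :
    Continuous (descend f hf) :=
  continuous_coinduced_dom.2 ((AddCircle.continuous_mk' L).comp hc)

/-- The diffeomorphism as a homeomorphism of the circle. -/
def homeo : AddCircle L ≃ₜ AddCircle L where
  toFun := descend φ.lift φ.lift_add_period
  invFun := descend φ.liftIso.symm φ.liftIso_symm_add_period
  left_inv := by
    intro z
    obtain ⟨x, rfl, -⟩ := exists_coe_eq z
    rw [descend_coe, descend_coe, ← liftIso_apply, OrderIso.symm_apply_apply]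
  right_inv := by
    intro z
    obtain ⟨x, rfl, -⟩ := exists_coe_eq z
    rw [descend_coe, descend_coe, ← liftIso_apply, OrderIso.apply_symm_apply]
  continuous_toFun := continuous_descend _ φ.continuous_lift
  continuous_invFun := continuous_descend _ φ.liftIso.symm.continuous

theorem homeo_coe (x : ℝ) : φ.homeo (x : AddCircle L) = (φ.lift x : AddCircle L) := rfl

theorem homeo_symm_coe (x : ℝ) :
    φ.homeo.symm (x : AddCircle L) = (φ.liftIso.symm x : AddCircle L) := rfl

/-! ### Change of variables -/

/-- The lift maps one period onto one period, so the change of variables on the line descends to the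
circle. -/
theorem lintegral_comp (g : AddCircle L → ℝ≥0∞) :
    ∫⁻ x : AddCircle L, ENNReal.ofReal (φ.q x) * g (φ.homeo x) = ∫⁻ x : AddCircle L, g x := by
  rw [← AddCircle.lintegral_preimage L 0, ← AddCircle.lintegral_preimage L (φ.lift 0), zero_add]
  have himg : φ.lift '' Ioc 0 L = Ioc (φ.lift 0) (φ.lift 0 + L) := by
    have h1 := φ.liftIso.image_Ioc 0 L
    have h2 := φ.lift_add_period 0
    rw [zero_add] at h2
    rw [← h2]
    exact h1
  rw [← himg, lintegral_image_eq_lintegral_abs_deriv_mul measurableSet_Ioc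
    (fun x _ => (φ.hasDerivAt_lift x).hasDerivWithinAt) φ.strictMono_lift.injective.injOn]
  refine lintegral_congr fun x => ?_
  rw [abs_of_pos (φ.pos _), homeo_coe]

/-- The pull-back of Lebesgue measure. -/
def density : Measure (AddCircle L) := volume.withDensity fun x => ENNReal.ofReal (φ.q x)

theorem measurable_q : Measurable fun x => ENNReal.ofReal (φ.q x) :=
  (map_continuous φ.q).measurable.ennreal_ofReal

theorem map_density : φ.density.map φ.homeo = volume := by
  ext s hs
  rw [Measure.map_apply φ.homeo.measurable hs, density,
    withDensity_apply _ (φ.homeo.measurable hs), ← lintegral_indicator (φ.homeo.measurable hs),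
    ← lintegral_indicator_one hs, ← φ.lintegral_comp (s.indicator 1)]
  refine lintegral_congr fun x => ?_
  by_cases hx : φ.homeo x ∈ s <;> simp [indicator, hx]

theorem map_symm_volume : volume.map φ.homeo.symm = φ.density := by
  rw [← φ.map_density, Measure.map_map φ.homeo.symm.measurable φ.homeo.measurable]
  simp

theorem density_le {C : ℝ} (hC : ∀ x, φ.q x ≤ C) : φ.density ≤ ENNReal.ofReal C • volume := by
  rw [density, ← withDensity_const]
  exact withDensity_mono (Eventually.of_forall fun x => ENNReal.ofReal_le_ofReal (hC x))

theorem volume_le {c : ℝ} (hc0 : 0 < c) (hc : ∀ x, c ≤ φ.q x) :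
    volume ≤ ENNReal.ofReal c⁻¹ • φ.density := by
  have h1 : (volume : Measure (AddCircle L)) = ENNReal.ofReal c⁻¹ • ENNReal.ofReal c • volume := by
    rw [smul_smul, ← ENNReal.ofReal_mul (inv_nonneg.2 hc0.le), inv_mul_cancel₀ hc0.ne',
      ENNReal.ofReal_one, one_smul]
  have h2 : ENNReal.ofReal c • (volume : Measure (AddCircle L)) ≤ φ.density := by
    rw [density, ← withDensity_const]
    exact withDensity_mono (Eventually.of_forall fun x => ENNReal.ofReal_le_ofReal (hc x))
  intro s
  calc volume s = (ENNReal.ofReal c⁻¹ • ENNReal.ofReal c • volume : Measure (AddCircle L)) s := by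
        rw [← h1]
    _ ≤ _ := by
        simp only [Measure.smul_apply]
        gcongr
        exact h2 s

theorem exists_bounds : ∃ c C : ℝ, 0 < c ∧ (∀ x, c ≤ φ.q x) ∧ ∀ x, φ.q x ≤ C := by
  obtain ⟨x, -, hx⟩ := isCompact_univ.exists_isMinOn (univ_nonempty (α := AddCircle L))
    (map_continuous φ.q).continuousOn
  obtain ⟨y, -, hy⟩ := isCompact_univ.exists_isMaxOn (univ_nonempty (α := AddCircle L))
    (map_continuous φ.q).continuousOn
  exact ⟨φ.q x, φ.q y, φ.pos x, fun z => hx (mem_univ z), fun z => hy (mem_univ z)⟩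

theorem map_volume_le {c : ℝ} (hc0 : 0 < c) (hc : ∀ x, c ≤ φ.q x) :
    volume.map φ.homeo ≤ ENNReal.ofReal c⁻¹ • volume := by
  have h := Measure.map_mono (φ.volume_le hc0 hc) φ.homeo.measurable
  rwa [Measure.map_smul, φ.map_density] at h

/-- The image of Lebesgue measure is at most `c⁻¹` times Lebesgue measure, so null sets pull back to
null sets and composition is well defined on classes. -/
theorem ae_comp {p : AddCircle L → Prop} (h : ∀ᵐ z : AddCircle L, p z) :
    ∀ᵐ x : AddCircle L, p (φ.homeo x) := by
  obtain ⟨c, C, hc0, hc, -⟩ := φ.exists_bounds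
  have h1 : ∀ᵐ z ∂(ENNReal.ofReal c⁻¹ • (volume : Measure (AddCircle L))), p z :=
    Measure.ae_smul_measure h _
  exact ae_of_ae_map φ.homeo.measurable.aemeasurable
    (ae_mono (φ.map_volume_le hc0 hc) h1)

theorem ae_comp_symm {p : AddCircle L → Prop} (h : ∀ᵐ z : AddCircle L, p z) :
    ∀ᵐ x : AddCircle L, p (φ.homeo.symm x) := by
  obtain ⟨c, C, hc0, hc, hC⟩ := φ.exists_bounds
  have h1 : ∀ᵐ z ∂(ENNReal.ofReal C • (volume : Measure (AddCircle L))), p z :=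
    Measure.ae_smul_measure h _
  refine ae_of_ae_map φ.homeo.symm.measurable.aemeasurable ?_
  rw [φ.map_symm_volume]
  exact ae_mono (φ.density_le hC) h1

theorem integral_comp (g : AddCircle L → ℝ) :
    ∫ x : AddCircle L, φ.q x * g (φ.homeo x) = ∫ x : AddCircle L, g x := by
  conv_rhs => rw [← φ.map_density, φ.homeo.measurableEmbedding.integral_map, density]
  rw [integral_withDensity_eq_integral_toReal_smul φ.measurable_q
    (Eventually.of_forall fun x => ENNReal.ofReal_lt_top)]
  refine integral_congr_ae (Eventually.of_forall fun x => ?_)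
  simp [ENNReal.toReal_ofReal (φ.pos x).le]

/-! ### Composition operators -/

theorem memLp_comp (f : L2 L) : MemLp (fun x => f (φ.homeo x)) 2 (volume : Measure (AddCircle L)) := by
  obtain ⟨c, C, hc0, hc, -⟩ := φ.exists_bounds
  have h1 : MemLp f 2 (volume.map φ.homeo) :=
    ((Lp.memLp f).smul_measure ENNReal.ofReal_ne_top).mono_measure (φ.map_volume_le hc0 hc)
  exact h1.comp_of_map φ.homeo.measurable.aemeasurable

theorem memLp_icomp (f : L2 L) :
    MemLp (fun x => f (φ.homeo.symm x)) 2 (volume : Measure (AddCircle L)) := by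
  obtain ⟨c, C, hc0, hc, hC⟩ := φ.exists_bounds
  have h1 : MemLp f 2 (volume.map φ.homeo.symm) := by
    rw [φ.map_symm_volume]
    exact ((Lp.memLp f).smul_measure ENNReal.ofReal_ne_top).mono_measure (φ.density_le hC)
  exact h1.comp_of_map φ.homeo.symm.measurable.aemeasurable

/-- `f ∘ φ`. -/
def comp (f : L2 L) : L2 L := (φ.memLp_comp f).toLp _

/-- `f ∘ φ⁻¹`. -/
def icomp (f : L2 L) : L2 L := (φ.memLp_icomp f).toLp _

theorem coeFn_comp (f : L2 L) : φ.comp f =ᵐ[volume] fun x => f (φ.homeo x) := MemLp.coeFn_toLp _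

theorem coeFn_icomp (f : L2 L) : φ.icomp f =ᵐ[volume] fun x => f (φ.homeo.symm x) :=
  MemLp.coeFn_toLp _

theorem comp_icomp (f : L2 L) : φ.comp (φ.icomp f) = f := by
  refine Lp.ext ?_
  filter_upwards [φ.coeFn_comp (φ.icomp f), φ.ae_comp (φ.coeFn_icomp f)] with x h1 h2
  rw [h1, h2, Homeomorph.symm_apply_apply]

theorem icomp_comp (f : L2 L) : φ.icomp (φ.comp f) = f := by
  refine Lp.ext ?_
  filter_upwards [φ.coeFn_icomp (φ.comp f), φ.ae_comp_symm (φ.coeFn_comp f)] with x h1 h2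
  rw [h1, h2, Homeomorph.apply_symm_apply]

theorem comp_add (f g : L2 L) : φ.comp (f + g) = φ.comp f + φ.comp g := by
  refine Lp.ext ?_
  filter_upwards [φ.coeFn_comp (f + g), φ.coeFn_comp f, φ.coeFn_comp g,
    φ.ae_comp (Lp.coeFn_add f g), Lp.coeFn_add (φ.comp f) (φ.comp g)] with x h1 h2 h3 h4 h5
  rw [h1, h4, h5, Pi.add_apply, Pi.add_apply, h2, h3]

theorem comp_smul (c : ℝ) (f : L2 L) : φ.comp (c • f) = c • φ.comp f := by
  refine Lp.ext ?_
  filter_upwards [φ.coeFn_comp (c • f), φ.coeFn_comp f,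
    φ.ae_comp (Lp.coeFn_smul c f), Lp.coeFn_smul c (φ.comp f)] with x h1 h2 h4 h5
  rw [h1, h4, h5, Pi.smul_apply, Pi.smul_apply, h2]

theorem icomp_add (f g : L2 L) : φ.icomp (f + g) = φ.icomp f + φ.icomp g := by
  conv_lhs => rw [← φ.comp_icomp f, ← φ.comp_icomp g, ← comp_add, icomp_comp]

theorem icomp_smul (c : ℝ) (f : L2 L) : φ.icomp (c • f) = c • φ.icomp f := by
  conv_lhs => rw [← φ.comp_icomp f, ← comp_smul, icomp_comp]

theorem integral_icomp_mul (f : L2 L) (g : AddCircle L → ℝ) :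
    ∫ z : AddCircle L, φ.icomp f z * g z = ∫ x : AddCircle L, φ.q x * (f x * g (φ.homeo x)) := by
  rw [← φ.integral_comp]
  refine integral_congr_ae ?_
  filter_upwards [φ.ae_comp (φ.coeFn_icomp f)] with x hx
  rw [hx, Homeomorph.symm_apply_apply]

theorem norm_icomp_le {C : ℝ} (hC : ∀ x, φ.q x ≤ C) (f : L2 L) : ‖φ.icomp f‖ ≤ √C * ‖f‖ := by
  have hC0 : 0 ≤ C := (φ.pos 0).le.trans (hC 0)
  have h : ‖φ.icomp f‖ ^ 2 ≤ (√C * ‖f‖) ^ 2 := by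
    rw [mul_pow, Real.sq_sqrt hC0, norm_sq_eq_integral, norm_sq_eq_integral,
      ← integral_const_mul, ← φ.integral_comp]
    refine integral_mono_of_nonneg (Eventually.of_forall fun x =>
      mul_nonneg (φ.pos x).le (sq_nonneg _)) ((Lp.memLp f).integrable_sq.const_mul _) ?_
    filter_upwards [φ.ae_comp (φ.coeFn_icomp f)] with x hx
    rw [hx, Homeomorph.symm_apply_apply]
    gcongr
    exact hC x
  exact le_of_sq_le_sq h (by positivity)

theorem norm_comp_le {c : ℝ} (hc0 : 0 < c) (hc : ∀ x, c ≤ φ.q x) (f : L2 L) :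
    ‖φ.comp f‖ ≤ √c⁻¹ * ‖f‖ := by
  have h : ‖φ.comp f‖ ^ 2 ≤ (√c⁻¹ * ‖f‖) ^ 2 := by
    rw [mul_pow, Real.sq_sqrt (inv_nonneg.2 hc0.le), norm_sq_eq_integral, norm_sq_eq_integral,
      ← φ.integral_comp fun x => f x ^ 2, ← integral_const_mul]
    obtain ⟨c', C, hc0', hc', hC⟩ := φ.exists_bounds
    refine integral_mono_ae (Lp.memLp _).integrable_sq ?_ ?_
    · have h1 := (Lp.memLp (φ.comp f)).integrable_sq.bdd_mul (c := ‖φ.q‖)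
        (map_continuous φ.q).aestronglyMeasurable
        (Eventually.of_forall φ.q.norm_coe_le_norm)
      refine (h1.congr ?_).const_mul _
      filter_upwards [φ.coeFn_comp f] with x hx
      rw [hx]
    · filter_upwards [φ.coeFn_comp f] with x hx
      rw [hx, ← mul_assoc]
      refine le_mul_of_one_le_left (sq_nonneg _) ?_
      rw [inv_mul_eq_div, one_le_div hc0]
      exact hc x
  exact le_of_sq_le_sq h (by positivity)

/-- Composition of continuous functions with `φ`. -/
def ccomp (F : C(AddCircle L, ℝ)) : C(AddCircle L, ℝ) := F.comp ⟨φ.homeo, φ.homeo.continuous⟩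

/-- Composition of continuous functions with `φ⁻¹`. -/
def cicomp (F : C(AddCircle L, ℝ)) : C(AddCircle L, ℝ) :=
  F.comp ⟨φ.homeo.symm, φ.homeo.symm.continuous⟩

@[simp] theorem ccomp_apply (F : C(AddCircle L, ℝ)) (x : AddCircle L) :
    φ.ccomp F x = F (φ.homeo x) := rfl

@[simp] theorem cicomp_apply (F : C(AddCircle L, ℝ)) (x : AddCircle L) :
    φ.cicomp F x = F (φ.homeo.symm x) := rfl

theorem comp_toL (F : C(AddCircle L, ℝ)) : φ.comp (toL F) = toL (φ.ccomp F) := by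
  refine Lp.ext ?_
  filter_upwards [φ.coeFn_comp (toL F), φ.ae_comp (coeFn_toL F), coeFn_toL (φ.ccomp F)]
    with x h1 h2 h3
  rw [h1, h2, h3, ccomp_apply]

theorem icomp_toL (F : C(AddCircle L, ℝ)) : φ.icomp (toL F) = toL (φ.cicomp F) := by
  refine Lp.ext ?_
  filter_upwards [φ.coeFn_icomp (toL F), φ.ae_comp_symm (coeFn_toL F), coeFn_toL (φ.cicomp F)]
    with x h1 h2 h3
  rw [h1, h2, h3, cicomp_apply]

theorem intervalIntegral_lift (g : L2 L) (x y : ℝ) :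
    ∫ s in (φ.lift x)..(φ.lift y), g (s : AddCircle L)
      = ∫ s in x..y, φ.q (s : AddCircle L) * φ.comp g (s : AddCircle L) := by
  wlog h : x ≤ y generalizing x y
  · rw [intervalIntegral.integral_symm, this y x (le_of_not_ge h), ← intervalIntegral.integral_symm]
  rw [intervalIntegral.integral_of_le h,
    intervalIntegral.integral_of_le (φ.strictMono_lift.monotone h)]
  have himg : φ.lift '' Ioc x y = Ioc (φ.lift x) (φ.lift y) := φ.liftIso.image_Ioc x y
  rw [← himg, integral_image_eq_integral_abs_deriv_smul measurableSet_Ioc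
    (fun x _ => (φ.hasDerivAt_lift x).hasDerivWithinAt) φ.strictMono_lift.injective.injOn]
  refine integral_congr_ae (ae_restrict_of_ae ?_)
  filter_upwards [ae_coe (φ.coeFn_comp g)] with s hs
  rw [hs, homeo_coe, abs_of_pos (φ.pos _), smul_eq_mul]

/-- The reciprocal of the derivative. -/
def qinv : C(AddCircle L, ℝ) := ⟨fun x => (φ.q x)⁻¹,
  (map_continuous φ.q).inv₀ fun x => (φ.pos x).ne'⟩

theorem hasWeakDeriv_comp {f g : L2 L} (h : HasWeakDeriv f g) :
    HasWeakDeriv (φ.comp f) (mulc φ.q (φ.comp g)) := by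
  obtain ⟨F, rfl, hF⟩ := h.exists_isPrim
  rw [comp_toL, hasWeakDeriv_toL]
  intro x
  have h1 := hF.sub_eq (φ.lift 0) (φ.lift x)
  rw [intervalIntegral_lift] at h1
  have h2 : ∫ s in (0 : ℝ)..x, mulc φ.q (φ.comp g) (s : AddCircle L)
      = ∫ s in (0 : ℝ)..x, φ.q (s : AddCircle L) * φ.comp g (s : AddCircle L) := by
    refine intervalIntegral.integral_congr_ae ?_
    filter_upwards [ae_coe (coeFn_mulc φ.q (φ.comp g))] with s hs _
    rw [hs]
  rw [h2, ← h1, ccomp_apply, ccomp_apply, homeo_coe, ← AddCircle.coe_zero, homeo_coe]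
  ring

theorem hasWeakDeriv_icomp {f g : L2 L} (h : HasWeakDeriv f g) :
    HasWeakDeriv (φ.icomp f) (φ.icomp (mulc φ.qinv g)) := by
  obtain ⟨F, rfl, hF⟩ := h.exists_isPrim
  rw [icomp_toL, hasWeakDeriv_toL]
  have key : ∀ x y : ℝ, F (y : AddCircle L) - F (x : AddCircle L)
      = ∫ s in (φ.lift x)..(φ.lift y), φ.icomp (mulc φ.qinv g) (s : AddCircle L) := by
    intro x y
    rw [hF.sub_eq, intervalIntegral_lift, comp_icomp]
    refine intervalIntegral.integral_congr_ae ?_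
    filter_upwards [ae_coe (coeFn_mulc φ.qinv g)] with s hs _
    rw [hs]
    change _ = φ.q s * ((φ.q s)⁻¹ * g s)
    rw [mul_inv_cancel_left₀ (φ.pos _).ne']
  intro z
  have h1 := key (φ.liftIso.symm 0) (φ.liftIso.symm z)
  rw [← liftIso_apply, ← liftIso_apply, OrderIso.apply_symm_apply, OrderIso.apply_symm_apply] at h1
  rw [← h1, cicomp_apply, cicomp_apply, homeo_symm_coe, ← AddCircle.coe_zero, homeo_symm_coe]
  ring

/-! ### The conjugated Hilbert transform -/

/-- `f ↦ H(f ∘ φ⁻¹) ∘ φ`. -/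
def conj (f : L2 L) : L2 L := φ.comp (hop (φ.icomp f))

theorem conj_add (f g : L2 L) : φ.conj (f + g) = φ.conj f + φ.conj g := by
  rw [conj, icomp_add, hop_add, comp_add]; rfl

theorem conj_smul (c : ℝ) (f : L2 L) : φ.conj (c • f) = c • φ.conj f := by
  rw [conj, icomp_smul, hop_smul, comp_smul]; rfl

theorem conj_sub (f g : L2 L) : φ.conj (f - g) = φ.conj f - φ.conj g := by
  have h : f - g = f + (-1 : ℝ) • g := by rw [neg_one_smul, sub_eq_add_neg]
  rw [h, conj_add, conj_smul, neg_one_smul, sub_eq_add_neg]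

theorem norm_conj_le {c C : ℝ} (hc0 : 0 < c) (hc : ∀ x, c ≤ φ.q x) (hC : ∀ x, φ.q x ≤ C)
    (f : L2 L) : ‖φ.conj f‖ ≤ √c⁻¹ * √C * ‖f‖ := by
  calc ‖φ.conj f‖ ≤ √c⁻¹ * ‖hop (φ.icomp f)‖ := φ.norm_comp_le hc0 hc _
    _ ≤ √c⁻¹ * (√C * ‖f‖) := by
        gcongr
        exact (norm_hop_le _).trans (φ.norm_icomp_le hC f)
    _ = _ := by ring

/-- The chain rule for `φ⁻¹` and for `φ`, with `H` commuting with differentiation in between. No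
commutator appears, only multiplication by `q⁻¹` before and by `q` after. -/
theorem hasWeakDeriv_conj {f g : L2 L} (h : HasWeakDeriv f g) :
    HasWeakDeriv (φ.conj f) (mulc φ.q (φ.conj (mulc φ.qinv g))) :=
  φ.hasWeakDeriv_comp (φ.hasWeakDeriv_icomp h).hop

/-- The conjugated Hilbert transform as a singular integral. -/
theorem conj_toL_ae_eq {F : C(AddCircle L, ℝ)} {g : L2 L} (h : IsPrim F g) :
    φ.conj (toL F) =ᵐ[volume] fun α => L⁻¹ * ∫ β : AddCircle L,
      (F β - F α) * (φ.q β * cotKernel L (φ.homeo α - φ.homeo β)) := by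
  have h1 := φ.hasWeakDeriv_icomp h.hasWeakDeriv
  rw [icomp_toL, hasWeakDeriv_toL] at h1
  filter_upwards [φ.coeFn_comp (hop (toL (φ.cicomp F))), φ.ae_comp h1.hop_ae_eq] with α h2 h3
  rw [conj, icomp_toL, h2, h3, hilbertFun, ← φ.integral_comp]
  congr 1
  refine integral_congr_ae (Eventually.of_forall fun β => ?_)
  simp only [cicomp_apply, Homeomorph.symm_apply_apply]
  ring

end CDiff

/-! ### Comparison of the kernels of two diffeomorphisms -/

/-- The upper bound is the lower bound on the complementary arc, because the total mass is `L`. -/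
theorem intervalIntegral_bounds {q : C(AddCircle L, ℝ)} (hm : ∫ x : AddCircle L, q x = L)
    {c : ℝ} (hc : ∀ x, c ≤ q x) {x y : ℝ} (hxy : x ≤ y) (hyL : y ≤ x + L) :
    c * (y - x) ≤ ∫ s in x..y, q (s : AddCircle L) ∧
      ∫ s in x..y, q (s : AddCircle L) ≤ L - c * (L - (y - x)) := by
  have hq := CDiff.continuous_q_coe q
  have low : ∀ {x y : ℝ}, x ≤ y → c * (y - x) ≤ ∫ s in x..y, q (s : AddCircle L) := by
    intro x y hxy
    have := intervalIntegral.integral_mono_on (μ := volume) (f := fun _ => c)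
      (g := fun s : ℝ => q (s : AddCircle L)) hxy intervalIntegrable_const
      (hq.intervalIntegrable x y) fun s _ => hc s
    rw [intervalIntegral.integral_const, smul_eq_mul] at this
    linarith
  refine ⟨low hxy, ?_⟩
  have h1 := low hyL
  have h2 := intervalIntegral.integral_add_adjacent_intervals (μ := volume)
    (hq.intervalIntegrable x y) (hq.intervalIntegrable y (x + L))
  rw [(periodic_coe q).intervalIntegral_add_eq x 0, zero_add, integral_coe (fun z => q z),
    hm] at h2
  have h3 : x + L - y = L - (y - x) := by ring
  rw [h3] at h1
  linarith

theorem le_abs_sin {X t : ℝ} (ht : 0 ≤ t) (h1 : t ≤ |X|) (h2 : |X| ≤ Real.pi - t) :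
    2 / Real.pi * t ≤ |Real.sin X| := by
  have hp := Real.pi_pos
  wlog h : 0 ≤ X generalizing X
  · have := this (X := -X) (by rwa [abs_neg]) (by rwa [abs_neg]) (by linarith)
    rwa [Real.sin_neg, abs_neg] at this
  rw [abs_of_nonneg h] at h1 h2
  refine le_trans ?_ (le_abs_self _)
  rcases le_total X (Real.pi / 2) with h3 | h3
  · refine le_trans ?_ (Real.mul_le_sin h h3)
    gcongr
  · rw [← Real.sin_pi_sub]
    refine le_trans ?_ (Real.mul_le_sin (by linarith) (by linarith))
    gcongr
    linarith

/-- The image of a short arc is neither too small nor close to the whole circle, so the argument of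
the sine stays away from both `0` and `±π`. -/
theorem le_abs_sin_arc {q : C(AddCircle L, ℝ)} (hm : ∫ x : AddCircle L, q x = L)
    {c : ℝ} (hc0 : 0 < c) (hc : ∀ x, c ≤ q x) {x s : ℝ} (hs : |s| ≤ L / 2) :
    2 * c / L * |s| ≤ |Real.sin (Real.pi / L * ∫ r in x..(x + s), q (r : AddCircle L))| := by
  have hL0 := hL.out
  have hp := Real.pi_pos
  set I := ∫ r in x..(x + s), q (r : AddCircle L) with hI
  have key : c * |s| ≤ |I| ∧ |I| ≤ L - c * (L - |s|) := by
    rcases le_total 0 s with h | h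
    · rw [abs_of_nonneg h] at hs ⊢
      have := intervalIntegral_bounds hm hc (x := x) (y := x + s) (by linarith) (by linarith)
      rw [add_sub_cancel_left, ← hI] at this
      rwa [abs_of_nonneg ((mul_nonneg hc0.le h).trans this.1)]
    · rw [abs_of_nonpos h] at hs ⊢
      have := intervalIntegral_bounds hm hc (x := x + s) (y := x) (by linarith) (by linarith)
      rw [intervalIntegral.integral_symm, ← hI, show x - (x + s) = -s by ring] at this
      have h4 : I ≤ 0 := by nlinarith [mul_nonneg hc0.le (neg_nonneg.2 h)]
      rwa [abs_of_nonpos h4]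
  have h1 : |Real.pi / L * I| = Real.pi / L * |I| := by rw [abs_mul, abs_of_pos (by positivity)]
  have h2 := le_abs_sin (X := Real.pi / L * I) (t := Real.pi / L * (c * |s|)) (by positivity)
    (by rw [h1]; gcongr; exact key.1) (by
      rw [h1]
      have : Real.pi - Real.pi / L * (c * |s|) = Real.pi / L * (L - c * |s|) := by field_simp
      rw [this]
      gcongr
      refine key.2.trans ?_
      have : c * |s| ≤ c * (L - |s|) := by gcongr; linarith
      linarith)
  refine le_trans (le_of_eq ?_) h2
  field_simp

theorem cot_sub_cot {a b X Y : ℝ} (hX : Real.sin X ≠ 0) (hY : Real.sin Y ≠ 0) :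
    a * Real.cot X - b * Real.cot Y
      = (a * (Real.cos X * Real.sin Y) - b * (Real.cos Y * Real.sin X))
        / (Real.sin X * Real.sin Y) := by
  rw [Real.cot_eq_cos_div_sin, Real.cot_eq_cos_div_sin]
  field_simp

/-- The constant in the comparison of kernels. -/
def kernelConst (L c C A : ℝ) : ℝ :=
  Real.pi / L * (C + A + Real.pi / L * C * √L * (2 * C)) * (L / (2 * c)) ^ 2

/-- Over the common denominator `sin X sin Y`, which is at least of order `s²`, the numerator `N(s)`
vanishes at `s = 0` and has derivative `O(δ |s|^{1/2})`. Hence `N(s) = O(δ |s|^{3/2})` and the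
quotient is `O(δ |s|^{-1/2})`. -/
theorem CDiff.abs_kernel_sub_le (φ ψ : CDiff L) {c C A δ : ℝ} (hc0 : 0 < c)
    (hφc : ∀ x, c ≤ φ.q x) (hψc : ∀ x, c ≤ ψ.q x) (hφC : ∀ x, φ.q x ≤ C) (hψC : ∀ x, ψ.q x ≤ C)
    (hA : ∀ x y, |φ.q x - φ.q y| ≤ A * √‖x - y‖) (hA0 : 0 ≤ A)
    (hδ : ∀ x, |φ.q x - ψ.q x| ≤ δ)
    (hδ' : ∀ x y, |(φ.q x - ψ.q x) - (φ.q y - ψ.q y)| ≤ δ * √‖x - y‖) (α β : AddCircle L) :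
    |φ.q β * cotKernel L (φ.homeo α - φ.homeo β) - ψ.q β * cotKernel L (ψ.homeo α - ψ.homeo β)|
      ≤ kernelConst L c C A * δ * sing (α - β) := by
  have hL0 := hL.out
  have hp := Real.pi_pos
  have hδ0 : 0 ≤ δ := (abs_nonneg _).trans (hδ 0)
  have hC0 : 0 ≤ C := (φ.pos 0).le.trans (hφC 0)
  obtain ⟨x, s, rfl, rfl, hs⟩ := exists_coe_eq_add α β
  have hsL : |s| ≤ L / 2 := by rw [hs]; exact norm_le_half _
  have hker : ∀ χ : CDiff L, cotKernel L (χ.homeo ((x + s : ℝ) : AddCircle L)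
      - χ.homeo (x : AddCircle L))
      = Real.cot (Real.pi / L * ∫ r in x..(x + s), χ.q (r : AddCircle L)) := by
    intro χ
    rw [homeo_coe, homeo_coe, ← AddCircle.coe_sub, lift_sub, cotKernel_coe]
  rw [hker, hker, sing, ← hs]
  rcases eq_or_ne s 0 with rfl | hs0
  · simp [Real.cot_eq_cos_div_sin]
  have hspos : 0 < |s| := abs_pos.2 hs0
  have hX := le_abs_sin_arc φ.mean hc0 hφc (x := x) hsL
  have hY := le_abs_sin_arc ψ.mean hc0 hψc (x := x) hsL
  have hlow : 0 < 2 * c / L * |s| := by positivity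
  have hX0 : Real.sin (Real.pi / L * ∫ r in x..(x + s), φ.q (r : AddCircle L)) ≠ 0 :=
    abs_pos.1 (hlow.trans_le hX)
  have hY0 : Real.sin (Real.pi / L * ∫ r in x..(x + s), ψ.q (r : AddCircle L)) ≠ 0 :=
    abs_pos.1 (hlow.trans_le hY)
  rw [cot_sub_cot hX0 hY0, abs_div, abs_mul]
  -- the numerator as a function of the arc
  set X : ℝ → ℝ := fun t => Real.pi / L * ∫ r in x..(x + t), φ.q (r : AddCircle L) with hXdef
  set Y : ℝ → ℝ := fun t => Real.pi / L * ∫ r in x..(x + t), ψ.q (r : AddCircle L) with hYdef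
  have hder : ∀ χ : CDiff L, ∀ t : ℝ, HasDerivAt
      (fun t => Real.pi / L * ∫ r in x..(x + t), χ.q (r : AddCircle L))
      (Real.pi / L * χ.q ((x + t : ℝ) : AddCircle L)) t := by
    intro χ t
    have h1 : (fun t => Real.pi / L * ∫ r in x..(x + t), χ.q (r : AddCircle L))
        = fun t => Real.pi / L * (χ.lift (x + t) - χ.lift x) := by
      funext t; rw [lift_sub]
    rw [h1]
    exact (((χ.hasDerivAt_lift (x + t)).comp_const_add x t).sub_const _).const_mul _
  set N : ℝ → ℝ := fun t => φ.q x * (Real.cos (X t) * Real.sin (Y t))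
    - ψ.q x * (Real.cos (Y t) * Real.sin (X t)) with hN
  set M : ℝ := Real.pi / L * (C + A + Real.pi / L * C * √L * (2 * C)) with hM
  have hM0 : 0 ≤ M := by positivity
  have hN' : ∀ t, HasDerivAt N (Real.pi / L * (Real.cos (X t) * Real.cos (Y t)
      * (φ.q x * ψ.q ((x + t : ℝ) : AddCircle L) - ψ.q x * φ.q ((x + t : ℝ) : AddCircle L))
      + Real.sin (X t) * Real.sin (Y t)
      * (ψ.q x * ψ.q ((x + t : ℝ) : AddCircle L)
        - φ.q x * φ.q ((x + t : ℝ) : AddCircle L)))) t := by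
    intro t
    have h1 := ((hder φ t).cos.mul (hder ψ t).sin).const_mul (φ.q x)
    have h2 := ((hder ψ t).cos.mul (hder φ t).sin).const_mul (ψ.q x)
    refine (h1.sub h2).congr_deriv ?_
    simp only [hXdef, hYdef]
    ring
  have hNb : ∀ t ∈ uIcc 0 s, |Real.pi / L * (Real.cos (X t) * Real.cos (Y t)
      * (φ.q x * ψ.q ((x + t : ℝ) : AddCircle L) - ψ.q x * φ.q ((x + t : ℝ) : AddCircle L))
      + Real.sin (X t) * Real.sin (Y t)
      * (ψ.q x * ψ.q ((x + t : ℝ) : AddCircle L)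
        - φ.q x * φ.q ((x + t : ℝ) : AddCircle L)))| ≤ M * δ * √|s| := by
    intro t ht
    have hts : |t| ≤ |s| := by simpa using abs_sub_left_of_mem_uIcc ht
    have hnt : ‖((x + t : ℝ) : AddCircle L) - (x : AddCircle L)‖ = |t| := by
      rw [← AddCircle.coe_sub, add_sub_cancel_left, AddCircle.norm_coe_eq_abs_iff L hL0.ne',
        abs_of_pos hL0]
      linarith
    set y : AddCircle L := ((x + t : ℝ) : AddCircle L) with hy
    have hst : √|t| ≤ √|s| := Real.sqrt_le_sqrt hts
    have e1 := hA y x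
    have e2 := hδ y
    have e3 := hδ' y x
    have e4 := hδ (x : AddCircle L)
    rw [hnt] at e1 e3
    -- This determinant vanishes when `x = y` and when `φ.q = ψ.q`; the decomposition below exhibits
    -- both zeros, giving a factor `δ` and a factor `√|t|`.
    have b1 : |φ.q x * ψ.q y - ψ.q x * φ.q y| ≤ δ * √|t| * C + δ * (A * √|t|) := by
      have : φ.q x * ψ.q y - ψ.q x * φ.q y
          = -((φ.q y - ψ.q y) - (φ.q x - ψ.q x)) * φ.q y
            + (φ.q y - ψ.q y) * (φ.q y - φ.q x) := by ring
      rw [this]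
      refine (abs_add_le _ _).trans ?_
      rw [abs_mul, abs_mul, abs_neg, abs_of_pos (φ.pos y)]
      have := φ.pos y
      have := hφC y
      gcongr
    have b2 : |ψ.q x * ψ.q y - φ.q x * φ.q y| ≤ δ * C + C * δ := by
      have : ψ.q x * ψ.q y - φ.q x * φ.q y
          = -((φ.q x - ψ.q x) * φ.q y) + -(ψ.q x * (φ.q y - ψ.q y)) := by ring
      rw [this]
      refine (abs_add_le _ _).trans ?_
      rw [abs_neg, abs_neg, abs_mul, abs_mul, abs_of_pos (φ.pos y), abs_of_pos (ψ.pos x)]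
      have := (φ.pos y).le
      have := (ψ.pos (x : AddCircle L)).le
      have := hφC y
      have := hψC (x : AddCircle L)
      gcongr
    -- The sine is of order `|t|`, but only `√|t|` is needed, so the other half power is absorbed
    -- into `√L`.
    have b3 : |Real.sin (X t)| ≤ Real.pi / L * C * √L * √|t| := by
      refine Real.abs_sin_le_abs.trans ?_
      have h5 : |∫ r in x..(x + t), φ.q (r : AddCircle L)| ≤ C * |t| := by
        have := intervalIntegral.norm_integral_le_of_norm_le_const (a := x) (b := x + t)
          (f := fun r : ℝ => φ.q (r : AddCircle L)) (C := C) fun r _ => by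
            rw [Real.norm_of_nonneg (φ.pos _).le]; exact hφC _
        rwa [add_sub_cancel_left] at this
      have h6 : |t| = √|t| * √|t| := (Real.mul_self_sqrt (abs_nonneg t)).symm
      have h7 : √|t| ≤ √L := Real.sqrt_le_sqrt (by linarith)
      rw [hXdef, abs_mul, abs_of_pos (show 0 < Real.pi / L by positivity)]
      calc Real.pi / L * |∫ r in x..(x + t), φ.q (r : AddCircle L)|
          ≤ Real.pi / L * (C * (√|t| * √|t|)) := by rw [← h6]; gcongr
        _ ≤ Real.pi / L * (C * (√L * √|t|)) := by gcongr
        _ = _ := by ring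
    rw [abs_mul, abs_of_pos (show 0 < Real.pi / L by positivity)]
    have hcos : |Real.cos (X t) * Real.cos (Y t)| ≤ 1 := by
      rw [abs_mul]
      exact mul_le_one₀ (Real.abs_cos_le_one _) (abs_nonneg _) (Real.abs_cos_le_one _)
    have hsin : |Real.sin (X t) * Real.sin (Y t)| ≤ Real.pi / L * C * √L * √|t| := by
      rw [abs_mul]
      exact (mul_le_of_le_one_right (abs_nonneg _) (Real.abs_sin_le_one _)).trans b3
    calc _ ≤ Real.pi / L * (1 * (δ * √|t| * C + δ * (A * √|t|))
          + Real.pi / L * C * √L * √|t| * (δ * C + C * δ)) := by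
          gcongr
          refine (abs_add_le _ _).trans ?_
          rw [abs_mul (Real.cos (X t) * Real.cos (Y t)), abs_mul (Real.sin (X t) * Real.sin (Y t))]
          gcongr
      _ = M * δ * √|t| := by rw [hM]; ring
      _ ≤ M * δ * √|s| := by gcongr
  have hNs : |N s| ≤ M * δ * √|s| * |s| := by
    have h0 : N 0 = 0 := by simp [hN, hXdef, hYdef]
    have := (convex_uIcc (0 : ℝ) s).norm_image_sub_le_of_norm_hasDerivWithin_le
      (fun t _ => (hN' t).hasDerivWithinAt) hNb left_mem_uIcc right_mem_uIcc
    rwa [h0, sub_zero, sub_zero] at this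
  have hN2 : |φ.q x * (Real.cos (X s) * Real.sin (Y s))
    - ψ.q x * (Real.cos (Y s) * Real.sin (X s))| ≤ M * δ * √|s| * |s| := hNs
  have hsq : 0 < √|s| := Real.sqrt_pos.2 hspos
  -- The two sines in the denominator account for the factor `(L / (2 * c)) ^ 2` in `kernelConst`;
  -- the remaining power is `|s|^{3/2 - 2}`.
  calc _ ≤ (M * δ * √|s| * |s|) / ((2 * c / L * |s|) * (2 * c / L * |s|)) := by
        gcongr
    _ = kernelConst L c C A * δ * (√|s|)⁻¹ := by
        rw [kernelConst, ← hM]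
        have h6 : √|s| * √|s| = |s| := Real.mul_self_sqrt (abs_nonneg s)
        field_simp
        rw [pow_two, h6]

/-! ### Operators with weakly singular kernels -/

theorem integral_sub_const_sq_mul {w k : AddCircle L → ℝ} (hk : Integrable k volume)
    (hwk : Integrable (fun x => w x * k x) volume)
    (hw2k : Integrable (fun x => w x ^ 2 * k x) volume) (c : ℝ) :
    ∫ x, (w x - c) ^ 2 * k x
      = (∫ x, w x ^ 2 * k x) - 2 * c * (∫ x, w x * k x) + c ^ 2 * ∫ x, k x := by
  have h3 : ∀ x, (w x - c) ^ 2 * k x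
      = (w x ^ 2 * k x - 2 * c * (w x * k x)) + c ^ 2 * k x := fun x => by ring
  simp only [h3]
  have h1 := integral_add (hw2k.sub (hwk.const_mul (2 * c))) (hk.const_mul (c ^ 2))
  have h2 := integral_sub hw2k (hwk.const_mul (2 * c))
  rw [integral_const_mul] at h1 h2
  rw [← h2]
  exact h1

theorem sq_integral_mul_le {w k : AddCircle L → ℝ} (hk : Integrable k volume)
    (hk0 : ∀ x, 0 ≤ k x) (hwk : Integrable (fun x => w x * k x) volume)
    (hw2k : Integrable (fun x => w x ^ 2 * k x) volume) (hpos : 0 < ∫ x, k x) :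
    (∫ x, w x * k x) ^ 2 ≤ (∫ x, k x) * ∫ x, w x ^ 2 * k x := by
  have h1 : 0 ≤ ∫ x, (w x - (∫ x, w x * k x) / ∫ x, k x) ^ 2 * k x :=
    integral_nonneg fun x => mul_nonneg (sq_nonneg _) (hk0 x)
  rw [integral_sub_const_sq_mul hk hwk hw2k] at h1
  generalize (∫ x, w x * k x) = I at *
  generalize (∫ x, k x) = S at *
  have h4 : (∫ x, w x ^ 2 * k x) - 2 * (I / S) * I + (I / S) ^ 2 * S
      = (∫ x, w x ^ 2 * k x) - I ^ 2 / S := by field_simp; ring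
  rw [h4, sub_nonneg, div_le_iff₀ hpos] at h1
  linarith

variable (L) in
/-- The `L¹` norm of the singularity. -/
def singInt : ℝ := ∫ s : AddCircle L, sing s

theorem singInt_pos : 0 < singInt L := by
  have h : 0 < ∫ s : AddCircle L, sing s := by
    rw [integral_pos_iff_support_of_nonneg sing_nonneg integrable_sing]
    have h1 : ∀ᵐ s : AddCircle L, s ∈ Function.support (sing (L := L)) := by
      filter_upwards [ae_ne (0 : AddCircle L)] with s hs
      have : 0 < ‖s‖ := norm_pos_iff.2 hs
      exact (inv_pos.2 (Real.sqrt_pos.2 this)).ne'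
    rw [measure_congr (eventuallyEq_univ.2 (show Function.support sing ∈ ae volume from h1)),
      AddCircle.measure_univ]
    simpa using hL.out
  exact h

/-- Schur's test: Cauchy–Schwarz with respect to the weight `sing (α - β)`, then Fubini, using that
the mass of the weight does not depend on the point. -/
theorem norm_le_of_weakly_singular {W : C(AddCircle L, ℝ)} {T : L2 L} {κ : ℝ} (hκ : 0 ≤ κ)
    (hT : ∀ᵐ α : AddCircle L, |T α| ≤ κ * ∫ β : AddCircle L, (|W β| + |W α|) * sing (α - β)) :
    ‖T‖ ≤ 2 * κ * singInt L * ‖toL W‖ := by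
  have hS := singInt_pos (L := L)
  set S := singInt L with hSdef
  have hSz : ∀ α : AddCircle L, ∫ β : AddCircle L, sing (α - β) = S := fun α =>
    integral_sing_sub α
  have hWc : Continuous fun β => |W β| := (map_continuous W).abs
  have hWm : ∀ {g : AddCircle L → ℝ}, Continuous g → ∀ α : AddCircle L,
      Integrable (fun β => g β * sing (α - β)) volume := by
    intro g hg α
    obtain ⟨B, hB⟩ := (⟨⟨g, hg⟩, rfl⟩ : ∃ B : C(AddCircle L, ℝ), B = ⟨g, hg⟩)
    refine (integrable_sing_sub α).bdd_mul (c := ‖B‖) hg.aestronglyMeasurable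
      (Eventually.of_forall fun x => ?_)
    rw [hB]
    exact (⟨g, hg⟩ : C(AddCircle L, ℝ)).norm_coe_le_norm x
  set P : AddCircle L → ℝ := fun α => ∫ β : AddCircle L, W β ^ 2 * sing (α - β) with hP
  have hprod : Integrable (Function.uncurry fun α β : AddCircle L => W β ^ 2 * sing (α - β))
      ((volume : Measure (AddCircle L)).prod volume) := by
    have hm : AEStronglyMeasurable (Function.uncurry fun α β : AddCircle L =>
        W β ^ 2 * sing (α - β)) ((volume : Measure (AddCircle L)).prod volume) := by
      refine Measurable.aestronglyMeasurable ?_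
      exact (((map_continuous W).measurable.comp measurable_snd).pow_const 2).mul
        (measurable_sing.comp (measurable_fst.sub measurable_snd))
    have hWb : ∀ β, W β ^ 2 ≤ ‖W‖ ^ 2 := fun β => by
      rw [← sq_abs]; exact pow_le_pow_left₀ (abs_nonneg _) (W.norm_coe_le_norm β) 2
    rw [integrable_prod_iff hm]
    refine ⟨Eventually.of_forall fun α => hWm ((map_continuous W).pow 2) α, ?_⟩
    refine Integrable.mono' (g := fun _ => ‖W‖ ^ 2 * S) (integrable_const _)
      hm.norm.integral_prod_right' (Eventually.of_forall fun α => ?_)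
    rw [Real.norm_of_nonneg (integral_nonneg fun _ => norm_nonneg _), ← hSz α,
      ← integral_const_mul]
    refine integral_mono (hWm ((map_continuous W).pow 2) α).norm
      ((integrable_sing_sub α).const_mul _) fun β => ?_
    simp only [Function.uncurry, norm_mul, Real.norm_of_nonneg (sing_nonneg _),
      Real.norm_of_nonneg (sq_nonneg (W β))]
    exact mul_le_mul_of_nonneg_right (hWb β) (sing_nonneg _)
  have hPint : Integrable P volume := hprod.integral_prod_left
  have hPeq : ∫ α, P α = S * ‖toL W‖ ^ 2 := by
    rw [hP, integral_integral_swap hprod]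
    have h1 : ∀ β : AddCircle L, ∫ α : AddCircle L, W β ^ 2 * sing (α - β) = W β ^ 2 * S := by
      intro β
      rw [integral_const_mul, integral_sub_right_eq_self (fun s => sing s) β]
      rfl
    simp only [h1]
    rw [integral_mul_const, norm_sq_eq_integral, mul_comm]
    congr 1
    refine integral_congr_ae ?_
    filter_upwards [coeFn_toL W] with x hx
    rw [hx]
  have hmain : ‖T‖ ^ 2 ≤ (2 * κ * S * ‖toL W‖) ^ 2 := by
    have hb : ∀ᵐ α : AddCircle L, T α ^ 2 ≤ 2 * κ ^ 2 * S * P α + 2 * κ ^ 2 * S ^ 2 * toL W α ^ 2 := by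
      filter_upwards [hT, coeFn_toL W] with α hα hW
      have h1 : ∫ β : AddCircle L, (|W β| + |W α|) * sing (α - β)
          = (∫ β : AddCircle L, |W β| * sing (α - β)) + |W α| * S := by
        rw [← hSz α, ← integral_const_mul, ← integral_add (hWm hWc α)
          ((integrable_sing_sub α).const_mul _)]
        exact integral_congr_ae (Eventually.of_forall fun β => by ring)
      rw [h1] at hα
      set Q := ∫ β : AddCircle L, |W β| * sing (α - β) with hQ
      have h2 : Q ^ 2 ≤ S * P α := by
        have := sq_integral_mul_le (w := fun β => |W β|) (integrable_sing_sub α)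
          (fun β => sing_nonneg _) (hWm hWc α) (hWm (hWc.pow 2) α) (by rw [hSz]; exact hS)
        rw [hSz] at this
        simpa only [sq_abs] using this
      have h3 : T α ^ 2 ≤ (κ * (Q + |W α| * S)) ^ 2 := by
        rw [← sq_abs (T α)]
        exact pow_le_pow_left₀ (abs_nonneg _) hα 2
      have h4 : (Q + |W α| * S) ^ 2 ≤ 2 * Q ^ 2 + 2 * (S ^ 2 * W α ^ 2) := by
        have := sq_nonneg (Q - |W α| * S)
        have h5 : (|W α| * S) ^ 2 = S ^ 2 * W α ^ 2 := by rw [mul_pow, sq_abs]; ring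
        nlinarith
      rw [hW]
      calc T α ^ 2 ≤ κ ^ 2 * (Q + |W α| * S) ^ 2 := by rw [← mul_pow]; exact h3
        _ ≤ κ ^ 2 * (2 * (S * P α) + 2 * (S ^ 2 * W α ^ 2)) := by
            gcongr
            linarith
        _ = _ := by ring
    have hI := integral_mono_ae (Lp.memLp T).integrable_sq
      ((hPint.const_mul (2 * κ ^ 2 * S)).add
        ((Lp.memLp (toL W)).integrable_sq.const_mul (2 * κ ^ 2 * S ^ 2))) hb
    rw [← norm_sq_eq_integral] at hI
    refine hI.trans (le_of_eq ?_)
    have h6 := integral_add (hPint.const_mul (2 * κ ^ 2 * S))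
      ((Lp.memLp (toL W)).integrable_sq.const_mul (2 * κ ^ 2 * S ^ 2))
    refine h6.trans ?_
    rw [integral_const_mul, integral_const_mul, hPeq, ← norm_sq_eq_integral]
    ring
  exact le_of_sq_le_sq hmain (by positivity)

theorem CDiff.integrable_comp (φ : CDiff L) {g : AddCircle L → ℝ} (hg : Integrable g volume) :
    Integrable (fun x => φ.q x * g (φ.homeo x)) volume := by
  rw [← φ.map_density, φ.homeo.measurableEmbedding.integrable_map_iff, CDiff.density,
    integrable_withDensity_iff_integrable_smul' φ.measurable_q
    (Eventually.of_forall fun x => ENNReal.ofReal_lt_top)] at hg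
  refine hg.congr (Eventually.of_forall fun x => ?_)
  simp [ENNReal.toReal_ofReal (φ.pos x).le]

/-- The conjugated Hilbert transform depends in a Lipschitz way on the diffeomorphism. -/
theorem CDiff.norm_conj_sub_conj_le (φ ψ : CDiff L) {c C A δ : ℝ} (hc0 : 0 < c)
    (hφc : ∀ x, c ≤ φ.q x) (hψc : ∀ x, c ≤ ψ.q x) (hφC : ∀ x, φ.q x ≤ C) (hψC : ∀ x, ψ.q x ≤ C)
    (hA : ∀ x y, |φ.q x - φ.q y| ≤ A * √‖x - y‖) (hA0 : 0 ≤ A)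
    (hδ : ∀ x, |φ.q x - ψ.q x| ≤ δ)
    (hδ' : ∀ x y, |(φ.q x - ψ.q x) - (φ.q y - ψ.q y)| ≤ δ * √‖x - y‖) (f : L2 L) :
    ‖φ.conj f - ψ.conj f‖ ≤ 2 * (L⁻¹ * (kernelConst L c C A * δ)) * singInt L * ‖f‖ := by
  have hL0 := hL.out
  have hp := Real.pi_pos
  have hδ0 : 0 ≤ δ := (abs_nonneg _).trans (hδ 0)
  have hC0 : 0 ≤ C := (φ.pos 0).le.trans (hφC 0)
  have hK0 : 0 ≤ kernelConst L c C A := by unfold kernelConst; positivity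
  set κ := L⁻¹ * (kernelConst L c C A * δ) with hκ
  have hκ0 : 0 ≤ κ := by positivity
  have hS := singInt_pos (L := L)
  have hsmooth : ∀ g g' : L2 L, HasWeakDeriv g g' →
      ‖φ.conj g - ψ.conj g‖ ≤ 2 * κ * singInt L * ‖g‖ := by
    intro g g' hg
    obtain ⟨F, rfl, hF⟩ := hg.exists_isPrim
    refine norm_le_of_weakly_singular hκ0 ?_
    have hint : ∀ (χ : CDiff L) (α : AddCircle L), Integrable (fun β =>
        (F β - F α) * (χ.q β * cotKernel L (χ.homeo α - χ.homeo β))) volume := by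
      intro χ α
      have h1 := χ.hasWeakDeriv_icomp hF.hasWeakDeriv
      rw [icomp_toL, hasWeakDeriv_toL] at h1
      refine (χ.integrable_comp (h1.integrable_sub_mul_cot (χ.homeo α))).congr
        (Eventually.of_forall fun β => ?_)
      simp only [cicomp_apply, Homeomorph.symm_apply_apply]
      ring
    filter_upwards [φ.conj_toL_ae_eq hF, ψ.conj_toL_ae_eq hF,
      Lp.coeFn_sub (φ.conj (toL F)) (ψ.conj (toL F))] with α h1 h2 h3
    rw [h3, Pi.sub_apply, h1, h2, ← mul_sub, ← integral_sub (hint φ α) (hint ψ α), abs_mul,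
      abs_of_pos (inv_pos.2 hL0), hκ, mul_assoc]
    gcongr
    rw [← integral_const_mul (kernelConst L c C A * δ)]
    have hi : Integrable (fun β => (|F β| + |F α|) * sing (α - β)) volume := by
      refine (integrable_sing_sub α).bdd_mul (c := ‖F‖ + ‖F‖)
        ((map_continuous F).abs.add continuous_const).aestronglyMeasurable
        (Eventually.of_forall fun x => ?_)
      rw [Real.norm_of_nonneg (by positivity)]
      exact add_le_add (F.norm_coe_le_norm x) (F.norm_coe_le_norm α)
    rw [← Real.norm_eq_abs]
    refine norm_integral_le_of_norm_le (hi.const_mul (kernelConst L c C A * δ)) (Eventually.of_forall fun β => ?_)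
    rw [← mul_sub, Real.norm_eq_abs, abs_mul]
    calc _ ≤ (|F β| + |F α|) * (kernelConst L c C A * δ * sing (α - β)) := by
          gcongr
          · exact abs_sub _ _
          · exact φ.abs_kernel_sub_le ψ hc0 hφc hψc hφC hψC hA hA0 hδ hδ' α β
      _ = _ := by ring
  set B := √c⁻¹ * √C
  have hB : 0 ≤ B := by positivity
  refine le_of_forall_pos_le_add fun ε hε => ?_
  -- Approximation of `f` within `ε / D` costs `B` for each of the two operators and `2 * κ *
  -- singInt L` for the norm of `g`; the total is `(D - 1) / D * ε`.
  set D := 2 * B + 2 * κ * singInt L + 1 with hD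
  have hD0 : 0 < D := by positivity
  obtain ⟨g, g', hg, hfg⟩ := exists_hasWeakDeriv_near f (div_pos hε hD0)
  have e1 := φ.norm_conj_le hc0 hφc hφC (f - g)
  have e2 := ψ.norm_conj_le hc0 hψc hψC (f - g)
  have e3 := hsmooth g g' hg
  have e4 : ‖g‖ ≤ ‖f‖ + ε / D := by
    have := norm_sub_norm_le g f
    rw [norm_sub_rev] at this
    linarith
  have e5 : φ.conj f - ψ.conj f
      = φ.conj (f - g) - ψ.conj (f - g) + (φ.conj g - ψ.conj g) := by
    rw [conj_sub, conj_sub]; abel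
  rw [e5]
  calc _ ≤ ‖φ.conj (f - g)‖ + ‖ψ.conj (f - g)‖ + ‖φ.conj g - ψ.conj g‖ :=
        (norm_add_le _ _).trans (add_le_add_left (norm_sub_le _ _) _)
    _ ≤ B * (ε / D) + B * (ε / D) + 2 * κ * singInt L * (‖f‖ + ε / D) := by
        refine add_le_add (add_le_add ?_ ?_) ?_
        · exact e1.trans (by gcongr)
        · exact e2.trans (by gcongr)
        · exact e3.trans (by gcongr)
    _ = 2 * κ * singInt L * ‖f‖ + (D - 1) / D * ε := by rw [hD]; field_simp; ring
    _ ≤ 2 * κ * singInt L * ‖f‖ + 1 * ε := by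
        gcongr
        rw [div_le_one hD0]
        linarith
    _ = _ := by rw [one_mul]

/-! ### The diffeomorphism with logarithmic derivative `S`, up to normalisation -/

/-- The logarithm of the mean of `exp S`. -/
def logMean (S : C(AddCircle L, ℝ)) : ℝ := Real.log (L⁻¹ * ∫ x : AddCircle L, Real.exp (S x))

theorem integrable_continuousMap (S : C(AddCircle L, ℝ)) : Integrable S volume :=
  (map_continuous S).integrable_of_hasCompactSupport (HasCompactSupport.of_compactSpace _)

theorem mean_const (c : ℝ) : L⁻¹ * ∫ _ : AddCircle L, c = c := by
  have := hL.out
  simp [Measure.real, AddCircle.measure_univ, this.le, this.ne']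

theorem mean_mono {F G : C(AddCircle L, ℝ)} (h : ∀ x, F x ≤ G x) :
    L⁻¹ * ∫ x : AddCircle L, F x ≤ L⁻¹ * ∫ x : AddCircle L, G x := by
  exact mul_le_mul_of_nonneg_left
    (integral_mono (integrable_continuousMap F) (integrable_continuousMap G) h)
    (inv_nonneg.2 hL.out.le)

theorem mean_cexp_pos (S : C(AddCircle L, ℝ)) : 0 < L⁻¹ * ∫ x : AddCircle L, Real.exp (S x) := by
  have h1 := mean_mono (F := ContinuousMap.const _ (Real.exp (-‖S‖))) (G := cexp S) fun x =>
    Real.exp_le_exp.2 (neg_le_of_abs_le (S.norm_coe_le_norm x))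
  simp only [ContinuousMap.const_apply, mean_const] at h1
  exact (Real.exp_pos _).trans_le h1

theorem exp_logMean (S : C(AddCircle L, ℝ)) :
    Real.exp (logMean S) = L⁻¹ * ∫ x : AddCircle L, Real.exp (S x) :=
  Real.exp_log (mean_cexp_pos S)

/-- The mean of the exponential is monotone and multiplies by `e^δ` when `δ` is added, so `logMean`
is `1`-Lipschitz in the supremum norm. -/
theorem logMean_le_add {S T : C(AddCircle L, ℝ)} {δ : ℝ} (h : ∀ x, S x ≤ T x + δ) :
    logMean S ≤ logMean T + δ := by
  rw [← Real.exp_le_exp, Real.exp_add, exp_logMean, exp_logMean]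
  have h1 := mean_mono (F := cexp S) (G := Real.exp δ • cexp T) fun x => by
    rw [ContinuousMap.smul_apply, cexp_apply, cexp_apply, smul_eq_mul, ← Real.exp_add]
    exact Real.exp_le_exp.2 (by linarith [h x])
  refine h1.trans (le_of_eq ?_)
  simp only [ContinuousMap.smul_apply, cexp_apply, smul_eq_mul]
  rw [integral_const_mul]
  ring

theorem logMean_zero : logMean (0 : C(AddCircle L, ℝ)) = 0 := by
  simp only [logMean, ContinuousMap.zero_apply, Real.exp_zero]
  rw [mean_const, Real.log_one]

theorem abs_logMean_sub_le {S T : C(AddCircle L, ℝ)} {δ : ℝ} (h : ∀ x, |(S - T) x| ≤ δ) :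
    |logMean S - logMean T| ≤ δ := by
  rw [abs_sub_le_iff]
  have h1 : ∀ x, |S x - T x| ≤ δ := h
  constructor
  · linarith [logMean_le_add (S := S) (T := T) (δ := δ) fun x => by
      linarith [le_of_abs_le (h1 x)]]
  · linarith [logMean_le_add (S := T) (T := S) (δ := δ) fun x => by
      linarith [neg_le_of_abs_le (h1 x)]]

theorem abs_logMean_le {S : C(AddCircle L, ℝ)} {R : ℝ} (h : ∀ x, |S x| ≤ R) :
    |logMean S| ≤ R := by
  have := abs_logMean_sub_le (S := S) (T := 0) (δ := R) (by simpa using h)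
  rwa [logMean_zero, sub_zero] at this

/-- The normalised logarithmic derivative. -/
def nrm (S : C(AddCircle L, ℝ)) : C(AddCircle L, ℝ) := S - ContinuousMap.const _ (logMean S)

@[simp] theorem nrm_apply (S : C(AddCircle L, ℝ)) (x : AddCircle L) :
    nrm S x = S x - logMean S := rfl

/-- The diffeomorphism whose derivative is proportional to `exp S`, mapping `0` to `a`. -/
def diffeo (S : C(AddCircle L, ℝ)) (a : ℝ) : CDiff L where
  q := cexp (nrm S)
  a := a
  pos _ := Real.exp_pos _
  mean := by
    have h := exp_logMean S
    have h2 := hL.out.ne'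
    simp only [cexp_apply, nrm_apply, Real.exp_sub]
    rw [integral_div, h]
    have h3 := right_ne_zero_of_mul (mean_cexp_pos S).ne'
    field_simp

theorem diffeo_q (S : C(AddCircle L, ℝ)) (a : ℝ) : (diffeo S a).q = cexp (nrm S) := rfl

theorem abs_nrm_le {S : C(AddCircle L, ℝ)} {R : ℝ} (h : ∀ x, |S x| ≤ R) (x : AddCircle L) :
    |nrm S x| ≤ 2 * R := by
  have h1 := abs_logMean_le h
  have h2 := abs_sub (S x) (logMean S)
  rw [nrm_apply]
  linarith [h x]

theorem diffeo_q_le {S : C(AddCircle L, ℝ)} {R : ℝ} (h : ∀ x, |S x| ≤ R) (a : ℝ)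
    (x : AddCircle L) : (diffeo S a).q x ≤ Real.exp (2 * R) :=
  Real.exp_le_exp.2 (le_of_abs_le (abs_nrm_le h x))

theorem le_diffeo_q {S : C(AddCircle L, ℝ)} {R : ℝ} (h : ∀ x, |S x| ≤ R) (a : ℝ)
    (x : AddCircle L) : Real.exp (-(2 * R)) ≤ (diffeo S a).q x :=
  Real.exp_le_exp.2 (neg_le_of_abs_le (abs_nrm_le h x))

theorem isPrim_nrm {S : C(AddCircle L, ℝ)} {s : L2 L} (h : IsPrim S s) : IsPrim (nrm S) s := by
  have h1 := h.add (isPrim_const (L := L) (-logMean S))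
  rw [add_zero] at h1
  convert h1 using 1
  ext x
  simp [sub_eq_add_neg]

theorem IsPrim.sub {F G : C(AddCircle L, ℝ)} {f g : L2 L} (hF : IsPrim F f) (hG : IsPrim G g) :
    IsPrim (F - G) (f - g) := by
  have := hF.add (hG.smul (-1))
  rwa [neg_one_smul, neg_one_smul, ← sub_eq_add_neg, ← sub_eq_add_neg] at this

theorem sub_mulc (F G : C(AddCircle L, ℝ)) (f : L2 L) : mulc (F - G) f = mulc F f - mulc G f := by
  have : F - G = F + (-1 : ℝ) • G := by rw [neg_one_smul, sub_eq_add_neg]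
  rw [this, add_mulc, smul_mulc, neg_one_smul, sub_eq_add_neg]

theorem mulc_sub (F : C(AddCircle L, ℝ)) (f g : L2 L) : mulc F (f - g) = mulc F f - mulc F g := by
  have : f - g = f + (-1 : ℝ) • g := by rw [neg_one_smul, sub_eq_add_neg]
  rw [this, mulc_add, mulc_smul, neg_one_smul, sub_eq_add_neg]

theorem norm_conj_diffeo_le {S : C(AddCircle L, ℝ)} {R : ℝ} (h : ∀ x, |S x| ≤ R) (a : ℝ)
    (f : L2 L) : ‖(diffeo S a).conj f‖ ≤ √(Real.exp (-(2 * R)))⁻¹ * √(Real.exp (2 * R)) * ‖f‖ :=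
  (diffeo S a).norm_conj_le (Real.exp_pos _) (le_diffeo_q h a) (diffeo_q_le h a) f

/-- The normalising factors `e^{-logMean S}` in `q` and `e^{logMean S}` in `q⁻¹` are constants and
cancel through the linear operator, leaving `S` itself. All estimates for derivatives of the field
rest on this formula. -/
theorem hasWeakDeriv_conj_diffeo (S : C(AddCircle L, ℝ)) (a : ℝ) {f g : L2 L}
    (h : HasWeakDeriv f g) : HasWeakDeriv ((diffeo S a).conj f)
      (mulc (cexp S) ((diffeo S a).conj (mulc (cexp (-S)) g))) := by
  have h1 := (diffeo S a).hasWeakDeriv_conj h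
  have e1 : (diffeo S a).q = Real.exp (-logMean S) • cexp S := by
    ext x
    simp [diffeo_q, sub_eq_add_neg, Real.exp_add, mul_comm]
  have e2 : (diffeo S a).qinv = Real.exp (logMean S) • cexp (-S) := by
    ext x
    change (Real.exp (S x - logMean S))⁻¹ = _
    rw [← Real.exp_neg, neg_sub, sub_eq_add_neg, Real.exp_add]
    rfl
  rw [e1, e2, smul_mulc, smul_mulc, CDiff.conj_smul, mulc_smul, smul_smul, ← Real.exp_add,
    neg_add_cancel, Real.exp_zero, one_smul] at h1
  exact h1

/-- Lipschitz dependence of the conjugated Hilbert transform on the logarithmic derivative. -/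
theorem exists_norm_conj_diffeo_sub_le (R : ℝ) : ∃ K, 0 ≤ K ∧
    ∀ (S T : C(AddCircle L, ℝ)) (s t f : L2 L) (a δ : ℝ), IsPrim S s → IsPrim T t →
      (∀ x, |S x| ≤ R) → (∀ x, |T x| ≤ R) → ‖s‖ ≤ R → ‖t‖ ≤ R → (∀ x, |(S - T) x| ≤ δ) →
      ‖s - t‖ ≤ δ → ‖(diffeo S a).conj f - (diffeo T a).conj f‖ ≤ K * δ * ‖f‖ := by
  set B := Real.exp (2 * R)
  have hB : 0 < B := Real.exp_pos _
  set K := kernelConst L (Real.exp (-(2 * R))) B (B * |R|)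
  have hL0 := hL.out
  have hp := Real.pi_pos
  have hK : 0 ≤ K := by
    have := Real.exp_pos (-(2 * R))
    simp only [K, kernelConst]
    positivity
  have hS := (singInt_pos (L := L)).le
  refine ⟨2 * (L⁻¹ * (K * (2 * B * |R| + 2 * B))) * singInt L, by positivity, ?_⟩
  intro S T s t f a δ hSs hTt hSR hTR hs ht hd hd'
  have hR0 : 0 ≤ R := (norm_nonneg _).trans hs
  have hδ0 : 0 ≤ δ := (norm_nonneg _).trans hd'
  have hdn : ∀ x, |nrm S x - nrm T x| ≤ 2 * δ := by
    intro x
    have h1 := abs_logMean_sub_le hd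
    have h2 : nrm S x - nrm T x = (S - T) x - (logMean S - logMean T) := by
      simp only [nrm_apply, ContinuousMap.sub_apply]; ring
    rw [h2]
    have h3 := abs_sub ((S - T) x) (logMean S - logMean T)
    linarith [hd x]
  have hq : ∀ x, |(diffeo S a).q x - (diffeo T a).q x| ≤ B * (2 * δ) := fun x =>
    (abs_exp_sub_exp_le (abs_nrm_le hSR x) (abs_nrm_le hTR x)).trans (by gcongr; exact hdn x)
  have hqS := (isPrim_nrm hSs).exp
  have hqT := (isPrim_nrm hTt).exp
  -- The difference of the derivatives of the two Jacobians, in `L²`; `IsPrim.holder` converts it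
  -- into the Hölder bound for the difference of the Jacobians that the kernel comparison requires.
  have hder : ‖mulc (cexp (nrm S)) s - mulc (cexp (nrm T)) t‖ ≤ (2 * B * |R| + 2 * B) * δ := by
    have e : mulc (cexp (nrm S)) s - mulc (cexp (nrm T)) t
        = mulc (cexp (nrm S) - cexp (nrm T)) s + mulc (cexp (nrm T)) (s - t) := by
      rw [sub_mulc, mulc_sub]; abel
    rw [e]
    have n1 := norm_mulc_le (F := cexp (nrm S) - cexp (nrm T)) (c := B * (2 * δ)) hq s
    have n2 := norm_mulc_le (F := cexp (nrm T)) (c := B) (fun x => by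
      rw [cexp_apply, abs_of_pos (Real.exp_pos _)]; exact diffeo_q_le hTR a x) (s - t)
    rw [abs_of_nonneg hR0]
    calc _ ≤ B * (2 * δ) * ‖s‖ + B * ‖s - t‖ := (norm_add_le _ _).trans (add_le_add n1 n2)
      _ ≤ B * (2 * δ) * R + B * δ := by gcongr
      _ ≤ _ := by nlinarith [mul_nonneg hB.le hδ0]
  have hA : ‖mulc (cexp (nrm S)) s‖ ≤ B * |R| := by
    rw [abs_of_nonneg hR0]
    exact (norm_mulc_le (F := cexp (nrm S)) (c := B) (fun x => by
      rw [cexp_apply, abs_of_pos (Real.exp_pos _)]; exact diffeo_q_le hSR a x) s).trans (by gcongr)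
  have h := (diffeo S a).norm_conj_sub_conj_le (diffeo T a) (Real.exp_pos _) (le_diffeo_q hSR a)
    (le_diffeo_q hTR a) (diffeo_q_le hSR a) (diffeo_q_le hTR a) (A := B * |R|)
    (fun x y => (hqS.holder x y).trans (by gcongr)) (by positivity)
    (δ := (2 * B * |R| + 2 * B) * δ)
    (fun x => (hq x).trans (by
      have : 0 ≤ 2 * B * |R| * δ := by positivity
      linarith))
    (fun x y => ((hqS.sub hqT).holder x y).trans (by gcongr)) f
  refine h.trans (le_of_eq ?_)
  ring

/-! ### Sobolev bounds -/

/-- `f` has `k` weak derivatives, and they are all, including `f`, bounded by `C` in `L²`. -/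
def SobB : ℕ → L2 L → ℝ → Prop
  | 0, f, C => ‖f‖ ≤ C
  | k + 1, f, C => ‖f‖ ≤ C ∧ ∃ g, HasWeakDeriv f g ∧ SobB k g C

namespace SobB

variable {k : ℕ} {f g : L2 L} {C D : ℝ}

theorem norm_le (h : SobB k f C) : ‖f‖ ≤ C := by
  cases k with
  | zero => exact h
  | succ k => exact h.1

theorem mono (h : SobB k f C) (hCD : C ≤ D) : SobB k f D := by
  induction k generalizing f with
  | zero => exact le_trans h hCD
  | succ k ih =>
    obtain ⟨h1, f', h2, h3⟩ := h
    exact ⟨h1.trans hCD, f', h2, ih h3⟩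

theorem of_succ (h : SobB (k + 1) f C) : SobB k f C := by
  induction k generalizing f with
  | zero => exact h.1
  | succ k ih =>
    obtain ⟨h1, f', h2, h3⟩ := h
    exact ⟨h1, f', h2, ih h3⟩

theorem of_le {j : ℕ} (h : SobB k f C) (hj : j ≤ k) : SobB j f C := by
  induction hj with
  | refl => exact h
  | step _ ih => exact ih h.of_succ

theorem add (hf : SobB k f C) (hg : SobB k g D) : SobB k (f + g) (C + D) := by
  induction k generalizing f g with
  | zero => exact (norm_add_le _ _).trans (add_le_add hf hg)
  | succ k ih =>
    obtain ⟨h1, f', h2, h3⟩ := hf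
    obtain ⟨k1, g', k2, k3⟩ := hg
    exact ⟨(norm_add_le _ _).trans (add_le_add h1 k1), f' + g', h2.add k2, ih h3 k3⟩

theorem smul (c : ℝ) (hf : SobB k f C) : SobB k (c • f) (|c| * C) := by
  induction k generalizing f with
  | zero =>
    change ‖c • f‖ ≤ _
    rw [norm_smul]
    exact mul_le_mul_of_nonneg_left hf (norm_nonneg _)
  | succ k ih =>
    obtain ⟨h1, f', h2, h3⟩ := hf
    refine ⟨?_, c • f', h2.smul c, ih h3⟩
    rw [norm_smul]
    exact mul_le_mul_of_nonneg_left h1 (norm_nonneg _)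

theorem neg (hf : SobB k f C) : SobB k (-f) C := by
  have := hf.smul (-1)
  rwa [neg_one_smul, abs_neg, abs_one, one_mul] at this

theorem deriv (hf : SobB (k + 1) f C) (h : HasWeakDeriv f g) : SobB k g C := by
  obtain ⟨-, f', h2, h3⟩ := hf
  rwa [h.unique h2]

end SobB

variable (L) in
/-- The constant of the embedding `H¹ ⊆ C`. -/
def supConst : ℝ := 1 + (√L)⁻¹ + √L

theorem one_le_supConst : 1 ≤ supConst L := by
  have := hL.out
  have h : 0 ≤ (√L)⁻¹ + √L := by positivity
  unfold supConst
  linarith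

theorem SobB.exists_rep {k : ℕ} {f : L2 L} {C : ℝ} (h : SobB (k + 1) f C) :
    ∃ F f', f = toL F ∧ IsPrim F f' ∧ SobB k f' C ∧ ∀ x, |F x| ≤ supConst L * C := by
  obtain ⟨h1, f', h2, h3⟩ := h
  obtain ⟨F, rfl, hF⟩ := h2.exists_isPrim
  refine ⟨F, f', rfl, hF, h3, fun x => (hF.abs_le x).trans ?_⟩
  have h4 := h3.norm_le
  have hC : 0 ≤ C := (norm_nonneg _).trans h1
  have hL0 := hL.out
  calc _ ≤ (√L)⁻¹ * C + √L * C := by gcongr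
    _ ≤ _ := by unfold supConst; linarith

/-- `F` is bounded by `R` in the supremum norm and in `Hᵏ`. -/
def BdB (k : ℕ) (F : C(AddCircle L, ℝ)) (R : ℝ) : Prop := (∀ x, |F x| ≤ R) ∧ SobB k (toL F) R

namespace BdB

variable {k : ℕ} {F G : C(AddCircle L, ℝ)} {R : ℝ}

theorem nonneg (h : BdB k F R) : 0 ≤ R := (abs_nonneg _).trans (h.1 0)

theorem of_succ (h : BdB (k + 1) F R) : BdB k F R := ⟨h.1, h.2.of_succ⟩

theorem of_le {j : ℕ} (h : BdB k F R) (hj : j ≤ k) : BdB j F R := ⟨h.1, h.2.of_le hj⟩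

theorem mono {R' : ℝ} (h : BdB k F R) (hR : R ≤ R') : BdB k F R' :=
  ⟨fun x => (h.1 x).trans hR, h.2.mono hR⟩

theorem neg (h : BdB k F R) : BdB k (-F) R :=
  ⟨fun x => by rw [ContinuousMap.neg_apply, abs_neg]; exact h.1 x, by rw [map_neg]; exact h.2.neg⟩

theorem exists_deriv (h : BdB (k + 1) F R) : ∃ f, IsPrim F f ∧ SobB k f R := by
  obtain ⟨-, f, h2, h3⟩ := h.2
  exact ⟨f, hasWeakDeriv_toL.1 h2, h3⟩

end BdB

/-- The constant in the product estimate. -/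
def mulConst (L : ℝ) (k : ℕ) : ℝ := (1 + supConst L) ^ k

theorem mulConst_pos (k : ℕ) : 0 < mulConst L k := by
  have := one_le_supConst (L := L)
  unfold mulConst
  positivity

/-- Leibniz' rule and induction. In the term with the derivative on `F` the roles are exchanged: `g`
has a continuous representative, at the price of `supConst`, whence the factor `1 + supConst L` per
derivative. -/
theorem BdB.mulc {k : ℕ} {F : C(AddCircle L, ℝ)} {g : L2 L} {R C : ℝ} (hF : BdB k F R)
    (hg : SobB k g C) : SobB k (mulc F g) (mulConst L k * R * C) := by
  have hC : 0 ≤ C := (norm_nonneg _).trans hg.norm_le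
  have hR := hF.nonneg
  have hs := one_le_supConst (L := L)
  induction k generalizing F g R C with
  | zero =>
    change ‖_‖ ≤ _
    rw [mulConst, pow_zero, one_mul]
    exact (norm_mulc_le hF.1 g).trans (mul_le_mul_of_nonneg_left hg hR)
  | succ k ih =>
    obtain ⟨f, hFf, hf⟩ := hF.exists_deriv
    obtain ⟨G, g', rfl, hG, hg', hGs⟩ := hg.exists_rep
    have hGb : BdB k G (supConst L * C) :=
      ⟨hGs, hg.of_succ.mono (le_mul_of_one_le_left hC hs)⟩
    have e1 := ih hF.of_succ hg' hC hR
    have e2 := ih hGb hf hR hGb.nonneg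
    have hm := mulConst_pos (L := L) k
    refine ⟨(norm_mulc_le hF.1 _).trans ?_, _, ?_, (e1.add e2).mono ?_⟩
    · have h1 : 1 ≤ mulConst L (k + 1) := one_le_pow₀ (by linarith)
      have h2 := hg.norm_le
      calc R * ‖toL G‖ ≤ R * C := by gcongr
        _ ≤ mulConst L (k + 1) * (R * C) := le_mul_of_one_le_left (by positivity) h1
        _ = _ := by ring
    · rw [mulc_toL, hasWeakDeriv_toL]
      exact hFf.mul hG
    · refine le_of_eq ?_
      simp only [mulConst, pow_succ]
      ring

/-- By induction from `(e^F)' = e^F F'`, where the factor `e^F` needs one derivative less. -/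
theorem exists_cexp_bound (k : ℕ) (R : ℝ) : ∃ C, 0 ≤ C ∧ ∀ F : C(AddCircle L, ℝ), BdB k F R →
    BdB k (cexp F) C := by
  induction k with
  | zero =>
    refine ⟨Real.exp R + √L * Real.exp R, by positivity, fun F hF => ?_⟩
    have h1 : ∀ x, |cexp F x| ≤ Real.exp R := fun x => by
      rw [cexp_apply, Real.abs_exp]
      exact Real.exp_le_exp.2 (le_of_abs_le (hF.1 x))
    refine ⟨fun x => (h1 x).trans (le_add_of_nonneg_right (by positivity)), ?_⟩
    exact (norm_toL_le h1).trans (le_add_of_nonneg_left (by positivity))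
  | succ k ih =>
    obtain ⟨C, hC, h⟩ := ih
    have hm := mulConst_pos (L := L) k
    refine ⟨C + mulConst L k * C * |R|, by positivity, fun F hF => ?_⟩
    have h1 := h F hF.of_succ
    obtain ⟨f, hFf, hf⟩ := hF.exists_deriv
    have h2 := h1.mulc hf
    have hR := hF.nonneg
    rw [abs_of_nonneg hR]
    refine ⟨fun x => (h1.1 x).trans (le_add_of_nonneg_right (by positivity)),
      h1.2.norm_le.trans (le_add_of_nonneg_right (by positivity)), _, hFf.exp.hasWeakDeriv,
      h2.mono (le_add_of_nonneg_left hC)⟩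

theorem exists_cexp_sub_bound (k : ℕ) (R : ℝ) : ∃ C, 0 ≤ C ∧ ∀ (F G : C(AddCircle L, ℝ)) (δ : ℝ),
    BdB k F R → BdB k G R → BdB k (F - G) δ → BdB k (cexp F - cexp G) (C * δ) := by
  induction k with
  | zero =>
    refine ⟨Real.exp R + √L * Real.exp R, by positivity, fun F G δ hF hG hFG => ?_⟩
    have hδ := hFG.nonneg
    have h1 : ∀ x, |(cexp F - cexp G) x| ≤ Real.exp R * δ := fun x =>
      (abs_exp_sub_exp_le (hF.1 x) (hG.1 x)).trans (by gcongr; exact hFG.1 x)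
    refine ⟨fun x => (h1 x).trans ?_, (norm_toL_le h1).trans ?_⟩
    · gcongr
      exact le_add_of_nonneg_right (by positivity)
    · rw [← mul_assoc]
      gcongr
      exact le_add_of_nonneg_left (by positivity)
  | succ k ih =>
    obtain ⟨C, hC, h⟩ := ih
    obtain ⟨D, hD, hexp⟩ := exists_cexp_bound (L := L) k R
    have hm := mulConst_pos (L := L) k
    refine ⟨C + (mulConst L k * C * |R| + mulConst L k * D), by positivity,
      fun F G δ hF hG hFG => ?_⟩
    have hδ := hFG.nonneg
    have h1 := h F G δ hF.of_succ hG.of_succ hFG.of_succ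
    obtain ⟨f, hFf, hf⟩ := hF.exists_deriv
    obtain ⟨g, hGg, hg⟩ := hG.exists_deriv
    have hfg : SobB k (f - g) δ := hFG.2.deriv (hFf.sub hGg).hasWeakDeriv
    have e : mulc (cexp F) f - mulc (cexp G) g
        = mulc (cexp F - cexp G) f + mulc (cexp G) (f - g) := by
      rw [sub_mulc, mulc_sub]; abel
    have h2 := (h1.mulc hf).add ((hexp G hG.of_succ).mulc hfg)
    have hR := hF.nonneg
    rw [← e] at h2
    rw [abs_of_nonneg hR]
    refine ⟨fun x => (h1.1 x).trans ?_, h1.2.norm_le.trans ?_, _,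
      (hFf.exp.sub hGg.exp).hasWeakDeriv, h2.mono ?_⟩
    · gcongr
      exact le_add_of_nonneg_right (by positivity)
    · gcongr
      exact le_add_of_nonneg_right (by positivity)
    · have : 0 ≤ C * δ := by positivity
      linarith

/-- Induction on `k` through `hasWeakDeriv_conj_diffeo`: the derivative is the same operator between
two multiplications by exponentials of `∓S`. -/
theorem exists_conj_bound (k : ℕ) (R : ℝ) : ∃ C, 0 ≤ C ∧
    ∀ (S : C(AddCircle L, ℝ)) (a : ℝ) (f : L2 L) (A : ℝ), BdB k S R → SobB k f A →
      SobB k ((diffeo S a).conj f) (C * A) := by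
  induction k with
  | zero =>
    refine ⟨√(Real.exp (-(2 * R)))⁻¹ * √(Real.exp (2 * R)), by positivity,
      fun S a f A hS hf => (norm_conj_diffeo_le hS.1 a f).trans ?_⟩
    gcongr
    exact hf
  | succ k ih =>
    obtain ⟨C, hC, h⟩ := ih
    obtain ⟨D, hD, hexp⟩ := exists_cexp_bound (L := L) k R
    have hm := mulConst_pos (L := L) k
    refine ⟨C + mulConst L k * D * (C * (mulConst L k * D)), by positivity,
      fun S a f A hS hf => ?_⟩
    have hA : 0 ≤ A := (norm_nonneg _).trans hf.norm_le
    have h1 := h S a f A hS.of_succ hf.of_succ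
    obtain ⟨-, f', hf1, hf2⟩ := hf
    have h2 := (hexp _ hS.of_succ.neg).mulc hf2
    have h3 := (hexp _ hS.of_succ).mulc (h S a _ _ hS.of_succ h2)
    refine ⟨h1.norm_le.trans ?_, _, hasWeakDeriv_conj_diffeo S a hf1, h3.mono ?_⟩
    · gcongr
      exact le_add_of_nonneg_right (by positivity)
    · have : 0 ≤ C * A := by positivity
      nlinarith

/-- The `L²` comparison at `k = 0` already needs `S` and `T` in `H¹`; the `BdB 1` hypotheses are
therefore carried along separately while the order `k` decreases in the induction. -/
theorem exists_conj_sub_bound (k : ℕ) (R : ℝ) : ∃ C, 0 ≤ C ∧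
    ∀ (S T : C(AddCircle L, ℝ)) (a : ℝ) (f : L2 L) (A δ : ℝ), BdB 1 S R → BdB 1 T R →
      BdB 1 (S - T) δ → BdB k S R → BdB k T R → BdB k (S - T) δ → SobB k f A →
      SobB k ((diffeo S a).conj f - (diffeo T a).conj f) (C * δ * A) := by
  induction k with
  | zero =>
    obtain ⟨K, hK, h⟩ := exists_norm_conj_diffeo_sub_le (L := L) R
    refine ⟨K, hK, fun S T a f A δ hS hT hST _ _ _ hf => ?_⟩
    obtain ⟨s, hSs, hs⟩ := hS.exists_deriv
    obtain ⟨t, hTt, ht⟩ := hT.exists_deriv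
    have hδ := hST.nonneg
    refine (h S T s t f a δ hSs hTt hS.1 hT.1 hs.norm_le ht.norm_le hST.1
      (hST.2.deriv (hSs.sub hTt).hasWeakDeriv)).trans ?_
    gcongr
    exact hf
  | succ k ih =>
    obtain ⟨C, hC, h⟩ := ih
    obtain ⟨D, hD, hexp⟩ := exists_cexp_bound (L := L) k R
    obtain ⟨E, hE, hexps⟩ := exists_cexp_sub_bound (L := L) k R
    obtain ⟨B, hB, hconj⟩ := exists_conj_bound (L := L) k R
    have hm := mulConst_pos (L := L) k
    set m := mulConst L k
    refine ⟨C + (m * E * (B * (m * D)) + (m * D * (C * (m * D)) + m * D * (B * (m * E)))),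
      by positivity, fun S T a f A δ hS hT hST hSk hTk hSTk hf => ?_⟩
    have hA : 0 ≤ A := (norm_nonneg _).trans hf.norm_le
    have hδ := hST.nonneg
    have h1 := h S T a f A δ hS hT hST hSk.of_succ hTk.of_succ hSTk.of_succ hf.of_succ
    obtain ⟨-, f', hf1, hf2⟩ := hf
    have hneg : BdB k (-S - -T) δ := by
      have := hSTk.of_succ.neg
      rwa [neg_sub', sub_neg_eq_add, ← sub_neg_eq_add] at this
    have m1 := (hexp _ hSk.of_succ.neg).mulc hf2
    have m2 := (hexps (-S) (-T) δ hSk.of_succ.neg hTk.of_succ.neg hneg).mulc hf2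
    have t1 := (hexps S T δ hSk.of_succ hTk.of_succ hSTk.of_succ).mulc
      (hconj S a _ _ hSk.of_succ m1)
    have t2 := (hexp T hTk.of_succ).mulc
      (h S T a _ _ δ hS hT hST hSk.of_succ hTk.of_succ hSTk.of_succ m1)
    have t3 := (hexp T hTk.of_succ).mulc (hconj T a _ _ hTk.of_succ m2)
    have t := t1.add (t2.add t3)
    -- `S` is replaced by `T` in one place at a time: outer exponential, operator, inner
    -- exponential.
    have e : mulc (cexp S) ((diffeo S a).conj (mulc (cexp (-S)) f'))
          - mulc (cexp T) ((diffeo T a).conj (mulc (cexp (-T)) f'))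
        = mulc (cexp S - cexp T) ((diffeo S a).conj (mulc (cexp (-S)) f'))
          + (mulc (cexp T) ((diffeo S a).conj (mulc (cexp (-S)) f')
              - (diffeo T a).conj (mulc (cexp (-S)) f'))
            + mulc (cexp T) ((diffeo T a).conj (mulc (cexp (-S) - cexp (-T)) f'))) := by
      rw [sub_mulc, sub_mulc, mulc_sub, CDiff.conj_sub, mulc_sub]; abel
    rw [← e] at t
    have hd := (hasWeakDeriv_conj_diffeo S a hf1).add
      ((hasWeakDeriv_conj_diffeo T a hf1).smul (-1))
    rw [neg_one_smul, neg_one_smul, ← sub_eq_add_neg, ← sub_eq_add_neg] at hd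
    refine ⟨h1.norm_le.trans ?_, _, hd, t.mono ?_⟩
    · gcongr
      exact le_add_of_nonneg_right (by positivity)
    · have : 0 ≤ C * δ * A := by positivity
      nlinarith

/-! ### The Sobolev spaces as Banach spaces -/

theorem norm_fc_sq_le (f : L2 L) (n : ℤ) : ‖fc f n‖ ^ 2 ≤ L⁻¹ * ‖f‖ ^ 2 :=
  le_hasSum (hasSum_norm_sq_fc f) n fun _ _ => sq_nonneg _

theorem norm_fc_le (f : L2 L) (n : ℤ) : ‖fc f n‖ ≤ √(L⁻¹) * ‖f‖ := by
  have h := Real.sqrt_le_sqrt (norm_fc_sq_le f n)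
  rwa [Real.sqrt_sq (norm_nonneg _), Real.sqrt_mul (inv_nonneg.2 hL.out.le),
    Real.sqrt_sq (norm_nonneg _)] at h

theorem continuous_fc (n : ℤ) : Continuous fun f : L2 L => fc f n := by
  refine (LipschitzWith.of_dist_le_mul (K := ⟨√(L⁻¹), Real.sqrt_nonneg _⟩) fun f g => ?_).continuous
  rw [dist_eq_norm, dist_eq_norm, ← fc_sub]
  exact norm_fc_le _ _

theorem hasWeakDeriv_iff_fc {f g : L2 L} :
    HasWeakDeriv f g ↔ ∀ n, fc g n = (freq L n * Complex.I) * fc f n :=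
  ⟨fc_of_hasWeakDeriv, hasWeakDeriv_of_fc⟩

/-- Each relation between Fourier coefficients is a closed condition. Completeness of `Hᵏ` is what
Picard–Lindelöf requires. -/
theorem isClosed_sobolev (k : ℕ) :
    IsClosed (Sobolev L k : Set (PiLp 2 (fun _ : Fin (k + 1) => L2 L))) := by
  have h : (Sobolev L k : Set (PiLp 2 (fun _ : Fin (k + 1) => L2 L)))
      = ⋂ (j : Fin k) (n : ℤ),
        {F | fc (F j.succ) n = (freq L n * Complex.I) * fc (F j.castSucc) n} := by
    ext F
    simp only [mem_iInter, mem_ofPred_eq]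
    exact forall_congr' fun j => hasWeakDeriv_iff_fc
  rw [h]
  refine isClosed_iInter fun j => isClosed_iInter fun n => isClosed_eq ?_ ?_
  · exact (continuous_fc n).comp (PiLp.continuous_apply 2 _ _)
  · exact continuous_const.mul ((continuous_fc n).comp (PiLp.continuous_apply 2 _ _))

instance (k : ℕ) : CompleteSpace (Sobolev L k) := (isClosed_sobolev k).completeSpace_coe

namespace Sobolev

variable {k : ℕ}

theorem norm_wderiv_le (F : Sobolev L k) (j : ℕ) (hj : j ≤ k) : ‖wderiv F j hj‖ ≤ ‖F‖ :=
  PiLp.norm_apply_le F.1 _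

theorem hasWeakDeriv (F : Sobolev L k) (j : ℕ) (hj : j + 1 ≤ k) :
    HasWeakDeriv (wderiv F j (Nat.le_of_succ_le hj)) (wderiv F (j + 1) hj) :=
  F.2 ⟨j, hj⟩

theorem sobB_wderiv (F : Sobolev L k) (i j : ℕ) (hij : j + i ≤ k) :
    SobB i (wderiv F j ((Nat.le_add_right j i).trans hij)) ‖F‖ := by
  induction i generalizing j with
  | zero => exact norm_wderiv_le F j _
  | succ i ih =>
    exact ⟨norm_wderiv_le F j _, _, hasWeakDeriv F j (by omega), ih (j + 1) (by omega)⟩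

theorem sobB (F : Sobolev L k) : SobB k (wderiv F 0 (Nat.zero_le k)) ‖F‖ :=
  sobB_wderiv F k 0 (by omega)

@[ext] theorem ext_wderiv {F G : Sobolev L k}
    (h : wderiv F 0 (Nat.zero_le k) = wderiv G 0 (Nat.zero_le k)) : F = G := by
  have key : ∀ j (hj : j ≤ k), wderiv F j hj = wderiv G j hj := by
    intro j
    induction j with
    | zero => exact fun _ => h
    | succ j ih =>
      intro hj
      have h1 := hasWeakDeriv F j hj
      rw [ih] at h1
      exact h1.unique (hasWeakDeriv G j hj)
  ext i : 2
  exact key i.1 (Nat.le_of_lt_succ i.2)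

theorem norm_le_of_forall {F : Sobolev L k} {C : ℝ} (hC : 0 ≤ C) (h : ∀ j, ‖F.1 j‖ ≤ C) :
    ‖F‖ ≤ (k + 1) * C := by
  change ‖F.1‖ ≤ _
  rw [PiLp.norm_eq_of_L2]
  refine Real.sqrt_le_iff.2 ⟨by positivity, ?_⟩
  calc ∑ i, ‖F.1 i‖ ^ 2 ≤ ∑ _i : Fin (k + 1), C ^ 2 :=
        Finset.sum_le_sum fun i _ => by gcongr; exact h i
    _ = (k + 1) * C ^ 2 := by simp
    _ ≤ (k + 1) ^ 2 * C ^ 2 := by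
        gcongr
        nlinarith [(Nat.cast_nonneg k : (0 : ℝ) ≤ k)]
    _ = _ := by ring

/-- The function with derivatives `f, F, F', …`. -/
def cons (f : L2 L) (F : Sobolev L k) (h : HasWeakDeriv f (wderiv F 0 (Nat.zero_le k))) :
    Sobolev L (k + 1) :=
  ⟨WithLp.toLp 2 (Fin.cons f F.1), fun j => by
    refine Fin.cases ?_ (fun i => ?_) j
    · exact h
    · exact F.2 i⟩

theorem exists_wderiv_eq {f : L2 L} {C : ℝ} (h : SobB k f C) :
    ∃ F : Sobolev L k, wderiv F 0 (Nat.zero_le k) = f ∧ ∀ j, ‖F.1 j‖ ≤ C := by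
  induction k generalizing f with
  | zero =>
    refine ⟨⟨WithLp.toLp 2 fun _ => f, fun j => j.elim0⟩, rfl, fun j => h⟩
  | succ k ih =>
    obtain ⟨h1, f', h2, h3⟩ := h
    obtain ⟨F, rfl, hF⟩ := ih h3
    refine ⟨cons f F h2, rfl, fun j => ?_⟩
    refine Fin.cases ?_ (fun i => ?_) j
    · exact h1
    · exact hF i

theorem norm_le_of_sobB {F : Sobolev L k} {C : ℝ} (h : SobB k (wderiv F 0 (Nat.zero_le k)) C) :
    ‖F‖ ≤ (k + 1) * C := by
  obtain ⟨G, hG, hGC⟩ := exists_wderiv_eq h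
  rw [← ext_wderiv hG]
  exact norm_le_of_forall ((norm_nonneg _).trans h.norm_le) hGC

variable (k) in
/-- The element of `Hᵏ` given by a square integrable function (`0` if there is none). -/
def ofL2 (f : L2 L) : Sobolev L k :=
  open Classical in
  if h : ∃ F : Sobolev L k, wderiv F 0 (Nat.zero_le k) = f then h.choose else 0

theorem wderiv_ofL2_of_exists {f : L2 L}
    (h : ∃ F : Sobolev L k, wderiv F 0 (Nat.zero_le k) = f) :
    wderiv (ofL2 k f) 0 (Nat.zero_le k) = f := by
  rw [ofL2, dif_pos h]
  exact h.choose_spec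

theorem wderiv_ofL2 {f : L2 L} {C : ℝ} (h : SobB k f C) :
    wderiv (ofL2 k f) 0 (Nat.zero_le k) = f := by
  obtain ⟨F, hF, -⟩ := exists_wderiv_eq h
  exact wderiv_ofL2_of_exists ⟨F, hF⟩

/-- The `j`-th weak derivative as a bounded operator. -/
def wderivL (j : ℕ) (hj : j ≤ k) : Sobolev L k →L[ℝ] L2 L :=
  LinearMap.mkContinuous
    { toFun := fun F => wderiv F j hj
      map_add' := fun _ _ => rfl
      map_smul' := fun _ _ => rfl } 1 fun F => by
    rw [one_mul]
    exact norm_wderiv_le F j hj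

@[simp] theorem wderivL_apply (j : ℕ) (hj : j ≤ k) (F : Sobolev L k) :
    wderivL j hj F = wderiv F j hj := rfl

theorem wderiv_sub (F G : Sobolev L k) (j : ℕ) (hj : j ≤ k) :
    wderiv (F - G) j hj = wderiv F j hj - wderiv G j hj := rfl

/-- The `i`-th derivative from `Hᵏ` to `Hʲ`. -/
def derivL (i j : ℕ) (hij : i + j ≤ k) : Sobolev L k →L[ℝ] Sobolev L j :=
  LinearMap.mkContinuous
    { toFun := fun F => ⟨WithLp.toLp 2 fun l => F.1 ⟨i + l, by omega⟩,
        fun l => F.2 ⟨i + l, by omega⟩⟩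
      map_add' := fun _ _ => rfl
      map_smul' := fun _ _ => rfl } (j + 1) fun F =>
    norm_le_of_forall (norm_nonneg _) fun l => norm_wderiv_le F (i + l) (by omega)

theorem wderiv_incl {j : ℕ} (hj : j ≤ k) (F : Sobolev L k) (l : ℕ) (hl : l ≤ j) :
    wderiv (incl hj F) l hl = wderiv F l (hl.trans hj) := rfl

theorem exists_rep (hk : 1 ≤ k) (F : Sobolev L k) : ∃ G : C(AddCircle L, ℝ),
    toL G = wderiv F 0 (Nat.zero_le k) ∧ ∀ x, |G x| ≤ supConst L * ‖F‖ := by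
  obtain ⟨G, f', h1, -, -, h2⟩ := (sobB_wderiv F (0 + 1) 0 (by omega)).exists_rep
  exact ⟨G, h1.symm, h2⟩

/-- The continuous representative of a function in `Hᵏ`, `k ≥ 1`. -/
def rep (hk : 1 ≤ k) : Sobolev L k →L[ℝ] C(AddCircle L, ℝ) :=
  LinearMap.mkContinuous
    { toFun := fun F => (exists_rep hk F).choose
      map_add' := fun F G => toL_injective <| by
        rw [map_add, (exists_rep hk F).choose_spec.1, (exists_rep hk G).choose_spec.1,
          (exists_rep hk (F + G)).choose_spec.1]
        rfl
      map_smul' := fun c F => toL_injective <| by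
        rw [RingHom.id_apply, map_smul, (exists_rep hk F).choose_spec.1,
          (exists_rep hk (c • F)).choose_spec.1]
        rfl } (supConst L) fun F =>
    (ContinuousMap.norm_le _ (mul_nonneg (zero_le_one.trans one_le_supConst)
      (norm_nonneg _))).2 (exists_rep hk F).choose_spec.2

theorem toL_rep (hk : 1 ≤ k) (F : Sobolev L k) : toL (rep hk F) = wderiv F 0 (Nat.zero_le k) :=
  (exists_rep hk F).choose_spec.1

theorem abs_rep_le (hk : 1 ≤ k) (F : Sobolev L k) (x : AddCircle L) :
    |rep hk F x| ≤ supConst L * ‖F‖ :=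
  (exists_rep hk F).choose_spec.2 x

theorem isPrim_rep (hk : 1 ≤ k) (F : Sobolev L k) : IsPrim (rep hk F) (wderiv F 1 hk) := by
  rw [← hasWeakDeriv_toL, toL_rep]
  exact hasWeakDeriv F 0 hk

theorem bdB_rep (hk : 1 ≤ k) (F : Sobolev L k) : BdB k (rep hk F) (supConst L * ‖F‖) := by
  refine ⟨abs_rep_le hk F, ?_⟩
  rw [toL_rep]
  exact (sobB F).mono (le_mul_of_one_le_left (norm_nonneg _) one_le_supConst)

end Sobolev

open Sobolev

/-! ### The vector field -/

section VectorField

variable {m : ℕ} (hm : 1 ≤ m)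

/-- The vector field of the model in Lagrangian coordinates: the unknowns are the logarithm of the
Jacobian of the flow and the vorticity along the flow. -/
def field (u' : Sobolev L m) (X : Sobolev L m × Sobolev L m) : Sobolev L m × Sobolev L m :=
  (ofL2 m ((diffeo (rep hm X.1) 0).conj (wderiv X.2 0 (Nat.zero_le m))),
    ofL2 m (mulc (cexp (-rep hm X.1)) (wderiv u' 0 (Nat.zero_le m))))

theorem wderiv_field_fst (u' : Sobolev L m) (X : Sobolev L m × Sobolev L m) :
    wderiv (field hm u' X).1 0 (Nat.zero_le m)
      = (diffeo (rep hm X.1) 0).conj (wderiv X.2 0 (Nat.zero_le m)) := by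
  obtain ⟨C, -, h⟩ := exists_conj_bound (L := L) m (supConst L * ‖X.1‖)
  exact wderiv_ofL2 (h _ 0 _ _ (bdB_rep hm X.1) (sobB X.2))

theorem wderiv_field_snd (u' : Sobolev L m) (X : Sobolev L m × Sobolev L m) :
    wderiv (field hm u' X).2 0 (Nat.zero_le m)
      = mulc (cexp (-rep hm X.1)) (wderiv u' 0 (Nat.zero_le m)) := by
  obtain ⟨C, -, h⟩ := exists_cexp_bound (L := L) m (supConst L * ‖X.1‖)
  exact wderiv_ofL2 ((h _ (bdB_rep hm X.1).neg).mulc (sobB u'))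

/-- The first component is Lipschitz in `X.1` by `exists_conj_sub_bound` and bounded linear in `X.2`
by `exists_conj_bound`; the second depends on `X.1` only through an exponential. -/
theorem exists_field_lipschitz (u' : Sobolev L m) (R : ℝ) : ∃ K, 0 ≤ K ∧ ∀ X Y,
    ‖X‖ ≤ R → ‖Y‖ ≤ R → ‖field hm u' X - field hm u' Y‖ ≤ K * ‖X - Y‖ := by
  set s := supConst L
  have hs : 1 ≤ s := one_le_supConst
  have hs0 : 0 ≤ s := zero_le_one.trans hs
  obtain ⟨A, hA, hconj⟩ := exists_conj_bound (L := L) m (s * R)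
  obtain ⟨B, hB, hsub⟩ := exists_conj_sub_bound (L := L) m (s * R)
  obtain ⟨C, hC, hexp⟩ := exists_cexp_sub_bound (L := L) m (s * R)
  have hmul := mulConst_pos (L := L) m
  refine ⟨(m + 1) * (B * s * |R| + A) + (m + 1) * (mulConst L m * (C * s) * ‖u'‖), by positivity,
    fun X Y hX hY => ?_⟩
  have hR : 0 ≤ R := (norm_nonneg _).trans hX
  have hX1 := (norm_fst_le X).trans hX
  have hX2 := (norm_snd_le X).trans hX
  have hY1 := (norm_fst_le Y).trans hY
  have hd1 : ‖X.1 - Y.1‖ ≤ ‖X - Y‖ := norm_fst_le (X - Y)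
  have hd2 : ‖X.2 - Y.2‖ ≤ ‖X - Y‖ := norm_snd_le (X - Y)
  have bX : BdB m (rep hm X.1) (s * R) := (bdB_rep hm X.1).mono (by gcongr)
  have bY : BdB m (rep hm Y.1) (s * R) := (bdB_rep hm Y.1).mono (by gcongr)
  have bd : BdB m (rep hm X.1 - rep hm Y.1) (s * ‖X - Y‖) := by
    rw [← map_sub]
    exact (bdB_rep hm _).mono (by gcongr)
  have h1 := (hsub _ _ 0 _ _ _ (bX.of_le hm) (bY.of_le hm) (bd.of_le hm) bX bY bd
    ((sobB X.2).mono hX2)).add (hconj _ 0 _ _ bY ((sobB (X.2 - Y.2)).mono hd2))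
  have h2 := (hexp (-rep hm X.1) (-rep hm Y.1) (s * ‖X - Y‖) bX.neg bY.neg (by
    have := bd.neg
    rwa [neg_sub', sub_neg_eq_add, ← sub_neg_eq_add] at this)).mulc (sobB u')
  rw [wderiv_sub, CDiff.conj_sub, sub_add_sub_cancel, ← wderiv_field_fst hm u',
    ← wderiv_field_fst hm u', ← wderiv_sub] at h1
  rw [sub_mulc, ← wderiv_field_snd, ← wderiv_field_snd, ← wderiv_sub] at h2
  have n1 := norm_le_of_sobB h1
  have n2 := norm_le_of_sobB h2
  rw [Prod.norm_def]
  have p1 : 0 ≤ (m + 1) * (mulConst L m * (C * s) * ‖u'‖) * ‖X - Y‖ := by positivity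
  have p2 : 0 ≤ (m + 1) * (B * s * |R| + A) * ‖X - Y‖ := by positivity
  rw [abs_of_nonneg hR] at p2 ⊢
  refine max_le (n1.trans ?_) (n2.trans ?_)
  · linarith
  · linarith

end VectorField

/-! ### Continuation of solutions of autonomous differential equations -/

section ODE

variable {E : Type*} [NormedAddCommGroup E] [NormedSpace ℝ E]

/-- `X` solves `X' = F X`, `X 0 = x₀`, on the time interval `(s, t)`. -/
def Solves (F : E → E) (x₀ : E) (s t : ℝ) (X : ℝ → E) : Prop :=
  X 0 = x₀ ∧ ∀ r ∈ Ioo s t, HasDerivAt X (F (X r)) r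

theorem Solves.continuousOn {F : E → E} {x₀ : E} {s t : ℝ} {X : ℝ → E} (h : Solves F x₀ s t X) :
    ContinuousOn X (Ioo s t) := fun r hr => (h.2 r hr).continuousAt.continuousWithinAt

theorem hasDerivAt_ite {X Y : ℝ → E} {c : ℝ} {e : E} (hX : HasDerivAt X e c)
    (hY : HasDerivAt Y e c) (hXY : X c = Y c) :
    HasDerivAt (fun r => if r ≤ c then X r else Y r) e c := by
  have h1 : HasDerivWithinAt (fun r => if r ≤ c then X r else Y r) e (Iic c) c :=
    hX.hasDerivWithinAt.congr (fun r hr => if_pos hr) (if_pos le_rfl)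
  have h2 : HasDerivWithinAt (fun r => if r ≤ c then X r else Y r) e (Ici c) c := by
    refine hY.hasDerivWithinAt.congr (fun r hr => ?_) ((if_pos le_rfl).trans hXY)
    rcases eq_or_lt_of_le (mem_Ici.1 hr) with rfl | h
    · exact (if_pos le_rfl).trans hXY
    · exact if_neg (not_le.2 h)
  have h3 := h1.union h2
  rw [Iic_union_Ici] at h3
  exact h3.hasDerivAt univ_mem

theorem Solves.glue {F : E → E} {x₀ : E} {s t c d : ℝ} {X Y : ℝ → E} (hX : Solves F x₀ s t X)
    (hc : c ∈ Ioo s t) (hc0 : 0 ≤ c) (hd : 0 < d)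
    (hY : ∀ r ∈ Ioo (c - d) (c + d), HasDerivAt Y (F (Y r)) r) (hXY : X c = Y c) :
    Solves F x₀ s (c + d) fun r => if r ≤ c then X r else Y r := by
  refine ⟨(if_pos hc0).trans hX.1, fun r hr => ?_⟩
  rcases lt_trichotomy r c with h | rfl | h
  · simp only [if_pos h.le]
    refine (hX.2 r ⟨hr.1, h.trans hc.2⟩).congr_of_eventuallyEq ?_
    filter_upwards [Iio_mem_nhds h] with x hx
    exact if_pos (le_of_lt hx)
  · simp only [le_refl, if_true]
    refine hasDerivAt_ite (hX.2 r hc) ?_ hXY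
    rw [hXY]
    exact hY r ⟨by linarith, by linarith⟩
  · simp only [if_neg (not_le.2 h)]
    refine (hY r ⟨by linarith, hr.2⟩).congr_of_eventuallyEq ?_
    filter_upwards [Ioi_mem_nhds h] with x hx
    exact if_neg (not_le.2 hx)

variable [CompleteSpace E]

/-- Picard–Lindelöf on the unit ball around `x`, where `F` is bounded by a constant depending only
on `R`; the existence time is therefore the same for all initial values in the ball. -/
theorem exists_uniform_local_solution {F : E → E} {R K : ℝ} (hR : 0 ≤ R) (hK : 0 ≤ K)
    (hF : ∀ x y, ‖x‖ ≤ R + 1 → ‖y‖ ≤ R + 1 → ‖F x - F y‖ ≤ K * ‖x - y‖) :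
    ∃ τ > 0, ∀ x, ‖x‖ ≤ R → ∀ c : ℝ, ∃ Y : ℝ → E, Y c = x ∧
      ∀ r ∈ Ioo (c - τ) (c + τ), HasDerivAt Y (F (Y r)) r := by
  set B := ‖F 0‖ + K * (R + 1) + 1
  have hB : 0 < B := by positivity
  have hFB : ∀ x, ‖x‖ ≤ R + 1 → ‖F x‖ ≤ B := by
    intro x hx
    have h1 := hF x 0 hx (by simp; linarith)
    have h2 := norm_le_norm_sub_add (F x) (F 0)
    rw [sub_zero] at h1
    have h3 : K * ‖x‖ ≤ K * (R + 1) := by gcongr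
    simp only [B]
    linarith
  refine ⟨B⁻¹, by positivity, fun x hx c => ?_⟩
  have hc : c ∈ Icc (c - B⁻¹) (c + B⁻¹) := by
    have : 0 < B⁻¹ := by positivity
    constructor <;> linarith
  have hball : ∀ y ∈ Metric.closedBall x ((1 : NNReal) : ℝ), ‖y‖ ≤ R + 1 := by
    intro y hy
    have h1 := mem_closedBall_iff_norm.1 hy
    have h2 := norm_le_norm_sub_add y x
    simp only [NNReal.coe_one] at h1
    linarith
  have hPL : IsPicardLindelof (fun _ => F) (tmin := c - B⁻¹) (tmax := c + B⁻¹) ⟨c, hc⟩ x 1 0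
      ⟨B, hB.le⟩ ⟨K, hK⟩ := by
    refine IsPicardLindelof.of_time_independent (fun y hy => hFB y (hball y hy)) ?_ ?_
    · refine LipschitzOnWith.of_dist_le_mul fun y hy z hz => ?_
      rw [dist_eq_norm, dist_eq_norm]
      exact hF y z (hball y hy) (hball z hz)
    · simp only [add_sub_cancel_left, sub_sub_cancel, max_self, NNReal.coe_one,
        NNReal.coe_zero, sub_zero]
      exact (mul_inv_cancel₀ hB.ne').le
  obtain ⟨Y, hY0, hY⟩ := hPL.exists_eq_forall_mem_Icc_hasDerivWithinAt₀
  exact ⟨Y, hY0, fun r hr => (hY r (Ioo_subset_Icc_self hr)).hasDerivAt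
    (Icc_mem_nhds hr.1 hr.2)⟩

/-- If all solutions defined up to time at most `T` satisfy a common bound, then there is a solution
defined beyond time `T`. -/
theorem exists_solves_beyond {F : E → E} {x₀ : E} {R T : ℝ}
    (hF : ∀ R, ∃ K, 0 ≤ K ∧ ∀ x y, ‖x‖ ≤ R → ‖y‖ ≤ R → ‖F x - F y‖ ≤ K * ‖x - y‖)
    (hx₀ : ‖x₀‖ ≤ R)
    (hR : ∀ ε > 0, ∀ t, 0 < t → t ≤ T → ∀ X, Solves F x₀ (-ε) t X → ∀ s ∈ Ico 0 t, ‖X s‖ ≤ R) :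
    ∃ ε > 0, ∃ t > T, ∃ X, Solves F x₀ (-ε) t X := by
  obtain ⟨K, hK, hFK⟩ := hF (R + 1)
  obtain ⟨τ, hτ, hloc⟩ := exists_uniform_local_solution ((norm_nonneg _).trans hx₀) hK hFK
  -- A solution up to `t ≤ T` is restarted at `t - τ / 2`, where the common bound `R` holds, and
  -- then lives up to `t + τ / 2`. Each step gains `τ / 2`.
  have key : ∀ n : ℕ, ∃ t > 0, (τ + n * (τ / 2) ≤ t ∨ T < t) ∧ ∃ X, Solves F x₀ (-τ) t X := by
    intro n
    induction n with
    | zero =>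
      obtain ⟨Y, hY0, hY⟩ := hloc x₀ hx₀ 0
      refine ⟨τ, hτ, Or.inl (by simp), Y, hY0, ?_⟩
      simpa using hY
    | succ n ih =>
      obtain ⟨t, ht0, ht, X, hX⟩ := ih
      rcases lt_or_ge T t with h | h
      · exact ⟨t, ht0, Or.inr h, X, hX⟩
      · have ht' : τ + n * (τ / 2) ≤ t := ht.resolve_right (not_lt.2 h)
        have hn : 0 ≤ n * (τ / 2) := by positivity
        have hc : 0 ≤ t - τ / 2 := by linarith
        obtain ⟨Y, hY0, hY⟩ := hloc _ (hR τ hτ t ht0 h X hX (t - τ / 2) ⟨hc, by linarith⟩)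
          (t - τ / 2)
        refine ⟨t - τ / 2 + τ, by linarith, Or.inl ?_, _,
          hX.glue ⟨by linarith, by linarith⟩ hc hτ hY hY0.symm⟩
        push_cast
        linarith
  obtain ⟨n, hn⟩ := exists_nat_gt (T / (τ / 2))
  obtain ⟨t, -, ht, X, hX⟩ := key n
  refine ⟨τ, hτ, t, ?_, X, hX⟩
  rcases ht with h | h
  · rw [div_lt_iff₀ (by positivity)] at hn
    linarith
  · exact h

/-- A curve is differentiable if it is so when tested against a separating family of functionals,
with a continuous candidate for the derivative. -/
theorem hasDerivAt_of_separating {ι : Type*} (ℓ : ι → E →L[ℝ] ℝ)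
    (hℓ : ∀ x, (∀ i, ℓ i x = 0) → x = 0) {G g : ℝ → E} {a b : ℝ}
    (hg : ContinuousOn g (Ioo a b))
    (h : ∀ t ∈ Ioo a b, ∀ i, HasDerivAt (fun s => ℓ i (G s)) (ℓ i (g t)) t) :
    ∀ t ∈ Ioo a b, HasDerivAt G (g t) t := by
  intro t ht
  have hsub : ∀ s ∈ Ioo a b, uIcc t s ⊆ Ioo a b := fun s hs => ordConnected_Ioo.uIcc_subset ht hs
  have hint : ∀ s ∈ Ioo a b, IntervalIntegrable g volume t s := fun s hs =>
    (hg.mono (hsub s hs)).intervalIntegrable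
  -- The functionals identify `G` with a primitive of `g`; differentiability in norm then comes from
  -- continuity of `g`.
  have key : ∀ s ∈ Ioo a b, G s = G t + ∫ r in t..s, g r := by
    intro s hs
    rw [← sub_eq_zero]
    refine hℓ _ fun i => ?_
    have h1 := intervalIntegral.integral_eq_sub_of_hasDerivAt (f := fun s => ℓ i (G s))
      (f' := fun s => ℓ i (g s)) (a := t) (b := s) (fun x hx => h x (hsub s hs hx) i)
      (((ℓ i).continuous.comp_continuousOn (hg.mono (hsub s hs))).intervalIntegrable)
    rw [map_sub, map_add, ← (ℓ i).intervalIntegral_comp_comm (hint s hs), h1]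
    ring
  have hnhds : Ioo a b ∈ 𝓝 t := isOpen_Ioo.mem_nhds ht
  have h2 : HasDerivAt (fun s => G t + ∫ r in t..s, g r) (g t) t := by
    refine (intervalIntegral.integral_hasDerivAt_right (by simp) ?_
      (hg.continuousAt hnhds)).const_add _
    exact ⟨Ioo a b, hnhds, hg.aestronglyMeasurable measurableSet_Ioo⟩
  refine h2.congr_of_eventuallyEq ?_
  filter_upwards [hnhds] with s hs
  exact key s hs

end ODE

/-! ### A priori bounds in Lagrangian coordinates -/

/-- Grönwall's inequality on a time interval of length at most `T`. -/
theorem norm_le_of_gronwall {E : Type*} [NormedAddCommGroup E] [NormedSpace ℝ E] {P P' : ℝ → E}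
    {ε t T δ K c : ℝ} (hε : 0 < ε) (htT : t ≤ T) (hK : 0 ≤ K) (hc : 0 ≤ c)
    (hP : ∀ s ∈ Ioo (-ε) t, HasDerivAt P (P' s) s) (h0 : ‖P 0‖ ≤ δ)
    (hb : ∀ s ∈ Ico 0 t, ‖P' s‖ ≤ K * ‖P s‖ + c) :
    ∀ s ∈ Ico 0 t, ‖P s‖ ≤ gronwallBound δ K c T := by
  intro s hs
  have hsub : Icc 0 s ⊆ Ioo (-ε) t := fun r hr => ⟨by linarith [hr.1], hr.2.trans_lt hs.2⟩
  have h1 := norm_le_gronwallBound_of_norm_deriv_right_le (f := P) (f' := P') (δ := δ) (K := K)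
    (ε := c) (a := 0) (b := s)
    (fun r hr => (hP r (hsub hr)).continuousAt.continuousWithinAt)
    (fun r hr => (hP r (hsub (Ico_subset_Icc_self hr))).hasDerivWithinAt) h0
    (fun r hr => hb r ⟨hr.1, hr.2.trans hs.2⟩) s ⟨hs.1, le_rfl⟩
  refine h1.trans (gronwallBound_mono ((norm_nonneg _).trans h0) hc hK ?_)
  linarith [hs.2]

/-! ### Propagation of Sobolev bounds -/

section

variable {m : ℕ} (hm : 1 ≤ m)

/-- The derivative is `e^S` times the conjugated transform of `e^{-S} ∂W`: linear in `∂W`, with a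
constant that involves only the `Hᵏ` and supremum norms of `S`, not its next derivative. -/
theorem field_fst_bound {k : ℕ} (hk : k + 1 ≤ m) (R : ℝ) : ∃ K, 0 ≤ K ∧
    ∀ (u' : Sobolev L m) (X : Sobolev L m × Sobolev L m), BdB k (rep hm X.1) R →
      ‖derivL 1 k (by omega) (field hm u' X).1‖ ≤ K * ‖derivL 1 k (by omega) X.2‖ := by
  obtain ⟨C, hC, hexp⟩ := exists_cexp_bound (L := L) k R
  obtain ⟨D, hD, hconj⟩ := exists_conj_bound (L := L) k R
  have hmul := mulConst_pos (L := L) k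
  refine ⟨(k + 1) * (mulConst L k * C * (D * (mulConst L k * C))), by positivity,
    fun u' X hX => ?_⟩
  have h1 := hasWeakDeriv (field hm u' X).1 0 hm
  rw [wderiv_field_fst] at h1
  have h2 := h1.unique (hasWeakDeriv_conj_diffeo (rep hm X.1) 0 (hasWeakDeriv X.2 0 hm))
  have h3 := (hexp _ hX).mulc (hconj _ 0 _ _ hX ((hexp _ hX.neg).mulc
    (sobB (derivL 1 k (by omega) X.2))))
  refine (norm_le_of_sobB (C := _) (h2.symm ▸ h3)).trans (le_of_eq ?_)
  ring

/-- The derivative of `e^{-S} u'` is `e^{-S} ∂u' - u' e^{-S} ∂S`, which is affine in `∂S` with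
constants depending only on `Hᵏ` control of `S`. -/
theorem field_snd_bound {k : ℕ} (hk : k + 1 ≤ m) (R : ℝ) (u' : Sobolev L m) : ∃ K c,
    0 ≤ K ∧ 0 ≤ c ∧ ∀ X : Sobolev L m × Sobolev L m, BdB k (rep hm X.1) R →
      ‖derivL 1 k (by omega) (field hm u' X).2‖ ≤ K * ‖derivL 1 k (by omega) X.1‖ + c := by
  obtain ⟨C, hC, hexp⟩ := exists_cexp_bound (L := L) k R
  have hmul := mulConst_pos (L := L) k
  have hs : 0 ≤ supConst L := zero_le_one.trans one_le_supConst
  refine ⟨(k + 1) * (mulConst L k * (supConst L * ‖u'‖) * (mulConst L k * C)),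
    (k + 1) * (mulConst L k * C * ‖derivL 1 k (by omega) u'‖), by positivity, by positivity,
    fun X hX => ?_⟩
  have h1 := hasWeakDeriv (field hm u' X).2 0 hm
  have hp := ((isPrim_rep hm X.1).smul (-1)).exp
  rw [neg_one_smul, neg_one_smul] at hp
  rw [wderiv_field_snd, ← toL_rep hm u', mulc_toL, hasWeakDeriv_toL] at h1
  have h2 := (hasWeakDeriv_toL.2 h1).unique (hp.mul (isPrim_rep hm u')).hasWeakDeriv
  have h3 := ((hexp _ hX.neg).mulc (sobB (derivL 1 k (by omega) u'))).add
    (((bdB_rep hm u').of_le (by omega : k ≤ m)).mulc ((hexp _ hX.neg).mulc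
      (sobB (derivL 1 k (by omega) X.1)).neg))
  refine (norm_le_of_sobB (C := _) (h2.symm ▸ h3)).trans (le_of_eq ?_)
  ring

/-- At order zero `S` is bounded by assumption and `W_t` is bounded in `L²`. Passing from `k` to `k
+ 1`, the bound of order `k` fixes the constants in the affine estimates for `(∂S, ∂W)`, and
Grönwall closes. -/
theorem exists_sobB_bound (u' : Sobolev L m) (x₀ : Sobolev L m × Sobolev L m) {M T : ℝ}
    (hM : 0 ≤ M) {k : ℕ} (hk : k ≤ m) : ∃ R, 0 ≤ R ∧
    ∀ ε > 0, ∀ t, t ≤ T → ∀ X, Solves (field hm u') x₀ (-ε) t X →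
      (∀ s ∈ Ico 0 t, ∀ x, |rep hm (X s).1 x| ≤ M) → ∀ s ∈ Ico 0 t,
        SobB k (wderiv (X s).1 0 (Nat.zero_le m)) R ∧
          SobB k (wderiv (X s).2 0 (Nat.zero_le m)) R := by
  induction k with
  | zero =>
    refine ⟨√L * M + |gronwallBound ‖x₀‖ 0 (Real.exp M * ‖u'‖) T|, by positivity, ?_⟩
    intro ε hε t htT X hX hσ s hs
    constructor
    · change ‖_‖ ≤ _
      rw [← toL_rep hm]
      exact (norm_toL_le (hσ s hs)).trans (le_add_of_nonneg_right (abs_nonneg _))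
    · change ‖_‖ ≤ _
      refine le_trans ?_ (le_add_of_nonneg_left (by positivity))
      refine le_trans ?_ (le_abs_self _)
      have hd : ∀ r ∈ Ioo (-ε) t, HasDerivAt (fun r => wderivL 0 (Nat.zero_le m) (X r).2)
          (wderivL 0 (Nat.zero_le m) (field hm u' (X r)).2) r := fun r hr =>
        (wderivL 0 (Nat.zero_le m)).hasFDerivAt.comp_hasDerivAt r (hX.2 r hr).snd
      refine norm_le_of_gronwall (P := fun r => wderivL 0 (Nat.zero_le m) (X r).2) hε htT le_rfl
        (by positivity) hd ?_ ?_ s hs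
      · rw [hX.1]
        exact (norm_wderiv_le _ _ (Nat.zero_le m)).trans (norm_snd_le x₀)
      · intro r hr
        rw [zero_mul, zero_add, wderivL_apply, wderiv_field_snd]
        refine (norm_mulc_le (c := Real.exp M) (fun x => ?_) _).trans ?_
        · rw [cexp_apply, abs_of_pos (Real.exp_pos _)]
          exact Real.exp_le_exp.2 (by
            rw [ContinuousMap.neg_apply]
            linarith [neg_le_of_abs_le (hσ r hr x)])
        · gcongr
          exact norm_wderiv_le _ _ _
  | succ k ih =>
    obtain ⟨R, hR, h⟩ := ih (by omega)
    obtain ⟨K, hK, hf⟩ := field_fst_bound (L := L) hm hk (M + R)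
    obtain ⟨K', c, hK', hc, hs⟩ := field_snd_bound hm hk (M + R) u'
    -- The pair of first derivatives, measured in `Hᵏ`, is the quantity to which Grönwall is
    -- applied.
    set P : Sobolev L m × Sobolev L m →L[ℝ] Sobolev L k × Sobolev L k :=
      (derivL 1 k (by omega)).prodMap (derivL 1 k (by omega))
    refine ⟨R + |gronwallBound ‖P x₀‖ (K + K') c T|, by positivity, ?_⟩
    intro ε hε t htT X hX hσ s hst
    have hB : ∀ r ∈ Ico 0 t, BdB k (rep hm (X r).1) (M + R) := fun r hr =>
      ⟨fun x => (hσ r hr x).trans (by linarith), by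
        rw [toL_rep]
        exact (h ε hε t htT X hX hσ r hr).1.mono (by linarith)⟩
    have hd : ∀ r ∈ Ioo (-ε) t, HasDerivAt (fun r => P (X r)) (P (field hm u' (X r))) r :=
      fun r hr => P.hasFDerivAt.comp_hasDerivAt r (hX.2 r hr)
    have hg := norm_le_of_gronwall hε htT (add_nonneg hK hK') hc hd (by rw [hX.1])
      (fun r hr => by
        have n1 := hf u' (X r) (hB r hr)
        have n2 := hs (X r) (hB r hr)
        have p1 : ‖derivL 1 k (by omega) (X r).1‖ ≤ ‖P (X r)‖ := norm_fst_le (P (X r))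
        have p2 : ‖derivL 1 k (by omega) (X r).2‖ ≤ ‖P (X r)‖ := norm_snd_le (P (X r))
        have p3 : 0 ≤ K * ‖P (X r)‖ := by positivity
        have p4 : 0 ≤ K' * ‖P (X r)‖ := by positivity
        refine max_le (n1.trans ?_) (n2.trans ?_)
        · have : K * ‖derivL 1 k (by omega) (X r).2‖ ≤ K * ‖P (X r)‖ := by gcongr
          linarith
        · have : K' * ‖derivL 1 k (by omega) (X r).1‖ ≤ K' * ‖P (X r)‖ := by gcongr
          linarith) s hst
    obtain ⟨b1, b2⟩ := h ε hε t htT X hX hσ s hst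
    have ha := le_abs_self (gronwallBound ‖P x₀‖ (K + K') c T)
    have ha0 := abs_nonneg (gronwallBound ‖P x₀‖ (K + K') c T)
    refine ⟨⟨b1.norm_le.trans (by linarith), _, hasWeakDeriv (X s).1 0 hm,
      (sobB (derivL 1 k (by omega) (X s).1)).mono ?_⟩,
      ⟨b2.norm_le.trans (by linarith), _, hasWeakDeriv (X s).2 0 hm,
      (sobB (derivL 1 k (by omega) (X s).2)).mono ?_⟩⟩
    · have : ‖derivL 1 k (by omega) (X s).1‖ ≤ ‖P (X s)‖ := norm_fst_le (P (X s))
      linarith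
    · have : ‖derivL 1 k (by omega) (X s).2‖ ≤ ‖P (X s)‖ := norm_snd_le (P (X s))
      linarith

/-- A bound for the logarithm of the Jacobian gives a bound in `Hᵐ`. -/
theorem exists_norm_bound (u' : Sobolev L m) (x₀ : Sobolev L m × Sobolev L m) {M T : ℝ}
    (hM : 0 ≤ M) : ∃ R, ‖x₀‖ ≤ R ∧ ∀ ε > 0, ∀ t, t ≤ T → ∀ X,
      Solves (field hm u') x₀ (-ε) t X → (∀ s ∈ Ico 0 t, ∀ x, |rep hm (X s).1 x| ≤ M) →
        ∀ s ∈ Ico 0 t, ‖X s‖ ≤ R := by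
  obtain ⟨R, hR, h⟩ := exists_sobB_bound hm u' x₀ (T := T) hM le_rfl
  refine ⟨‖x₀‖ + (m + 1) * R, le_add_of_nonneg_right (by positivity),
    fun ε hε t htT X hX hσ s hs => ?_⟩
  obtain ⟨h1, h2⟩ := h ε hε t htT X hX hσ s hs
  exact (max_le (norm_le_of_sobB h1) (norm_le_of_sobB h2)).trans
    (le_add_of_nonneg_left (norm_nonneg _))

end

/-! ### Curves that are continuous in `Hᵏ` -/

/-- The curve `f` has `k` weak derivatives, and all of them are continuous in `L²` on `I`. -/
def SobC : ℕ → (ℝ → L2 L) → Set ℝ → Prop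
  | 0, f, I => ContinuousOn f I
  | k + 1, f, I => ContinuousOn f I ∧
      ∃ g, (∀ t ∈ I, HasWeakDeriv (f t) (g t)) ∧ SobC k g I

theorem isBoundedBilinearMap_mulc :
    IsBoundedBilinearMap ℝ fun p : C(AddCircle L, ℝ) × L2 L => mulc p.1 p.2 where
  add_left := add_mulc
  smul_left := smul_mulc
  add_right := mulc_add
  smul_right c F f := mulc_smul F c f
  bound := ⟨1, one_pos, fun F f => by
    rw [one_mul]
    exact norm_mulc_le (fun x => F.norm_coe_le_norm x) f⟩

theorem continuous_cexp : Continuous (cexp (L := L)) :=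
  ContinuousMap.continuous_postcomp ⟨Real.exp, Real.continuous_exp⟩

theorem continuous_hop : Continuous (hop (L := L)) := by
  refine (LipschitzWith.of_dist_le_mul (K := 1) fun f g => ?_).continuous
  rw [dist_eq_norm, dist_eq_norm, ← hop_sub, NNReal.coe_one, one_mul]
  exact norm_hop_le _

theorem norm_le_of_isPrim {F : C(AddCircle L, ℝ)} {f : L2 L} (h : IsPrim F f) :
    ‖F‖ ≤ (√L)⁻¹ * ‖toL F‖ + √L * ‖f‖ :=
  (ContinuousMap.norm_le _ (by positivity)).2 h.abs_le

/-- The embedding of `H¹` in the continuous functions, applied to differences at two times. -/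
theorem continuousOn_of_isPrim {F : ℝ → C(AddCircle L, ℝ)} {f : ℝ → L2 L} {I : Set ℝ}
    (h : ∀ t ∈ I, IsPrim (F t) (f t)) (hF : ContinuousOn (fun t => toL (F t)) I)
    (hf : ContinuousOn f I) : ContinuousOn F I := by
  intro t ht
  have h1 : Tendsto (fun s => (√L)⁻¹ * ‖toL (F s) - toL (F t)‖ + √L * ‖f s - f t‖)
      (𝓝[I] t) (𝓝 ((√L)⁻¹ * ‖toL (F t) - toL (F t)‖ + √L * ‖f t - f t‖)) :=
    (((hF t ht).sub_const _).norm.const_mul _).add (((hf t ht).sub_const _).norm.const_mul _)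
  simp only [sub_self, norm_zero, mul_zero, add_zero] at h1
  rw [ContinuousWithinAt, tendsto_iff_norm_sub_tendsto_zero]
  refine squeeze_zero' (Eventually.of_forall fun _ => norm_nonneg _) ?_ h1
  filter_upwards [self_mem_nhdsWithin] with s hs
  rw [← map_sub]
  exact norm_le_of_isPrim ((h s hs).sub (h t ht))

namespace SobC

variable {k : ℕ} {f g : ℝ → L2 L} {I : Set ℝ}

theorem continuousOn (h : SobC k f I) : ContinuousOn f I := by
  cases k with
  | zero => exact h
  | succ k => exact h.1

theorem of_succ (h : SobC (k + 1) f I) : SobC k f I := by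
  induction k generalizing f with
  | zero => exact h.1
  | succ k ih =>
    obtain ⟨h1, f', h2, h3⟩ := h
    exact ⟨h1, f', h2, ih h3⟩

theorem of_le {j : ℕ} (h : SobC k f I) (hj : j ≤ k) : SobC j f I := by
  induction hj with
  | refl => exact h
  | step _ ih => exact ih h.of_succ

theorem congr (h : SobC k f I) (hfg : ∀ t ∈ I, g t = f t) : SobC k g I := by
  cases k with
  | zero => exact ContinuousOn.congr h hfg
  | succ k =>
    obtain ⟨h1, f', h2, h3⟩ := h
    exact ⟨h1.congr hfg, f', fun t ht => by rw [hfg t ht]; exact h2 t ht, h3⟩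

theorem add (hf : SobC k f I) (hg : SobC k g I) : SobC k (fun t => f t + g t) I := by
  induction k generalizing f g with
  | zero => exact ContinuousOn.add hf hg
  | succ k ih =>
    obtain ⟨h1, f', h2, h3⟩ := hf
    obtain ⟨k1, g', k2, k3⟩ := hg
    exact ⟨h1.add k1, _, fun t ht => (h2 t ht).add (k2 t ht), ih h3 k3⟩

theorem smul (c : ℝ) (hf : SobC k f I) : SobC k (fun t => c • f t) I := by
  induction k generalizing f with
  | zero => exact ContinuousOn.const_smul hf c
  | succ k ih =>
    obtain ⟨h1, f', h2, h3⟩ := hf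
    exact ⟨h1.const_smul c, _, fun t ht => (h2 t ht).smul c, ih h3⟩

theorem neg (hf : SobC k f I) : SobC k (fun t => -f t) I := by
  simpa only [neg_one_smul] using hf.smul (-1)

theorem deriv (hf : SobC (k + 1) f I) (h : ∀ t ∈ I, HasWeakDeriv (f t) (g t)) : SobC k g I := by
  obtain ⟨-, f', h2, h3⟩ := hf
  exact h3.congr fun t ht => (h t ht).unique (h2 t ht)

theorem hop (hf : SobC k f I) : SobC k (fun t => hop (f t)) I := by
  induction k generalizing f with
  | zero => exact continuous_hop.comp_continuousOn hf
  | succ k ih =>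
    obtain ⟨h1, f', h2, h3⟩ := hf
    exact ⟨continuous_hop.comp_continuousOn h1, _, fun t ht => (h2 t ht).hop, ih h3⟩

theorem exists_sobB (hf : SobC k f I) {t : ℝ} (ht : t ∈ I) : ∃ C, SobB k (f t) C := by
  induction k generalizing f with
  | zero => exact ⟨_, le_rfl⟩
  | succ k ih =>
    obtain ⟨-, f', h2, h3⟩ := hf
    obtain ⟨C, hC⟩ := ih h3
    exact ⟨max ‖f t‖ C, le_max_left _ _, _, h2 t ht, hC.mono (le_max_right _ _)⟩

end SobC

theorem sobC_wderiv {k : ℕ} {F : ℝ → Sobolev L k} {I : Set ℝ} (hF : ContinuousOn F I) (i j : ℕ)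
    (hij : j + i ≤ k) :
    SobC i (fun t => wderiv (F t) j ((Nat.le_add_right j i).trans hij)) I := by
  induction i generalizing j with
  | zero => exact (wderivL j hij).continuous.comp_continuousOn hF
  | succ i ih =>
    exact ⟨(wderivL j (by omega : j ≤ k)).continuous.comp_continuousOn hF, _,
      fun t _ => hasWeakDeriv (F t) j (by omega), ih (j + 1) (by omega)⟩

theorem SobC.wderiv_ofL2 {k : ℕ} {f : ℝ → L2 L} {I : Set ℝ} (h : SobC k f I) {t : ℝ} (ht : t ∈ I) :
    wderiv (ofL2 k (f t)) 0 (Nat.zero_le k) = f t := by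
  obtain ⟨C, hC⟩ := h.exists_sobB ht
  exact Sobolev.wderiv_ofL2 hC

/-- Uniqueness of weak derivatives matches each stored component with the corresponding continuous
curve of derivatives. -/
theorem SobC.continuousOn_ofL2 {k : ℕ} {f : ℝ → L2 L} {I : Set ℝ} (h : SobC k f I) :
    ContinuousOn (fun t => ofL2 k (f t)) I := by
  have key : ∀ (j : ℕ) (hj : j ≤ k), SobC (k - j) (fun t => wderiv (ofL2 k (f t)) j hj) I := by
    intro j
    induction j with
    | zero => exact fun _ => h.congr fun t ht => h.wderiv_ofL2 ht
    | succ j ih =>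
      intro hj
      have h1 := ih (Nat.le_of_succ_le hj)
      rw [show k - j = k - (j + 1) + 1 by omega] at h1
      exact h1.deriv fun t _ => hasWeakDeriv _ j hj
  rw [Topology.IsInducing.subtypeVal.continuousOn_iff]
  have h2 : ContinuousOn (fun t => WithLp.ofLp (ofL2 k (f t)).1) I :=
    continuousOn_pi.2 fun j => (key j.1 (Nat.le_of_lt_succ j.2)).continuousOn
  exact (PiLp.continuous_toLp 2 _).comp_continuousOn h2

/-- `F` is continuous on `I` both in the supremum norm and in `Hᵏ`. -/
def BdC (k : ℕ) (F : ℝ → C(AddCircle L, ℝ)) (I : Set ℝ) : Prop :=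
  ContinuousOn F I ∧ SobC k (fun t => toL (F t)) I

theorem SobC.exists_rep {k : ℕ} {f : ℝ → L2 L} {I : Set ℝ} (h : SobC (k + 1) f I) :
    ∃ F, (∀ t ∈ I, f t = toL (F t)) ∧ BdC (k + 1) F I := by
  have h0 := h
  obtain ⟨h1, f', h2, h3⟩ := h
  have h4 : ∀ t, ∃ F, t ∈ I → f t = toL F ∧ IsPrim F (f' t) := fun t => by
    by_cases ht : t ∈ I
    · obtain ⟨F, hF⟩ := (h2 t ht).exists_isPrim
      exact ⟨F, fun _ => hF⟩
    · exact ⟨0, fun h => absurd h ht⟩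
  choose F hF using h4
  have h5 : SobC (k + 1) (fun t => toL (F t)) I := h0.congr fun t ht => ((hF t ht).1).symm
  exact ⟨F, fun t ht => (hF t ht).1, continuousOn_of_isPrim (fun t ht => (hF t ht).2)
    h5.continuousOn h3.continuousOn, h5⟩

namespace BdC

variable {k : ℕ} {F G : ℝ → C(AddCircle L, ℝ)} {I : Set ℝ}

theorem of_succ (h : BdC (k + 1) F I) : BdC k F I := ⟨h.1, h.2.of_succ⟩

theorem of_le {j : ℕ} (h : BdC k F I) (hj : j ≤ k) : BdC j F I := ⟨h.1, h.2.of_le hj⟩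

theorem neg (h : BdC k F I) : BdC k (fun t => -F t) I :=
  ⟨h.1.neg, by simpa only [map_neg] using h.2.neg⟩

theorem exists_deriv (h : BdC (k + 1) F I) :
    ∃ f, (∀ t ∈ I, IsPrim (F t) (f t)) ∧ SobC k f I := by
  obtain ⟨-, f, h2, h3⟩ := h.2
  exact ⟨f, fun t ht => hasWeakDeriv_toL.1 (h2 t ht), h3⟩

theorem mulc {g : ℝ → L2 L} (hF : BdC k F I) (hg : SobC k g I) :
    SobC k (fun t => mulc (F t) (g t)) I := by
  have hc : ∀ {F : ℝ → C(AddCircle L, ℝ)} {g : ℝ → L2 L}, ContinuousOn F I → ContinuousOn g I →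
      ContinuousOn (fun t => OneDModel.mulc (F t) (g t)) I := fun hF hg =>
    isBoundedBilinearMap_mulc.continuous.comp_continuousOn (hF.prodMk hg)
  induction k generalizing F g with
  | zero => exact hc hF.1 hg
  | succ k ih =>
    obtain ⟨f, hFf, hf⟩ := hF.exists_deriv
    obtain ⟨G, hgG, hG⟩ := hg.exists_rep
    obtain ⟨g', hg', hg's⟩ := hG.exists_deriv
    refine ⟨hc hF.1 hg.continuousOn, _, fun t ht => ?_, (ih hF.of_succ hg's).add (ih hG.of_succ hf)⟩
    simp only [hgG t ht]
    rw [mulc_toL, hasWeakDeriv_toL]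
    exact (hFf t ht).mul (hg' t ht)

theorem cexp (hF : BdC k F I) : BdC k (fun t => cexp (F t)) I := by
  have hc := continuous_cexp.comp_continuousOn hF.1
  induction k with
  | zero => exact ⟨hc, toL.continuous.comp_continuousOn hc⟩
  | succ k ih =>
    obtain ⟨f, hFf, hf⟩ := hF.exists_deriv
    exact ⟨hc, toL.continuous.comp_continuousOn hc, _,
      fun t ht => (hFf t ht).exp.hasWeakDeriv, (ih hF.of_succ).mulc hf⟩

end BdC

theorem bdC_rep {k : ℕ} (hk : 1 ≤ k) {F : ℝ → Sobolev L k} {I : Set ℝ} (hF : ContinuousOn F I) :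
    BdC k (fun t => rep hk (F t)) I :=
  ⟨(rep hk).continuous.comp_continuousOn hF, by
    simpa only [toL_rep] using sobC_wderiv hF k 0 (by omega)⟩

/-! ### Curves of diffeomorphisms -/

/-- A continuous curve of diffeomorphisms. -/
def ContDiffeo (φ : ℝ → CDiff L) (I : Set ℝ) : Prop :=
  ContinuousOn (fun t => (φ t).q) I ∧ ContinuousOn (fun t => (φ t).a) I

theorem CDiff.dist_homeo_le (φ ψ : CDiff L) (x : AddCircle L) :
    dist (φ.homeo x) (ψ.homeo x) ≤ |φ.a - ψ.a| + L * ‖φ.q - ψ.q‖ := by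
  obtain ⟨y, hy, rfl⟩ : ∃ y : ℝ, y ∈ Icc 0 L ∧ (y : AddCircle L) = x := by
    have h := AddCircle.coe_image_Icc_eq L 0
    rw [zero_add] at h
    obtain ⟨y, hy, hyx⟩ := h.symm ▸ mem_univ x
    exact ⟨y, hy, hyx⟩
  rw [CDiff.homeo_coe, CDiff.homeo_coe, dist_eq_norm, ← AddCircle.coe_sub]
  refine QuotientAddGroup.norm_mk_le_norm.trans ?_
  have h1 : φ.lift y - ψ.lift y = (φ.a - ψ.a) + ∫ s in (0 : ℝ)..y, (φ.q - ψ.q) (s : AddCircle L) := by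
    simp only [CDiff.lift, ContinuousMap.sub_apply]
    rw [intervalIntegral.integral_sub ((continuous_q_coe φ.q).intervalIntegrable _ _)
      ((continuous_q_coe ψ.q).intervalIntegrable _ _)]
    ring
  rw [h1, Real.norm_eq_abs]
  refine (abs_add_le _ _).trans ?_
  have h2 := intervalIntegral.norm_integral_le_of_norm_le_const (a := 0) (b := y)
    (f := fun s : ℝ => (φ.q - ψ.q) (s : AddCircle L)) (C := ‖φ.q - ψ.q‖)
    fun s _ => (φ.q - ψ.q).norm_coe_le_norm _
  rw [sub_zero, abs_of_nonneg hy.1, Real.norm_eq_abs] at h2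
  have h3 : ‖φ.q - ψ.q‖ * y ≤ L * ‖φ.q - ψ.q‖ := by
    rw [mul_comm]
    exact mul_le_mul_of_nonneg_right hy.2 (norm_nonneg _)
  linarith

namespace ContDiffeo

variable {φ : ℝ → CDiff L} {I : Set ℝ}

theorem ccomp (hφ : ContDiffeo φ I) (F : C(AddCircle L, ℝ)) :
    ContinuousOn (fun t => (φ t).ccomp F) I := by
  intro t ht
  rw [ContinuousWithinAt, Metric.tendsto_nhds]
  intro ε hε
  obtain ⟨δ, hδ, h⟩ := Metric.uniformContinuous_iff.1
    (CompactSpace.uniformContinuous_of_continuous F.continuous) (ε / 2) (half_pos hε)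
  have h1 : Tendsto (fun s => |(φ s).a - (φ t).a| + L * ‖(φ s).q - (φ t).q‖) (𝓝[I] t)
      (𝓝 (|(φ t).a - (φ t).a| + L * ‖(φ t).q - (φ t).q‖)) :=
    ((hφ.2 t ht).sub_const _).abs.add (((hφ.1 t ht).sub_const _).norm.const_mul _)
  rw [sub_self, sub_self, norm_zero, abs_zero, mul_zero, add_zero] at h1
  filter_upwards [h1.eventually (gt_mem_nhds hδ)] with s hs
  refine lt_of_le_of_lt ((ContinuousMap.dist_le (half_pos hε).le).2 fun x => ?_) (half_lt_self hε)
  exact (h (((φ s).dist_homeo_le (φ t) x).trans_lt hs)).le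

/-- No estimate for the inverse diffeomorphisms is needed: with `K = G ∘ φ_t⁻¹`, the difference `G ∘
φ_s⁻¹ - G ∘ φ_t⁻¹` at `φ_s(x)` equals `K(φ_t(x)) - K(φ_s(x))`, and the forward maps depend
continuously on time. -/
theorem icomp_toL (hφ : ContDiffeo φ I) (G : C(AddCircle L, ℝ)) :
    ContinuousOn (fun t => (φ t).icomp (toL G)) I := by
  intro t ht
  set K := (φ t).cicomp G
  have h1 := (hφ.ccomp K t ht).sub_const ((φ t).ccomp K)
  have h2 : Tendsto (fun s => √L * ‖(φ s).ccomp K - (φ t).ccomp K‖) (𝓝[I] t)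
      (𝓝 (√L * ‖(φ t).ccomp K - (φ t).ccomp K‖)) := h1.norm.const_mul _
  rw [sub_self, norm_zero, mul_zero] at h2
  rw [ContinuousWithinAt, tendsto_iff_norm_sub_tendsto_zero]
  refine squeeze_zero' (Eventually.of_forall fun _ => norm_nonneg _)
    (Eventually.of_forall fun s => ?_) h2
  rw [CDiff.icomp_toL, CDiff.icomp_toL, ← map_sub]
  refine norm_toL_le fun z => ?_
  have h3 := ((φ s).ccomp K - (φ t).ccomp K).norm_coe_le_norm ((φ s).homeo.symm z)
  have h4 : ((φ s).ccomp K - (φ t).ccomp K) ((φ s).homeo.symm z)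
      = -((φ s).cicomp G - K) z := by
    change G ((φ t).homeo.symm ((φ s).homeo ((φ s).homeo.symm z)))
      - G ((φ t).homeo.symm ((φ t).homeo ((φ s).homeo.symm z)))
      = -(G ((φ s).homeo.symm z) - G ((φ t).homeo.symm z))
    rw [Homeomorph.apply_symm_apply, Homeomorph.symm_apply_apply]
    ring
  rwa [h4, norm_neg, Real.norm_eq_abs] at h3

/-- The operators are uniformly bounded near `t`, so it suffices to approximate `f t` by a
continuous function. Four errors of size `ε / 4` arise, one of them strict. -/
theorem icomp (hφ : ContDiffeo φ I) {f : ℝ → L2 L} (hf : ContinuousOn f I) :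
    ContinuousOn (fun t => (φ t).icomp (f t)) I := by
  intro t ht
  rw [ContinuousWithinAt, Metric.tendsto_nhds]
  intro ε hε
  set C := ‖(φ t).q‖ + 1
  have hC : 0 < C := by positivity
  have hsC : 0 < √C := Real.sqrt_pos.2 hC
  have hη : 0 < ε / (4 * √C) := by positivity
  obtain ⟨g, g', hg, hfg⟩ := exists_hasWeakDeriv_near (f t) hη
  obtain ⟨G, rfl, -⟩ := hg.exists_isPrim
  have e1 : ∀ᶠ s in 𝓝[I] t, ‖(φ s).q‖ < C :=
    (hφ.1 t ht).norm.eventually (gt_mem_nhds (by simp [C]))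
  have e2 : ∀ᶠ s in 𝓝[I] t, dist (f s) (f t) < ε / (4 * √C) :=
    Metric.tendsto_nhds.1 (hf t ht) _ hη
  have e3 := Metric.tendsto_nhds.1 (hφ.icomp_toL G t ht) (ε / 4) (by positivity)
  have hb : ∀ s, ‖(φ s).q‖ < C → ∀ w : L2 L, ‖w‖ ≤ ε / (4 * √C) → ‖(φ s).icomp w‖ ≤ ε / 4 := by
    intro s hs w hw
    calc ‖(φ s).icomp w‖ ≤ √C * ‖w‖ := (φ s).norm_icomp_le
          (fun x => (le_abs_self _).trans (((φ s).q.norm_coe_le_norm x).trans hs.le)) w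
      _ ≤ √C * (ε / (4 * √C)) := by gcongr
      _ = ε / 4 := by field_simp
  have hsub : ∀ s (v w : L2 L), (φ s).icomp v - (φ s).icomp w = (φ s).icomp (v - w) := by
    intro s v w
    rw [sub_eq_add_neg v, ← neg_one_smul ℝ w, CDiff.icomp_add, CDiff.icomp_smul, neg_one_smul,
      sub_eq_add_neg]
  filter_upwards [e1, e2, e3] with s h1 h2 h3
  rw [dist_eq_norm] at h2 h3 ⊢
  have d : (φ s).icomp (f s) - (φ t).icomp (f t)
      = (φ s).icomp (f s - f t) + (φ s).icomp (f t - toL G)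
        + ((φ s).icomp (toL G) - (φ t).icomp (toL G)) - (φ t).icomp (f t - toL G) := by
    rw [← hsub, ← hsub, ← hsub]; abel
  have n1 := hb s h1 _ h2.le
  have n2 := hb s h1 _ hfg
  have n3 := hb t (by simp [C]) _ hfg
  rw [d]
  refine (norm_sub_le _ _).trans_lt ?_
  have := norm_add₃_le (a := (φ s).icomp (f s - f t)) (b := (φ s).icomp (f t - toL G))
    (c := (φ s).icomp (toL G) - (φ t).icomp (toL G))
  linarith

theorem sobC_icomp (hφ : ContDiffeo φ I) {k : ℕ} (hq : BdC k (fun t => (φ t).qinv) I)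
    {f : ℝ → L2 L} (hf : SobC k f I) : SobC k (fun t => (φ t).icomp (f t)) I := by
  induction k generalizing f with
  | zero => exact hφ.icomp hf
  | succ k ih =>
    obtain ⟨h1, f', h2, h3⟩ := hf
    exact ⟨hφ.icomp h1, _, fun t ht => (φ t).hasWeakDeriv_icomp (h2 t ht),
      ih hq.of_succ (hq.of_succ.mulc h3)⟩

/-- The Jacobian enters only after one differentiation, so composition keeps one derivative more
than the Jacobian has. This places `u` in `H^{m+1}` although the logarithm of the Jacobian is only
in `Hᵐ`. -/
theorem sobC_succ_icomp (hφ : ContDiffeo φ I) {k : ℕ} (hq : BdC k (fun t => (φ t).qinv) I)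
    {f : ℝ → L2 L} (hf : SobC (k + 1) f I) : SobC (k + 1) (fun t => (φ t).icomp (f t)) I := by
  obtain ⟨h1, f', h2, h3⟩ := hf
  exact ⟨hφ.icomp h1, _, fun t ht => (φ t).hasWeakDeriv_icomp (h2 t ht),
    hφ.sobC_icomp hq (hq.mulc h3)⟩

end ContDiffeo

/-! ### The velocity -/

theorem exists_vel (f : L2 L) : ∃ F : C(AddCircle L, ℝ), IsPrim F (hop f) ∧
    ∫ x : AddCircle L, F x = 0 := by
  obtain ⟨F, hF, -⟩ := exists_isPrim (g := hop f) (by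
    rw [integral_coe (fun z => hop f z)]
    exact integral_hop f)
  set c := L⁻¹ * ∫ x : AddCircle L, F x
  refine ⟨F + ContinuousMap.const _ (-c), ?_, ?_⟩
  · have := hF.add (isPrim_const (L := L) (-c))
    rwa [add_zero] at this
  · simp only [ContinuousMap.add_apply, ContinuousMap.const_apply]
    rw [integral_add (integrable_continuousMap F) (integrable_const _)]
    have h1 := mean_const (L := L) (-c)
    have h2 := hL.out.ne'
    rw [inv_mul_eq_iff_eq_mul₀ h2] at h1
    rw [h1, mul_neg, mul_inv_cancel_left₀ h2]
    ring

/-- The velocity of mean zero whose derivative is the Hilbert transform of `f`. -/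
def vel (f : L2 L) : C(AddCircle L, ℝ) := (exists_vel f).choose

theorem isPrim_vel (f : L2 L) : IsPrim (vel f) (hop f) := (exists_vel f).choose_spec.1

theorem integral_vel (f : L2 L) : ∫ x : AddCircle L, vel f x = 0 := (exists_vel f).choose_spec.2

theorem integral_cm_sub (F G : C(AddCircle L, ℝ)) :
    ∫ x : AddCircle L, (F - G) x = (∫ x : AddCircle L, F x) - ∫ x : AddCircle L, G x :=
  integral_sub (integrable_continuousMap F) (integrable_continuousMap G)

theorem norm_le_of_mean_zero {F : C(AddCircle L, ℝ)} {g : L2 L} (h : IsPrim F g)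
    (hm : ∫ x : AddCircle L, F x = 0) : ‖F‖ ≤ √L * ‖g‖ :=
  (ContinuousMap.norm_le _ (by positivity)).2 (h.abs_le_of_mean_zero hm)

theorem IsPrim.eq_of_mean_zero {F G : C(AddCircle L, ℝ)} {g : L2 L} (hF : IsPrim F g)
    (hG : IsPrim G g) (hF0 : ∫ x : AddCircle L, F x = 0) (hG0 : ∫ x : AddCircle L, G x = 0) :
    F = G := by
  have h1 := norm_le_of_mean_zero (hF.sub hG) (by rw [integral_cm_sub, hF0, hG0, sub_zero])
  rw [sub_self, norm_zero, mul_zero] at h1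
  exact sub_eq_zero.1 (norm_le_zero_iff.1 h1)

theorem norm_vel_sub_le (f g : L2 L) : ‖vel f - vel g‖ ≤ √L * ‖f - g‖ := by
  refine (norm_le_of_mean_zero ((isPrim_vel f).sub (isPrim_vel g)) ?_).trans ?_
  · rw [integral_cm_sub, integral_vel, integral_vel, sub_zero]
  · rw [← hop_sub]
    gcongr
    exact norm_hop_le _

theorem continuous_vel : Continuous (vel (L := L)) := by
  refine (LipschitzWith.of_dist_le_mul (K := ⟨√L, Real.sqrt_nonneg _⟩) fun f g => ?_).continuous
  rw [dist_eq_norm, dist_eq_norm]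
  exact norm_vel_sub_le f g

theorem SobC.vel {k : ℕ} {f : ℝ → L2 L} {I : Set ℝ} (hf : SobC k f I) :
    BdC (k + 1) (fun t => vel (f t)) I := by
  have hc := continuous_vel.comp_continuousOn hf.continuousOn
  exact ⟨hc, toL.continuous.comp_continuousOn hc, _,
    fun t _ => (isPrim_vel (f t)).hasWeakDeriv, hf.hop⟩

/-! ### Test functions -/

/-- `K'` is the classical derivative of `K`. -/
def IsClassicalDeriv (K K' : C(AddCircle L, ℝ)) : Prop :=
  ∀ x : ℝ, HasDerivAt (fun y : ℝ => K (y : AddCircle L)) (K' (x : AddCircle L)) x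

theorem IsClassicalDeriv.isPrim {K K' : C(AddCircle L, ℝ)} (h : IsClassicalDeriv K K') :
    IsPrim K (toL K') := by
  intro x
  have h1 : ∫ s in (0 : ℝ)..x, toL K' (s : AddCircle L)
      = ∫ s in (0 : ℝ)..x, K' (s : AddCircle L) := by
    refine intervalIntegral.integral_congr_ae ?_
    filter_upwards [ae_coe (coeFn_toL K')] with s hs _
    exact hs
  rw [h1, intervalIntegral.integral_eq_sub_of_hasDerivAt (fun s _ => h s)
    ((CDiff.continuous_q_coe K').intervalIntegrable _ _), AddCircle.coe_zero]
  ring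

theorem exists_periodic_lift {ψ : ℝ → ℝ} (hψ : Continuous ψ) (hp : Function.Periodic ψ L) :
    ∃ K : C(AddCircle L, ℝ), ∀ x : ℝ, K (x : AddCircle L) = ψ x :=
  ⟨⟨hp.lift, continuous_coinduced_dom.2 hψ⟩, fun x => hp.lift_coe x⟩

theorem exists_test_function {ψ ψ' : ℝ → ℝ} (h : ∀ x, HasDerivAt ψ (ψ' x) x)
    (hψ' : Continuous ψ') (hp : Function.Periodic ψ L) (hp' : Function.Periodic ψ' L) :
    ∃ K K' : C(AddCircle L, ℝ), IsClassicalDeriv K K' ∧ ∀ x : ℝ, K (x : AddCircle L) = ψ x := by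
  obtain ⟨K, hK⟩ := exists_periodic_lift
    (continuous_iff_continuousAt.2 fun x => (h x).continuousAt) hp
  obtain ⟨K', hK'⟩ := exists_periodic_lift hψ' hp'
  refine ⟨K, K', fun x => ?_, hK⟩
  rw [hK']
  exact (h x).congr_of_eventuallyEq (Eventually.of_forall hK)

theorem freq_mul_add_period (n : ℤ) (x : ℝ) :
    2 * Real.pi * n / L * (x + L) = 2 * Real.pi * n / L * x + n * (2 * Real.pi) := by
  have := hL.out.ne'
  field_simp

theorem inner_toL (K : C(AddCircle L, ℝ)) (f : L2 L) :
    inner ℝ (toL K) f = ∫ x : AddCircle L, f x * K x := by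
  rw [inner_eq_integral]
  refine integral_congr_ae ?_
  filter_upwards [coeFn_toL K] with x hx
  rw [hx, mul_comm]

/-- Cosines and sines are admissible test functions and determine all Fourier coefficients. -/
theorem eq_zero_of_inner_test {f : L2 L}
    (h : ∀ K K' : C(AddCircle L, ℝ), IsClassicalDeriv K K' → inner ℝ (toL K) f = 0) : f = 0 := by
  have key : ∀ ψ ψ' : ℝ → ℝ, (∀ x, HasDerivAt ψ (ψ' x) x) → Continuous ψ' →
      Function.Periodic ψ L → Function.Periodic ψ' L →
      ∫ x in (0 : ℝ)..L, f (x : AddCircle L) * ψ x = 0 := by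
    intro ψ ψ' h1 h2 h3 h4
    obtain ⟨K, K', hK, hKψ⟩ := exists_test_function h1 h2 h3 h4
    have h5 := h K K' hK
    rw [inner_toL, ← integral_coe (fun x => f x * K x)] at h5
    simpa only [hKψ] using h5
  refine ext_fc fun n => ?_
  have hz : fc (0 : L2 L) n = 0 := by simpa using fc_smul 0 (0 : L2 L) n
  set ξ := 2 * Real.pi * n / L
  have hlin : ∀ x, HasDerivAt (fun x : ℝ => ξ * x) ξ x := fun x => by
    simpa using (hasDerivAt_id x).const_mul ξ
  rw [hz, fc_eq_cos_sin,
    key (fun x => Real.cos (ξ * x)) (fun x => -Real.sin (ξ * x) * ξ) (fun x => (hlin x).cos)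
      (by fun_prop)
      (fun x => by simp only [ξ, freq_mul_add_period, Real.cos_add_int_mul_two_pi])
      (fun x => by simp only [ξ, freq_mul_add_period, Real.sin_add_int_mul_two_pi]),
    key (fun x => Real.sin (ξ * x)) (fun x => Real.cos (ξ * x) * ξ) (fun x => (hlin x).sin)
      (by fun_prop)
      (fun x => by simp only [ξ, freq_mul_add_period, Real.sin_add_int_mul_two_pi])
      (fun x => by simp only [ξ, freq_mul_add_period, Real.cos_add_int_mul_two_pi])]
  simp

/-! ### Transport by a flow -/

/-- Integration over `(0, x)` as a bounded functional. -/
def primL (x : ℝ) : C(AddCircle L, ℝ) →L[ℝ] ℝ :=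
  LinearMap.mkContinuous
    { toFun := fun F => ∫ s in (0 : ℝ)..x, F (s : AddCircle L)
      map_add' := fun F G => intervalIntegral.integral_add
        ((CDiff.continuous_q_coe F).intervalIntegrable _ _)
        ((CDiff.continuous_q_coe G).intervalIntegrable _ _)
      map_smul' := fun c F => intervalIntegral.integral_const_mul c _ } |x| fun F => by
    have h := intervalIntegral.norm_integral_le_of_norm_le_const (a := 0) (b := x)
      (f := fun s : ℝ => F (s : AddCircle L)) (C := ‖F‖) fun s _ => F.norm_coe_le_norm _
    rw [sub_zero, mul_comm] at h
    exact h

theorem primL_apply (x : ℝ) (F : C(AddCircle L, ℝ)) :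
    primL x F = ∫ s in (0 : ℝ)..x, F (s : AddCircle L) := rfl

theorem ContDiffeo.ccomp_curve {φ : ℝ → CDiff L} {I : Set ℝ} (hφ : ContDiffeo φ I)
    {F : ℝ → C(AddCircle L, ℝ)} (hF : ContinuousOn F I) :
    ContinuousOn (fun t => (φ t).ccomp (F t)) I := by
  intro t ht
  have h1 := ((hφ.ccomp (F t) t ht).sub_const ((φ t).ccomp (F t))).norm.add
    ((hF t ht).sub_const (F t)).norm
  simp only [sub_self, norm_zero, add_zero] at h1
  rw [ContinuousWithinAt, tendsto_iff_norm_sub_tendsto_zero]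
  refine squeeze_zero (fun _ => norm_nonneg _) (fun s => ?_) h1
  refine (ContinuousMap.norm_le _ (by positivity)).2 fun x => ?_
  have n1 := ((φ s).ccomp (F t) - (φ t).ccomp (F t)).norm_coe_le_norm x
  have n2 := (F s - F t).norm_coe_le_norm ((φ s).homeo x)
  have e : ((φ s).ccomp (F s) - (φ t).ccomp (F t)) x
      = ((φ s).ccomp (F t) - (φ t).ccomp (F t)) x + (F s - F t) ((φ s).homeo x) := by
    simp only [ContinuousMap.sub_apply, CDiff.ccomp_apply]
    ring
  rw [e]
  exact (norm_add_le _ _).trans (add_le_add n1 n2)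

/-- `φ` is the flow of the velocity `vel (w t)` for `t` in `I`; the function `h t` is the derivative
of the velocity in Lagrangian coordinates. -/
structure IsFlow (φ : ℝ → CDiff L) (w : ℝ → L2 L) (h : ℝ → C(AddCircle L, ℝ)) (I : Set ℝ) :
    Prop where
  cont_w : ContinuousOn w I
  cont_h : ContinuousOn h I
  toL_h : ∀ t ∈ I, toL (h t) = (φ t).comp (hop (w t))
  deriv_q : ∀ t ∈ I, HasDerivAt (fun s => (φ s).q) ((φ t).q * h t) t
  deriv_a : ∀ t ∈ I, HasDerivAt (fun s => (φ s).a) (vel (w t) ((φ t).a : AddCircle L)) t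

namespace IsFlow

variable {φ : ℝ → CDiff L} {w : ℝ → L2 L} {h : ℝ → C(AddCircle L, ℝ)} {a b : ℝ}

theorem contDiffeo (H : IsFlow φ w h (Ioo a b)) : ContDiffeo φ (Ioo a b) :=
  ⟨fun t ht => (H.deriv_q t ht).continuousAt.continuousWithinAt,
    fun t ht => (H.deriv_a t ht).continuousAt.continuousWithinAt⟩

/-- Differentiating `a + ∫ q` gives `v(a) + ∫ q h`. Since `h` is `v_z` along the flow, a change of
variables turns the integral into the increment of `v` along the image arc. -/
theorem deriv_lift (H : IsFlow φ w h (Ioo a b)) {t : ℝ} (ht : t ∈ Ioo a b) (x : ℝ) :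
    HasDerivAt (fun s => (φ s).lift x) (vel (w t) ((φ t).homeo (x : AddCircle L))) t := by
  have h1 := (H.deriv_a t ht).add ((primL x).hasFDerivAt.comp_hasDerivAt t (H.deriv_q t ht))
  refine h1.congr_deriv ?_
  have h2 := (isPrim_vel (w t)).sub_eq ((φ t).lift 0) ((φ t).lift x)
  rw [(φ t).intervalIntegral_lift, (φ t).lift_zero] at h2
  rw [CDiff.homeo_coe, primL_apply, eq_comm, ← sub_eq_iff_eq_add', h2]
  refine intervalIntegral.integral_congr_ae ?_
  filter_upwards [ae_coe (coeFn_toL (h t))] with s hs _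
  rw [ContinuousMap.mul_apply, ← hs, H.toL_h t ht]

/-- The identity is checked at each point of the circle and lifted to the supremum norm by
`hasDerivAt_of_separating`, the candidate derivative being continuous in time. -/
theorem deriv_test (H : IsFlow φ w h (Ioo a b)) {K K' : C(AddCircle L, ℝ)}
    (hK : IsClassicalDeriv K K') : ∀ t ∈ Ioo a b,
    HasDerivAt (fun s => (φ s).ccomp K * (φ s).q)
      ((φ t).ccomp (K' * vel (w t)) * (φ t).q + (φ t).ccomp K * ((φ t).q * h t)) t := by
  have hq := H.contDiffeo.1
  refine hasDerivAt_of_separating (fun x : AddCircle L => ContinuousMap.evalCLM ℝ x)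
    (fun F hF => ContinuousMap.ext hF) ?_ ?_
  · exact ((H.contDiffeo.ccomp_curve (continuousOn_const.mul
      (continuous_vel.comp_continuousOn H.cont_w))).mul hq).add
      ((H.contDiffeo.ccomp K).mul (hq.mul H.cont_h))
  · intro t ht z
    obtain ⟨x, rfl⟩ := QuotientAddGroup.mk_surjective z
    have h1 := ((hK ((φ t).lift x)).comp t (H.deriv_lift ht x)).mul
      ((ContinuousMap.evalCLM ℝ (x : AddCircle L)).hasFDerivAt.comp_hasDerivAt t (H.deriv_q t ht))
    exact h1

/-- Transport of functions by the flow, tested against `K`. -/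
theorem deriv_integral_icomp (H : IsFlow φ w h (Ioo a b)) {K K' : C(AddCircle L, ℝ)}
    (hK : IsClassicalDeriv K K') {f f' : ℝ → L2 L}
    {t : ℝ} (ht : t ∈ Ioo a b) (hf : HasDerivAt f (f' t) t) {E : L2 L}
    (hE : HasWeakDeriv ((φ t).icomp (f t)) E) :
    HasDerivAt (fun s => inner ℝ (toL K) ((φ s).icomp (f s)))
      (inner ℝ (toL K) ((φ t).icomp (f' t) - mulc (vel (w t)) E)) t := by
  -- Changing variables moves the inverse flow onto the test function, so the time derivative never
  -- falls on the composition `f ∘ φ⁻¹`.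
  have e1 : ∀ s g, inner ℝ (toL K) ((φ s).icomp g) = inner ℝ (toL ((φ s).ccomp K * (φ s).q)) g := by
    intro s g
    rw [inner_toL, inner_toL, (φ s).integral_icomp_mul]
    refine integral_congr_ae (Eventually.of_forall fun x => ?_)
    simp only [ContinuousMap.mul_apply, CDiff.ccomp_apply]
    ring
  simp only [e1]
  have h1 := (toL.hasFDerivAt.comp_hasDerivAt t (H.deriv_test hK t ht)).inner ℝ hf
  refine h1.congr_deriv ?_
  rw [inner_sub_right, e1, sub_eq_add_neg]
  congr 1
  obtain ⟨G, hG, hGp⟩ := hE.exists_isPrim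
  have hfG : f t =ᵐ[volume] (φ t).ccomp G := by
    have h2 := congrArg (φ t).comp hG
    rw [(φ t).comp_icomp, (φ t).comp_toL] at h2
    rw [h2]
    exact coeFn_toL _
  -- Integration by parts in the form `∫ (G K v)' = 0`, with `G` the continuous representative of `f
  -- ∘ φ⁻¹`.
  have h3 := (hGp.mul (hK.isPrim.mul (isPrim_vel (w t)))).hasWeakDeriv.integral_eq_zero
  have h4 : ∫ x : AddCircle L, ((mulc G (mulc K (hop (w t)) + mulc (vel (w t)) (toL K'))) x
      + (mulc (K * vel (w t)) E) x) = 0 := by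
    rw [← h3]
    refine integral_congr_ae ?_
    filter_upwards [Lp.coeFn_add (mulc G (mulc K (hop (w t)) + mulc (vel (w t)) (toL K')))
      (mulc (K * vel (w t)) E)] with x hx
    rw [hx, Pi.add_apply]
  rw [integral_add (L2.integrable _) (L2.integrable _)] at h4
  rw [inner_toL, inner_toL, eq_neg_iff_add_eq_zero, ← h4,
    ← (φ t).integral_comp (mulc G (mulc K (hop (w t)) + mulc (vel (w t)) (toL K')))]
  congr 1
  · refine integral_congr_ae ?_
    have h5 : ∀ᵐ z : AddCircle L, mulc G (mulc K (hop (w t)) + mulc (vel (w t)) (toL K')) z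
        = G z * (K z * hop (w t) z + vel (w t) z * K' z) := by
      filter_upwards [coeFn_mulc G (mulc K (hop (w t)) + mulc (vel (w t)) (toL K')),
        Lp.coeFn_add (mulc K (hop (w t))) (mulc (vel (w t)) (toL K')), coeFn_mulc K (hop (w t)),
        coeFn_mulc (vel (w t)) (toL K'), coeFn_toL K'] with z h1 h2 h3 h4 h5
      rw [h1, h2, Pi.add_apply, h3, h4, h5]
    have h6 := coeFn_toL (h t)
    rw [H.toL_h t ht] at h6
    filter_upwards [hfG, (φ t).ae_comp h5, h6, (φ t).coeFn_comp (hop (w t))] with x g1 g2 g3 g4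
    rw [g2, ← g4, g3, g1]
    simp only [ContinuousMap.add_apply, ContinuousMap.mul_apply, CDiff.ccomp_apply]
    ring
  · refine integral_congr_ae ?_
    filter_upwards [coeFn_mulc (vel (w t)) E, coeFn_mulc (K * vel (w t)) E] with x g1 g2
    rw [g1, g2, ContinuousMap.mul_apply]
    ring

/-- Transport by the flow, as an evolution equation in `Hᵏ`. -/
theorem hasDerivAt_ofL2 (H : IsFlow φ w h (Ioo a b)) {k : ℕ} {f f' E : ℝ → L2 L}
    (hf : ∀ t ∈ Ioo a b, HasDerivAt f (f' t) t)
    (hE : ∀ t ∈ Ioo a b, HasWeakDeriv ((φ t).icomp (f t)) (E t))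
    (hk : SobC k (fun t => (φ t).icomp (f t)) (Ioo a b))
    (hk' : SobC k (fun t => (φ t).icomp (f' t) - mulc (vel (w t)) (E t)) (Ioo a b)) :
    ∀ t ∈ Ioo a b, HasDerivAt (fun s => ofL2 k ((φ s).icomp (f s)))
      (ofL2 k ((φ t).icomp (f' t) - mulc (vel (w t)) (E t))) t := by
  refine hasDerivAt_of_separating
    (ι := {p : C(AddCircle L, ℝ) × C(AddCircle L, ℝ) // IsClassicalDeriv p.1 p.2})
    (fun p => (innerSL ℝ (toL p.1.1)).comp (wderivL 0 (Nat.zero_le k))) ?_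
    hk'.continuousOn_ofL2 ?_
  · intro F hF
    exact ext_wderiv (eq_zero_of_inner_test fun K K' hK => hF ⟨(K, K'), hK⟩)
  · rintro t ht ⟨⟨K, K'⟩, hK⟩
    simp only [ContinuousLinearMap.comp_apply, wderivL_apply, innerSL_apply_apply]
    rw [hk'.wderiv_ofL2 ht]
    refine (H.deriv_integral_icomp hK ht (hf t ht) (hE t ht)).congr_of_eventuallyEq ?_
    filter_upwards [isOpen_Ioo.mem_nhds ht] with s hs
    rw [hk.wderiv_ofL2 hs]

end IsFlow

/-! ### From Lagrangian to Eulerian coordinates -/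

theorem CDiff.homeo_sub_eq {φ ψ : CDiff L} (h : φ.q = ψ.q) (α β : AddCircle L) :
    φ.homeo α - φ.homeo β = ψ.homeo α - ψ.homeo β := by
  obtain ⟨x, rfl⟩ := QuotientAddGroup.mk_surjective α
  obtain ⟨y, rfl⟩ := QuotientAddGroup.mk_surjective β
  rw [φ.homeo_coe, φ.homeo_coe, ψ.homeo_coe, ψ.homeo_coe, ← AddCircle.coe_sub,
    ← AddCircle.coe_sub, φ.lift_sub, ψ.lift_sub, h]

/-- The kernel sees only differences of image points, so the base point drops out. This justifies
the base point `0` in `field`, whatever the actual position of the flow. -/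
theorem CDiff.conj_eq_of_q_eq {φ ψ : CDiff L} (h : φ.q = ψ.q) {f g : L2 L}
    (hf : HasWeakDeriv f g) : φ.conj f = ψ.conj f := by
  obtain ⟨F, rfl, hF⟩ := hf.exists_isPrim
  refine Lp.ext ?_
  filter_upwards [φ.conj_toL_ae_eq hF, ψ.conj_toL_ae_eq hF] with α h1 h2
  rw [h1, h2]
  simp only [CDiff.homeo_sub_eq h, h]

theorem CDiff.icomp_eq_self {φ : CDiff L} (hq : φ.q = 1) (ha : φ.a = 0) (f : L2 L) :
    φ.icomp f = f := by
  have h1 : φ.homeo = Homeomorph.refl _ := by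
    ext z
    obtain ⟨x, rfl⟩ := QuotientAddGroup.mk_surjective z
    change φ.homeo (x : AddCircle L) = (x : AddCircle L)
    rw [φ.homeo_coe, CDiff.lift, hq, ha]
    simp
  refine Lp.ext ?_
  filter_upwards [φ.coeFn_icomp f] with z hz
  rw [hz, h1]
  rfl

theorem CDiff.icomp_zero (φ : CDiff L) : φ.icomp 0 = 0 := by
  simpa using φ.icomp_smul 0 0

theorem qinv_diffeo (S : C(AddCircle L, ℝ)) (a : ℝ) : (diffeo S a).qinv = cexp (-nrm S) := by
  ext x
  exact (Real.exp_neg _).symm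

theorem BdC.congr {k : ℕ} {F G : ℝ → C(AddCircle L, ℝ)} {I : Set ℝ} (h : BdC k F I)
    (hFG : ∀ t ∈ I, G t = F t) : BdC k G I :=
  ⟨h.1.congr hFG, h.2.congr fun t ht => by rw [hFG t ht]⟩

theorem continuous_field {m : ℕ} (hm : 1 ≤ m) (u' : Sobolev L m) : Continuous (field hm u') := by
  refine continuous_iff_continuousAt.2 fun X => ?_
  obtain ⟨K, -, hK⟩ := exists_field_lipschitz hm u' (‖X‖ + 1)
  rw [ContinuousAt, tendsto_iff_norm_sub_tendsto_zero]
  have h1 : Tendsto (fun Y => K * ‖Y - X‖) (𝓝 X) (𝓝 (K * ‖X - X‖)) :=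
    ((continuous_id.sub continuous_const).norm.const_mul K).tendsto X
  rw [sub_self, norm_zero, mul_zero] at h1
  refine squeeze_zero' (Eventually.of_forall fun _ => norm_nonneg _) ?_ h1
  filter_upwards [continuous_norm.continuousAt.eventually (gt_mem_nhds (lt_add_one ‖X‖))] with Y hY
  exact hK Y X hY.le (le_add_of_nonneg_right zero_le_one)

/-- Gives the continuity in time of `originVel`, needed to integrate it to the base point of the
flow. -/
theorem continuous_double_integral : Continuous fun p : C(AddCircle L, ℝ) × C(AddCircle L, ℝ) =>
    ∫ x in (0 : ℝ)..L, p.1 (x : AddCircle L) * primL x p.2 := by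
  have hmk : Continuous fun x : ℝ => (x : AddCircle L) := AddCircle.continuous_mk' L
  have h1 : Continuous fun z : (C(AddCircle L, ℝ) × C(AddCircle L, ℝ)) × ℝ =>
      primL z.2 z.1.2 := by
    simp only [primL_apply]
    refine intervalIntegral.continuous_parametric_intervalIntegral_of_continuous
      (f := fun (z : (C(AddCircle L, ℝ) × C(AddCircle L, ℝ)) × ℝ) (s : ℝ) =>
        z.1.2 (s : AddCircle L)) ?_ continuous_snd
    exact (continuous_snd.comp (continuous_fst.comp continuous_fst)).eval (hmk.comp continuous_snd)
  refine intervalIntegral.continuous_parametric_intervalIntegral_of_continuous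
      (f := fun (p : C(AddCircle L, ℝ) × C(AddCircle L, ℝ)) (x : ℝ) =>
        p.1 (x : AddCircle L) * primL x p.2) ?_ continuous_const
  exact ((continuous_fst.comp continuous_fst).eval (hmk.comp continuous_snd)).mul h1

theorem const_of_deriv_eq_zero {f : ℝ → ℝ} {a b : ℝ} (h : ∀ t ∈ Ioo a b, HasDerivAt f 0 t) {s t : ℝ}
    (hs : s ∈ Ioo a b) (ht : t ∈ Ioo a b) : f s = f t :=
  isOpen_Ioo.is_const_of_deriv_eq_zero isPreconnected_Ioo
    (fun x hx => (h x hx).differentiableAt.differentiableWithinAt)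
    (fun x hx => (h x hx).deriv) hs ht

/-! ### Reconstruction of the flow from the Lagrangian unknowns -/

section

variable {m : ℕ} (hm : 1 ≤ m) (u' : Sobolev L m) (X : ℝ → Sobolev L m × Sobolev L m)

/-- The logarithm of the Jacobian of the flow. -/
def logJac (s : ℝ) : C(AddCircle L, ℝ) := rep hm (X s).1

/-- The time derivative of the logarithm of the Jacobian of the flow. -/
def strain (s : ℝ) : C(AddCircle L, ℝ) := rep hm (field hm u' (X s)).1

/-- The velocity at the position of the particle `0`. -/
def originVel (s : ℝ) : ℝ :=
  -(L⁻¹ * ∫ x in (0 : ℝ)..L, cexp (logJac hm X s) (x : AddCircle L)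
    * primL x (cexp (logJac hm X s) * strain hm u' X s))

/-- The flow of the velocity. -/
def flow (s : ℝ) : CDiff L := diffeo (logJac hm X s) (∫ r in (0 : ℝ)..s, originVel hm u' X r)

/-- The vorticity in Eulerian coordinates. -/
def vort (s : ℝ) : L2 L := (flow hm u' X s).icomp (wderiv (X s).2 0 (Nat.zero_le m))

variable {hm u' X} {ω₀ : Sobolev L m} {ε t : ℝ}

theorem hasDerivAt_logJac (hX : Solves (field hm u') (0, ω₀) (-ε) t X) {s : ℝ}
    (hs : s ∈ Ioo (-ε) t) : HasDerivAt (logJac hm X) (strain hm u' X s) s :=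
  (rep hm).hasFDerivAt.comp_hasDerivAt s (hX.2 s hs).fst

theorem continuousOn_strain (hX : Solves (field hm u') (0, ω₀) (-ε) t X) :
    ContinuousOn (strain hm u' X) (Ioo (-ε) t) :=
  (rep hm).continuous.comp_continuousOn
    (continuous_fst.comp_continuousOn ((continuous_field hm u').comp_continuousOn hX.continuousOn))

theorem toL_strain (s : ℝ) : toL (strain hm u' X s)
    = (diffeo (logJac hm X s) 0).conj (wderiv (X s).2 0 (Nat.zero_le m)) := by
  rw [strain, toL_rep, wderiv_field_fst]
  rfl

theorem hasDerivAt_cexp_logJac (hX : Solves (field hm u') (0, ω₀) (-ε) t X) :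
    ∀ s ∈ Ioo (-ε) t, HasDerivAt (fun s => cexp (logJac hm X s))
      (cexp (logJac hm X s) * strain hm u' X s) s := by
  have hc : ContinuousOn (logJac hm X) (Ioo (-ε) t) := fun s hs =>
    (hasDerivAt_logJac hX hs).continuousAt.continuousWithinAt
  refine hasDerivAt_of_separating (fun x : AddCircle L => ContinuousMap.evalCLM ℝ x)
    (fun F hF => ContinuousMap.ext hF)
    ((continuous_cexp.comp_continuousOn hc).mul (continuousOn_strain hX)) ?_
  intro s hs x
  exact ((ContinuousMap.evalCLM ℝ x).hasFDerivAt.comp_hasDerivAt s (hasDerivAt_logJac hX hs)).exp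

theorem logJac_zero (hX : Solves (field hm u') (0, ω₀) (-ε) t X) : logJac hm X 0 = 0 := by
  rw [logJac, hX.1, map_zero]

/-- After a change of variables this is, up to a constant factor, the integral of a Hilbert
transform. -/
theorem integral_cexp_mul_strain (s : ℝ) :
    ∫ x : AddCircle L, (cexp (logJac hm X s) * strain hm u' X s) x = 0 := by
  set φ := diffeo (logJac hm X s) 0
  have h1 := φ.integral_comp (hop (φ.icomp (wderiv (X s).2 0 (Nat.zero_le m))))
  rw [integral_hop] at h1
  have h2 : ∫ x : AddCircle L, (cexp (logJac hm X s) * strain hm u' X s) x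
      = ∫ x : AddCircle L, Real.exp (logMean (logJac hm X s)) *
        (φ.q x * hop (φ.icomp (wderiv (X s).2 0 (Nat.zero_le m))) (φ.homeo x)) := by
    refine integral_congr_ae ?_
    have h3 := coeFn_toL (strain hm u' X s)
    rw [toL_strain] at h3
    filter_upwards [h3, φ.coeFn_comp (hop (φ.icomp (wderiv (X s).2 0 (Nat.zero_le m))))]
      with x h4 h5
    change φ.conj _ x = _ at h4
    rw [CDiff.conj, h5] at h4
    rw [h4, ContinuousMap.mul_apply, ← mul_assoc]
    congr 1
    rw [cexp_apply, diffeo_q, cexp_apply, ← Real.exp_add, nrm_apply, add_sub_cancel]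
  rw [h2, integral_const_mul, h1, mul_zero]

/-- The total length `∫ e^S` is conserved and equals `L` at time `0`, so the normalisation in
`diffeo` is trivial along solutions and `e^S` is the true Jacobian. -/
theorem logMean_logJac (hε : 0 < ε) (ht : 0 < t) (hX : Solves (field hm u') (0, ω₀) (-ε) t X)
    {s : ℝ} (hs : s ∈ Ioo (-ε) t) : logMean (logJac hm X s) = 0 := by
  have h1 : ∀ r ∈ Ioo (-ε) t, HasDerivAt (fun r => primL L (cexp (logJac hm X r))) 0 r := by
    intro r hr
    refine ((primL L).hasFDerivAt.comp_hasDerivAt r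
      (hasDerivAt_cexp_logJac hX r hr)).congr_deriv ?_
    rw [primL_apply, integral_coe (fun x => (cexp (logJac hm X r) * strain hm u' X r) x)]
    exact integral_cexp_mul_strain r
  have h2 := const_of_deriv_eq_zero h1 hs (t := 0) ⟨by linarith, ht⟩
  simp only [primL_apply] at h2
  rw [integral_coe (fun x => cexp (logJac hm X s) x),
    integral_coe (fun x => cexp (logJac hm X 0) x), logJac_zero hX] at h2
  have h3 := exp_logMean (logJac hm X s)
  have h4 := exp_logMean (0 : C(AddCircle L, ℝ))
  simp only [cexp_apply] at h2
  rw [logMean_zero] at h4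
  rwa [h2, ← h4, Real.exp_eq_exp] at h3

theorem nrm_logJac (hε : 0 < ε) (ht : 0 < t) (hX : Solves (field hm u') (0, ω₀) (-ε) t X)
    {s : ℝ} (hs : s ∈ Ioo (-ε) t) : nrm (logJac hm X s) = logJac hm X s := by
  ext x
  rw [nrm_apply, logMean_logJac hε ht hX hs, sub_zero]

theorem flow_q (hε : 0 < ε) (ht : 0 < t) (hX : Solves (field hm u') (0, ω₀) (-ε) t X)
    {s : ℝ} (hs : s ∈ Ioo (-ε) t) : (flow hm u' X s).q = cexp (logJac hm X s) := by
  rw [flow, diffeo_q, nrm_logJac hε ht hX hs]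

theorem hasDerivAt_flow_a (hε : 0 < ε) (ht : 0 < t)
    (hX : Solves (field hm u') (0, ω₀) (-ε) t X) {s : ℝ} (hs : s ∈ Ioo (-ε) t) :
    HasDerivAt (fun s => (flow hm u' X s).a) (originVel hm u' X s) s := by
  have hc : ContinuousOn (fun s => cexp (logJac hm X s)) (Ioo (-ε) t) := fun s hs =>
    (hasDerivAt_cexp_logJac hX s hs).continuousAt.continuousWithinAt
  have h1 : ContinuousOn (originVel hm u' X) (Ioo (-ε) t) :=
    ((continuous_double_integral.comp_continuousOn
      (hc.prodMk (hc.mul (continuousOn_strain hX)))).const_smul L⁻¹).neg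
  have h0 : (0 : ℝ) ∈ Ioo (-ε) t := ⟨by linarith, ht⟩
  have hnhds : Ioo (-ε) t ∈ 𝓝 s := isOpen_Ioo.mem_nhds hs
  exact intervalIntegral.integral_hasDerivAt_right
    ((h1.mono (ordConnected_Ioo.uIcc_subset h0 hs)).intervalIntegrable)
    ⟨Ioo (-ε) t, hnhds, h1.aestronglyMeasurable measurableSet_Ioo⟩ (h1.continuousAt hnhds)

theorem toL_strain_eq_comp (s : ℝ) :
    toL (strain hm u' X s) = (flow hm u' X s).comp (hop (vort hm u' X s)) := by
  rw [toL_strain]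
  exact CDiff.conj_eq_of_q_eq (φ := diffeo (logJac hm X s) 0) (ψ := flow hm u' X s) rfl
    (hasWeakDeriv (X s).2 0 hm)

/-- Along the flow, `v(φ(x))` is `v(φ(0))` plus the integral of Jacobian times strain from `0` to
`x`. Integrating against the Jacobian over a period, the left side vanishes because `v` has mean
zero, which determines `v(φ(0))` from the Lagrangian unknowns alone. -/
theorem originVel_eq (hε : 0 < ε) (ht : 0 < t) (hX : Solves (field hm u') (0, ω₀) (-ε) t X)
    {s : ℝ} (hs : s ∈ Ioo (-ε) t) : originVel hm u' X s
      = vel (vort hm u' X s) ((flow hm u' X s).a : AddCircle L) := by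
  set φ := flow hm u' X s
  set w := vort hm u' X s
  have hq : φ.q = cexp (logJac hm X s) := flow_q hε ht hX hs
  have h1 : ∀ x : ℝ, vel w (φ.homeo (x : AddCircle L))
      = vel w (φ.a : AddCircle L) + primL x (φ.q * strain hm u' X s) := by
    intro x
    have h2 := (isPrim_vel w).sub_eq (φ.lift 0) (φ.lift x)
    rw [φ.intervalIntegral_lift, φ.lift_zero] at h2
    rw [CDiff.homeo_coe, primL_apply, ← sub_eq_iff_eq_add', h2]
    refine intervalIntegral.integral_congr_ae ?_
    filter_upwards [ae_coe (coeFn_toL (strain hm u' X s))] with r hr _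
    rw [ContinuousMap.mul_apply, ← hr, toL_strain_eq_comp]
  have h3 := φ.integral_comp (vel w)
  rw [integral_vel, ← integral_coe (fun x => φ.q x * vel w (φ.homeo x))] at h3
  simp only [h1, mul_add] at h3
  have hmk : Continuous fun x : ℝ => (x : AddCircle L) := AddCircle.continuous_mk' L
  have c1 : Continuous fun x : ℝ => φ.q (x : AddCircle L) := CDiff.continuous_q_coe φ.q
  have c2 : Continuous fun x : ℝ => primL x (φ.q * strain hm u' X s) :=
    intervalIntegral.continuous_primitive
      (fun a b => (CDiff.continuous_q_coe (φ.q * strain hm u' X s)).intervalIntegrable a b) 0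
  have i1 : IntervalIntegrable (fun x : ℝ => φ.q (x : AddCircle L) * vel w (φ.a : AddCircle L))
      volume 0 L := (c1.mul continuous_const).intervalIntegrable _ _
  have i2 : IntervalIntegrable (fun x : ℝ => φ.q (x : AddCircle L)
      * primL x (φ.q * strain hm u' X s)) volume 0 L := (c1.mul c2).intervalIntegrable _ _
  rw [intervalIntegral.integral_add i1 i2, intervalIntegral.integral_mul_const,
    integral_coe (fun x => φ.q x), φ.mean] at h3
  rw [originVel, ← hq]
  have hL0 := hL.out.ne'
  rw [neg_eq_iff_eq_neg, inv_mul_eq_iff_eq_mul₀ hL0]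
  linarith

theorem isFlow (hε : 0 < ε) (ht : 0 < t) (hX : Solves (field hm u') (0, ω₀) (-ε) t X) :
    IsFlow (flow hm u' X) (vort hm u' X) (strain hm u' X) (Ioo (-ε) t) := by
  have hq : ∀ s ∈ Ioo (-ε) t, HasDerivAt (fun s => (flow hm u' X s).q)
      ((flow hm u' X s).q * strain hm u' X s) s := by
    intro s hs
    rw [flow_q hε ht hX hs]
    refine (hasDerivAt_cexp_logJac hX s hs).congr_of_eventuallyEq ?_
    filter_upwards [isOpen_Ioo.mem_nhds hs] with r hr
    exact flow_q hε ht hX hr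
  have ha : ∀ s ∈ Ioo (-ε) t, HasDerivAt (fun s => (flow hm u' X s).a)
      (originVel hm u' X s) s := fun s hs => hasDerivAt_flow_a hε ht hX hs
  have hφ : ContDiffeo (flow hm u' X) (Ioo (-ε) t) :=
    ⟨fun s hs => (hq s hs).continuousAt.continuousWithinAt,
      fun s hs => (ha s hs).continuousAt.continuousWithinAt⟩
  exact
    { cont_w := hφ.icomp ((wderivL 0 (Nat.zero_le m)).continuous.comp_continuousOn
        (continuous_snd.comp_continuousOn hX.continuousOn))
      cont_h := continuousOn_strain hX
      toL_h := fun s _ => toL_strain_eq_comp s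
      deriv_q := hq
      deriv_a := fun s hs => originVel_eq hε ht hX hs ▸ ha s hs }

theorem bdC_qinv (hε : 0 < ε) (ht : 0 < t) (hX : Solves (field hm u') (0, ω₀) (-ε) t X) :
    BdC m (fun s => (flow hm u' X s).qinv) (Ioo (-ε) t) := by
  refine (bdC_rep hm (continuous_fst.comp_continuousOn hX.continuousOn)).neg.cexp.congr
    fun s hs => ?_
  rw [flow, qinv_diffeo, nrm_logJac hε ht hX hs]
  rfl

theorem sobC_vort (hε : 0 < ε) (ht : 0 < t) (hX : Solves (field hm u') (0, ω₀) (-ε) t X) :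
    SobC m (vort hm u' X) (Ioo (-ε) t) :=
  (isFlow hε ht hX).contDiffeo.sobC_icomp (bdC_qinv hε ht hX)
    (sobC_wderiv (continuous_snd.comp_continuousOn hX.continuousOn) m 0 (by omega))

theorem flow_icomp_zero (hX : Solves (field hm u') (0, ω₀) (-ε) t X) (f : L2 L) :
    (flow hm u' X 0).icomp f = f := by
  refine CDiff.icomp_eq_self ?_ ?_ f
  · rw [flow, diffeo_q, logJac_zero hX]
    ext x
    simp [logMean_zero]
  · simp [flow, diffeo]

/-- The strain is bounded by the supremum norm of the Hilbert transform of the vorticity. -/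
theorem enorm_strain_le (s : ℝ) (x : AddCircle L) :
    ‖strain hm u' X s x‖ₑ ≤ eLpNorm (hop (vort hm u' X s)) ∞ volume := by
  set N := eLpNorm (hop (vort hm u' X s)) ∞ volume
  have h1 : ∀ᵐ z : AddCircle L, ‖hop (vort hm u' X s) z‖ₑ ≤ N := by
    simp only [N, eLpNorm_exponent_top]
    exact ae_le_eLpNormEssSup
  have h2 : ∀ᵐ z : AddCircle L, ‖strain hm u' X s z‖ₑ ≤ N := by
    have h3 := coeFn_toL (strain hm u' X s)
    rw [toL_strain_eq_comp] at h3
    filter_upwards [h3, (flow hm u' X s).coeFn_comp (hop (vort hm u' X s)),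
      (flow hm u' X s).ae_comp h1] with z g1 g2 g3
    rw [← g1, g2]
    exact g3
  -- The bound holds almost everywhere; the exceptional set is open by continuity of the strain, and
  -- an open null set is empty.
  have h3 : IsOpen {z : AddCircle L | N < ‖strain hm u' X s z‖ₑ} :=
    isOpen_lt continuous_const (map_continuous (strain hm u' X s)).enorm
  have h4 : volume {z : AddCircle L | N < ‖strain hm u' X s z‖ₑ} = 0 := by
    have := ae_iff.1 h2
    simpa only [not_le] using this
  have h5 := h3.eq_empty_of_measure_zero h4
  by_contra h6
  have h7 : x ∈ {z : AddCircle L | N < ‖strain hm u' X s z‖ₑ} := not_le.1 h6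
  rw [h5] at h7
  exact h7

end

/-! ### The Eulerian solution -/

theorem contDiffOn_one_of_hasDerivAt {E : Type*} [NormedAddCommGroup E] [NormedSpace ℝ E]
    {f f' : ℝ → E} {a b : ℝ} (h : ∀ t ∈ Ioo a b, HasDerivAt f (f' t) t)
    (hc : ContinuousOn f' (Ioo a b)) : ContDiffOn ℝ 1 f (Ioo a b) := by
  have h1 : (1 : WithTop ℕ∞) = 0 + 1 := by norm_num
  rw [h1, contDiffOn_succ_iff_deriv_of_isOpen isOpen_Ioo]
  refine ⟨fun t ht => (h t ht).differentiableAt.differentiableWithinAt, by simp, ?_⟩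
  exact contDiffOn_zero.2 (hc.congr fun t ht => (h t ht).deriv)

theorem inner_toL_one (f : L2 L) : inner ℝ (toL 1) f = ∫ x : AddCircle L, f x := by
  rw [inner_toL]
  simp

theorem integral_mulc (G : C(AddCircle L, ℝ)) (f : L2 L) :
    ∫ x : AddCircle L, mulc G f x = inner ℝ (toL G) f := by
  rw [inner_toL]
  refine integral_congr_ae ?_
  filter_upwards [coeFn_mulc G f] with x hx
  rw [hx, mul_comm]

theorem integral_L2_add (f g : L2 L) :
    ∫ x : AddCircle L, (f + g) x = (∫ x : AddCircle L, f x) + ∫ x : AddCircle L, g x := by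
  simp only [← inner_toL_one, inner_add_right]

/-- The transport term has mean zero. -/
theorem integral_mulc_vel {f g : L2 L} (h : HasWeakDeriv f g) :
    ∫ x : AddCircle L, mulc (vel f) g x = 0 := by
  obtain ⟨F, rfl, hF⟩ := h.exists_isPrim
  -- Integrating `(v f)'` reduces the claim to the orthogonality of `f` and `Hf`.
  have h1 := ((isPrim_vel (toL F)).mul hF).hasWeakDeriv.integral_eq_zero
  rwa [integral_L2_add, integral_mulc F, inner_hop_self, add_zero] at h1

theorem isClassicalDeriv_one : IsClassicalDeriv (1 : C(AddCircle L, ℝ)) 0 := fun x =>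
  hasDerivAt_const x (1 : ℝ)

theorem SobC.sub {k : ℕ} {f g : ℝ → L2 L} {I : Set ℝ} (hf : SobC k f I) (hg : SobC k g I) :
    SobC k (fun t => f t - g t) I := by
  simpa only [sub_eq_add_neg] using hf.add hg.neg

theorem SobC.incl_ofL2 {k j : ℕ} (hj : j ≤ k) {f : ℝ → L2 L} {I : Set ℝ} (h : SobC k f I) {t : ℝ}
    (ht : t ∈ I) : incl hj (ofL2 k (f t)) = ofL2 j (f t) :=
  ext_wderiv (by rw [wderiv_incl, h.wderiv_ofL2 ht, (h.of_le hj).wderiv_ofL2 ht])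

section

variable {m : ℕ} {hm : 1 ≤ m} {u₀ : Sobolev L (m + 1)} {ω₀ : Sobolev L m}
  {X : ℝ → Sobolev L m × Sobolev L m} {ε t : ℝ}

/-- The derivative of the datum, as an element of `Hᵐ`. -/
abbrev datumDeriv (u₀ : Sobolev L (m + 1)) : Sobolev L m := derivL 1 m (by omega) u₀

variable (hm u₀ X) in
/-- `u` in Eulerian coordinates. -/
def eulU (s : ℝ) : L2 L :=
  (flow hm (datumDeriv u₀) X s).icomp (wderiv u₀ 0 (Nat.zero_le _))

variable (hm u₀ X) in
/-- `u_z` in Eulerian coordinates. -/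
def eulUz (s : ℝ) : L2 L := (flow hm (datumDeriv u₀) X s).icomp
  (mulc (flow hm (datumDeriv u₀) X s).qinv (wderiv u₀ 1 (Nat.le_add_left 1 m)))

variable (hm u₀ X) in
/-- `ω_z` in Eulerian coordinates. -/
def eulWz (s : ℝ) : L2 L := (flow hm (datumDeriv u₀) X s).icomp
  (mulc (flow hm (datumDeriv u₀) X s).qinv (wderiv (X s).2 1 hm))

theorem hasWeakDeriv_eulU (s : ℝ) : HasWeakDeriv (eulU hm u₀ X s) (eulUz hm u₀ X s) :=
  CDiff.hasWeakDeriv_icomp _ (hasWeakDeriv u₀ 0 (Nat.le_add_left 1 m))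

theorem hasWeakDeriv_vort (s : ℝ) :
    HasWeakDeriv (vort hm (datumDeriv u₀) X s) (eulWz hm u₀ X s) :=
  CDiff.hasWeakDeriv_icomp _ (hasWeakDeriv (X s).2 0 hm)

theorem icomp_deriv_snd (hε : 0 < ε) (ht : 0 < t)
    (hX : Solves (field hm (datumDeriv u₀)) (0, ω₀) (-ε) t X) {s : ℝ} (hs : s ∈ Ioo (-ε) t) :
    (flow hm (datumDeriv u₀) X s).icomp
      (wderiv (field hm (datumDeriv u₀) (X s)).2 0 (Nat.zero_le m)) = eulUz hm u₀ X s := by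
  rw [wderiv_field_snd, eulUz, flow, qinv_diffeo, nrm_logJac hε ht hX hs]
  rfl

theorem sobC_eulU (hε : 0 < ε) (ht : 0 < t)
    (hX : Solves (field hm (datumDeriv u₀)) (0, ω₀) (-ε) t X) :
    SobC (m + 1) (eulU hm u₀ X) (Ioo (-ε) t) :=
  (isFlow hε ht hX).contDiffeo.sobC_succ_icomp (bdC_qinv hε ht hX)
    (sobC_wderiv (F := fun _ => u₀) continuousOn_const (m + 1) 0 (by omega))

theorem sobC_eulUz (hε : 0 < ε) (ht : 0 < t)
    (hX : Solves (field hm (datumDeriv u₀)) (0, ω₀) (-ε) t X) :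
    SobC m (eulUz hm u₀ X) (Ioo (-ε) t) :=
  (sobC_eulU hε ht hX).deriv fun s _ => hasWeakDeriv_eulU s

theorem sobC_eulWz (hε : 0 < ε) (ht : 0 < t)
    (hX : Solves (field hm (datumDeriv u₀)) (0, ω₀) (-ε) t X) :
    SobC (m - 1) (eulWz hm u₀ X) (Ioo (-ε) t) :=
  ((sobC_vort hε ht hX).of_le (by omega : m - 1 + 1 ≤ m)).deriv fun s _ => hasWeakDeriv_vort s

/-- Testing the vorticity equation against `1` leaves `∫ u_z - ∫ v ω_z`, and both integrals vanish.
-/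
theorem integral_vort (hε : 0 < ε) (ht : 0 < t)
    (hX : Solves (field hm (datumDeriv u₀)) (0, ω₀) (-ε) t X) (hω₀ : ω₀ ∈ V L m) {s : ℝ}
    (hs : s ∈ Ioo (-ε) t) : ∫ x : AddCircle L, vort hm (datumDeriv u₀) X s x = 0 := by
  have hW : ∀ r ∈ Ioo (-ε) t, HasDerivAt (fun r => wderiv (X r).2 0 (Nat.zero_le m))
      (wderiv (field hm (datumDeriv u₀) (X r)).2 0 (Nat.zero_le m)) r := fun r hr =>
    (wderivL 0 (Nat.zero_le m)).hasFDerivAt.comp_hasDerivAt r (hX.2 r hr).snd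
  have h1 : ∀ r ∈ Ioo (-ε) t, HasDerivAt
      (fun r => inner ℝ (toL 1) (vort hm (datumDeriv u₀) X r)) 0 r := by
    intro r hr
    refine ((isFlow hε ht hX).deriv_integral_icomp isClassicalDeriv_one
      (f' := fun r => wderiv (field hm (datumDeriv u₀) (X r)).2 0 (Nat.zero_le m)) hr (hW r hr)
      (hasWeakDeriv_vort r)).congr_deriv ?_
    rw [icomp_deriv_snd hε ht hX hr, inner_sub_right, inner_toL_one, inner_toL_one,
      (hasWeakDeriv_eulU r).integral_eq_zero, integral_mulc_vel (hasWeakDeriv_vort r), sub_zero]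
  have h0 : (0 : ℝ) ∈ Ioo (-ε) t := ⟨by linarith, ht⟩
  have h2 := const_of_deriv_eq_zero h1 hs h0
  rw [inner_toL_one, inner_toL_one, vort, vort, flow_icomp_zero hX, hX.1] at h2
  rw [vort, h2]
  have h3 : (1 / L) * ∫ x : AddCircle L, wderiv ω₀ 0 (Nat.zero_le m) x = 0 := hω₀
  exact (mul_eq_zero.1 h3).resolve_left (one_div_ne_zero hL.out.ne')

/-- A solution in Lagrangian coordinates yields a solution of the model. -/
theorem isSolution_eul (hε : 0 < ε) (ht : 0 < t)
    (hX : Solves (field hm (datumDeriv u₀)) (0, ω₀) (-ε) t X) (hω₀ : ω₀ ∈ V L m) {I : Set ℝ}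
    (hI : I ⊆ Ioo (-ε) t) (hU : UniqueDiffOn ℝ I) :
    IsSolution hm u₀ ω₀ I (fun s => ofL2 (m + 1) (eulU hm u₀ X s))
      (fun s => ofL2 m (vort hm (datumDeriv u₀) X s)) := by
  have H := isFlow hε ht hX
  have cU := sobC_eulU hε ht hX
  have cUz := sobC_eulUz hε ht hX
  have cW := sobC_vort hε ht hX
  have cWz := sobC_eulWz hε ht hX
  have cV := cW.vel
  set w := vort hm (datumDeriv u₀) X
  set φ := flow hm (datumDeriv u₀) X
  -- In Lagrangian coordinates `u` is constant in time, whence the source term `0`; only the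
  -- transport term remains.
  have cdU : SobC m (fun s => (φ s).icomp 0 - mulc (vel (w s)) (eulUz hm u₀ X s)) (Ioo (-ε) t) := by
    have h1 := (cV.of_succ.mulc cUz).neg
    simpa only [CDiff.icomp_zero, zero_sub] using h1
  have cdW : SobC (m - 1) (fun s => (φ s).icomp
      (wderiv (field hm (datumDeriv u₀) (X s)).2 0 (Nat.zero_le m))
        - mulc (vel (w s)) (eulWz hm u₀ X s)) (Ioo (-ε) t) :=
    ((cUz.of_le (Nat.sub_le m 1)).congr fun s hs => icomp_deriv_snd hε ht hX hs).sub
      ((cV.of_le (by omega)).mulc cWz)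
  have hW : ∀ r ∈ Ioo (-ε) t, HasDerivAt (fun r => wderiv (X r).2 0 (Nat.zero_le m))
      (wderiv (field hm (datumDeriv u₀) (X r)).2 0 (Nat.zero_le m)) r := fun r hr =>
    (wderivL 0 (Nat.zero_le m)).hasFDerivAt.comp_hasDerivAt r (hX.2 r hr).snd
  have dU : ∀ s ∈ Ioo (-ε) t, HasDerivAt
      (fun s => incl (Nat.le_succ m) (ofL2 (m + 1) (eulU hm u₀ X s)))
      (ofL2 m ((φ s).icomp 0 - mulc (vel (w s)) (eulUz hm u₀ X s))) s := by
    intro s hs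
    refine (H.hasDerivAt_ofL2 (k := m) (f := fun _ => wderiv u₀ 0 (Nat.zero_le _))
      (f' := fun _ => 0) (fun s _ => hasDerivAt_const s _) (fun s _ => hasWeakDeriv_eulU s)
      cU.of_succ cdU s hs).congr_of_eventuallyEq ?_
    filter_upwards [isOpen_Ioo.mem_nhds hs] with r hr
    exact cU.incl_ofL2 (Nat.le_succ m) hr
  have dW : ∀ s ∈ Ioo (-ε) t, HasDerivAt
      (fun s => incl (Nat.sub_le m 1) (ofL2 m (w s)))
      (ofL2 (m - 1) ((φ s).icomp (wderiv (field hm (datumDeriv u₀) (X s)).2 0 (Nat.zero_le m))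
        - mulc (vel (w s)) (eulWz hm u₀ X s))) s := by
    intro s hs
    refine (H.hasDerivAt_ofL2 (k := m - 1) hW (fun s _ => hasWeakDeriv_vort s)
      (cW.of_le (Nat.sub_le m 1)) cdW s hs).congr_of_eventuallyEq ?_
    filter_upwards [isOpen_Ioo.mem_nhds hs] with r hr
    exact cW.incl_ofL2 (Nat.sub_le m 1) hr
  have fnW : ∀ s ∈ Ioo (-ε) t, fn (ofL2 m (w s)) = w s := fun s hs => by
    rw [fn, cW.wderiv_ofL2 hs]
  have uz : ∀ s ∈ Ioo (-ε) t, wderiv (ofL2 (m + 1) (eulU hm u₀ X s)) 1 (Nat.le_add_left 1 m)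
      = eulUz hm u₀ X s := fun s hs => by
    have h1 := hasWeakDeriv (ofL2 (m + 1) (eulU hm u₀ X s)) 0 (Nat.le_add_left 1 m)
    rw [cU.wderiv_ofL2 hs] at h1
    exact h1.unique (hasWeakDeriv_eulU s)
  have wz : ∀ s ∈ Ioo (-ε) t, wderiv (ofL2 m (w s)) 1 hm = eulWz hm u₀ X s := fun s hs => by
    have h1 := hasWeakDeriv (ofL2 m (w s)) 0 hm
    rw [cW.wderiv_ofL2 hs] at h1
    exact h1.unique (hasWeakDeriv_vort s)
  refine ⟨⟨fun s hs => ?_, cU.continuousOn_ofL2.mono hI, cW.continuousOn_ofL2.mono hI,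
    (contDiffOn_one_of_hasDerivAt dU cdU.continuousOn_ofL2).mono hI,
    (contDiffOn_one_of_hasDerivAt dW cdW.continuousOn_ofL2).mono hI⟩, ?_, ?_, fun s hs => ?_⟩
  · change (1 / L) * ∫ x : AddCircle L, fn (ofL2 m (w s)) x = 0
    rw [fnW s (hI hs), integral_vort hε ht hX hω₀ (hI hs), mul_zero]
  · have h0 : (0 : ℝ) ∈ Ioo (-ε) t := ⟨by linarith, ht⟩
    refine ext_wderiv ?_
    rw [cU.wderiv_ofL2 h0]
    exact flow_icomp_zero hX _
  · have h0 : (0 : ℝ) ∈ Ioo (-ε) t := ⟨by linarith, ht⟩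
    refine ext_wderiv ?_
    rw [cW.wderiv_ofL2 h0]
    change (flow hm (datumDeriv u₀) X 0).icomp _ = _
    rw [flow_icomp_zero hX, hX.1]
  · have hs' := hI hs
    have ev : wderiv (ofL2 (m + 1) (toL (vel (w s)))) 0 (Nat.zero_le _) = toL (vel (w s)) :=
      cV.2.wderiv_ofL2 hs'
    have fnv : fn (ofL2 (m + 1) (toL (vel (w s)))) =ᵐ[volume] vel (w s) := by
      rw [fn, ev]
      exact coeFn_toL _
    have v1 : wderiv (ofL2 (m + 1) (toL (vel (w s)))) 1 (Nat.le_add_left 1 m) = hop (w s) := by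
      have h1 := hasWeakDeriv (ofL2 (m + 1) (toL (vel (w s)))) 0 (Nat.le_add_left 1 m)
      rw [ev] at h1
      exact h1.unique (isPrim_vel (w s)).hasWeakDeriv
    refine ⟨ofL2 (m + 1) (toL (vel (w s))), ⟨?_, ?_⟩, ?_, ?_⟩
    · change (1 / L) * ∫ x : AddCircle L, fn (ofL2 (m + 1) (toL (vel (w s)))) x = 0
      rw [integral_congr_ae fnv, integral_vel, mul_zero]
    · rw [fnW s hs', (hasWeakDeriv_vort s).isHilbertTransform_iff, v1]
    · rw [(dU s hs').hasDerivWithinAt.derivWithin (hU s hs), uz s hs', fn, cdU.wderiv_ofL2 hs',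
        CDiff.icomp_zero, zero_sub]
      filter_upwards [fnv, Lp.coeFn_neg (mulc (vel (w s)) (eulUz hm u₀ X s)),
        coeFn_mulc (vel (w s)) (eulUz hm u₀ X s)] with z g1 g2 g3
      rw [g1, g2, Pi.neg_apply, g3, neg_add_cancel]
    · rw [(dW s hs').hasDerivWithinAt.derivWithin (hU s hs), uz s hs', wz s hs', fn,
        cdW.wderiv_ofL2 hs', icomp_deriv_snd hε ht hX hs']
      filter_upwards [fnv, Lp.coeFn_sub (eulUz hm u₀ X s) (mulc (vel (w s)) (eulWz hm u₀ X s)),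
        coeFn_mulc (vel (w s)) (eulWz hm u₀ X s)] with z g1 g2 g3
      rw [g1, g2, Pi.sub_apply, g3, sub_add_cancel]

end

/-! ### Uniqueness -/

theorem norm_vel_le (f : L2 L) : ‖vel f‖ ≤ √L * ‖f‖ :=
  (norm_le_of_mean_zero (isPrim_vel f) (integral_vel f)).trans (by gcongr; exact norm_hop_le f)

theorem norm_mulc_le_norm (F : C(AddCircle L, ℝ)) (f : L2 L) : ‖mulc F f‖ ≤ ‖F‖ * ‖f‖ :=
  norm_mulc_le (fun x => F.norm_coe_le_norm x) f

theorem mulc_toL_comm (F G : C(AddCircle L, ℝ)) : mulc F (toL G) = mulc G (toL F) := by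
  rw [mulc_toL, mulc_toL, mul_comm]

/-- From `∫ (V f²)' = 0` the derivative moves from `f` to `V`, so transport costs no derivative in
an energy estimate. -/
theorem abs_inner_transport_le {f g : L2 L} (hf : HasWeakDeriv f g) {V H : C(AddCircle L, ℝ)}
    (hV : IsPrim V (toL H)) : |inner ℝ f (mulc V g)| ≤ ‖H‖ * ‖f‖ ^ 2 := by
  obtain ⟨F, rfl, hF⟩ := hf.exists_isPrim
  have h1 := (hF.mul (hV.mul hF)).hasWeakDeriv.integral_eq_zero
  rw [integral_L2_add, integral_mulc, ← mulc_mulc, mulc_mulc, inner_add_right, mul_comm V F,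
    ← mulc_mulc, integral_mulc] at h1
  have h2 : |inner ℝ (toL F) (mulc F (toL H))| ≤ ‖H‖ * ‖toL F‖ ^ 2 := by
    rw [mulc_toL_comm]
    refine (abs_real_inner_le_norm _ _).trans ?_
    calc ‖toL F‖ * ‖mulc H (toL F)‖ ≤ ‖toL F‖ * (‖H‖ * ‖toL F‖) := by
          gcongr; exact norm_mulc_le_norm H _
      _ = _ := by ring
  have h3 : 0 ≤ ‖H‖ * ‖toL F‖ ^ 2 := by positivity
  rw [abs_le] at h2 ⊢
  constructor <;> linarith [h2.1, h2.2]

/-- The energy estimate for the difference of two solutions. -/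
theorem energy_estimate {R : ℝ} {u₁ u₂ U₁ U₂ U₁' U₂' w₁ w₂ w₁' w₂' : L2 L}
    {H₁ H₂ : C(AddCircle L, ℝ)} (dU₁ : HasWeakDeriv U₁ U₁') (dU₂ : HasWeakDeriv U₂ U₂')
    (dw₁ : HasWeakDeriv w₁ w₁') (dw₂ : HasWeakDeriv w₂ w₂') (hH₁ : toL H₁ = hop w₁)
    (hH₂ : toL H₂ = hop w₂) (bV : ‖vel w₁‖ ≤ R) (bH : ‖H₁‖ ≤ R) (bU : SobB 1 U₂ R)
    (bU' : ∀ G, toL G = U₂ → ‖G‖ ≤ R) (bw : ‖w₂'‖ ≤ R) :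
    |inner ℝ (u₁ - u₂) (-mulc (vel w₁) U₁ - -mulc (vel w₂) U₂)
      + inner ℝ (U₁ - U₂) (-(mulc (vel w₁) U₁' + mulc H₁ U₁) - -(mulc (vel w₂) U₂' + mulc H₂ U₂))
      + inner ℝ (w₁ - w₂) (U₁ - mulc (vel w₁) w₁' - (U₂ - mulc (vel w₂) w₂'))|
      ≤ (1 + 4 * R + 3 * (√L * R)) *
        (‖u₁ - u₂‖ ^ 2 + ‖U₁ - U₂‖ ^ 2 + ‖w₁ - w₂‖ ^ 2) := by
  obtain ⟨G, rfl, hG⟩ := dU₂.exists_isPrim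
  have hR : 0 ≤ R := (norm_nonneg _).trans bV
  have hU' : ‖U₂'‖ ≤ R := (bU.deriv (dU₂)).norm_le
  have hGR := bU' G rfl
  set x := ‖u₁ - u₂‖
  set y := ‖U₁ - toL G‖
  set z := ‖w₁ - w₂‖
  set S := √L
  have hS : 0 ≤ S := Real.sqrt_nonneg _
  have hx : 0 ≤ x := norm_nonneg _
  have hy : 0 ≤ y := norm_nonneg _
  have hz : 0 ≤ z := norm_nonneg _
  have bd : ∀ f : L2 L, ‖f‖ ≤ R → ‖mulc (vel w₁ - vel w₂) f‖ ≤ S * z * R := fun f hf =>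
    (norm_mulc_le_norm _ _).trans (by gcongr; exact norm_vel_sub_le w₁ w₂)
  -- In `e2` and `e3` the transport of the difference by the first velocity is isolated, for
  -- `abs_inner_transport_le`. In all three, the rest is linear in the differences with bounded
  -- coefficients. Including `u_z` among the unknowns closes the system, as `u_z` forces `ω`.
  have e1 : -mulc (vel w₁) U₁ - -mulc (vel w₂) (toL G)
      = -(mulc (vel w₁) (U₁ - toL G) + mulc (vel w₁ - vel w₂) (toL G)) := by
    rw [mulc_sub, sub_mulc]; abel
  have e2 : -(mulc (vel w₁) U₁' + mulc H₁ U₁) - -(mulc (vel w₂) U₂' + mulc H₂ (toL G))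
      = -mulc (vel w₁) (U₁' - U₂') - (mulc (vel w₁ - vel w₂) U₂' + mulc H₁ (U₁ - toL G)
        + mulc G (hop (w₁ - w₂))) := by
    rw [hop_sub, ← hH₁, ← hH₂, mulc_sub, mulc_sub, sub_mulc, mulc_sub, mulc_toL_comm G H₁,
      mulc_toL_comm G H₂]
    abel
  have e3 : U₁ - mulc (vel w₁) w₁' - (toL G - mulc (vel w₂) w₂')
      = -mulc (vel w₁) (w₁' - w₂') + ((U₁ - toL G) - mulc (vel w₁ - vel w₂) w₂') := by
    rw [mulc_sub, sub_mulc]; abel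
  have hVp : IsPrim (vel w₁) (toL H₁) := hH₁ ▸ isPrim_vel w₁
  have dsub : ∀ {f g f' g' : L2 L}, HasWeakDeriv f f' → HasWeakDeriv g g' →
      HasWeakDeriv (f - g) (f' - g') := by
    intro f g f' g' hf hg
    have := hf.add (hg.smul (-1))
    rwa [neg_one_smul, neg_one_smul, ← sub_eq_add_neg, ← sub_eq_add_neg] at this
  have t1 : |inner ℝ (u₁ - u₂) (-mulc (vel w₁) U₁ - -mulc (vel w₂) (toL G))|
      ≤ x * (R * y + S * z * R) := by
    rw [e1]
    refine (abs_real_inner_le_norm _ _).trans ?_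
    rw [norm_neg]
    gcongr
    refine (norm_add_le _ _).trans (add_le_add ?_ (bd _ bU.norm_le))
    exact (norm_mulc_le_norm _ _).trans (by gcongr)
  have t2 : |inner ℝ (U₁ - toL G) (-(mulc (vel w₁) U₁' + mulc H₁ U₁)
      - -(mulc (vel w₂) U₂' + mulc H₂ (toL G)))|
      ≤ R * y ^ 2 + y * (S * z * R + R * y + R * z) := by
    rw [e2, inner_sub_right, inner_neg_right]
    refine (abs_sub _ _).trans (add_le_add ?_ ?_)
    · rw [abs_neg]
      exact (abs_inner_transport_le (dsub dU₁ dU₂) hVp).trans (by gcongr)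
    · refine (abs_real_inner_le_norm _ _).trans ?_
      gcongr
      refine norm_add₃_le.trans (add_le_add (add_le_add (bd _ hU') ?_) ?_)
      · exact (norm_mulc_le_norm _ _).trans (by gcongr)
      · exact (norm_mulc_le_norm _ _).trans (by gcongr; exact norm_hop_le _)
  have t3 : |inner ℝ (w₁ - w₂) (U₁ - mulc (vel w₁) w₁' - (toL G - mulc (vel w₂) w₂'))|
      ≤ R * z ^ 2 + z * (y + S * z * R) := by
    rw [e3, inner_add_right, inner_neg_right]
    refine (abs_add_le _ _).trans (add_le_add ?_ ?_)
    · rw [abs_neg]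
      exact (abs_inner_transport_le (dsub dw₁ dw₂) hVp).trans (by gcongr)
    · refine (abs_real_inner_le_norm _ _).trans ?_
      gcongr
      exact (norm_sub_le _ _).trans (add_le_add le_rfl (bd _ bw))
  refine (abs_add_three _ _ _).trans ((add_le_add (add_le_add t1 t2) t3).trans ?_)
  have p1 : x * y ≤ x ^ 2 + y ^ 2 := by nlinarith [sq_nonneg (x - y)]
  have p2 : x * z ≤ x ^ 2 + z ^ 2 := by nlinarith [sq_nonneg (x - z)]
  have p3 : y * z ≤ y ^ 2 + z ^ 2 := by nlinarith [sq_nonneg (y - z)]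
  have hSR : 0 ≤ S * R := mul_nonneg hS hR
  have q1 := mul_le_mul_of_nonneg_left p1 hR
  have q2 := mul_le_mul_of_nonneg_left p2 hSR
  have q3 := mul_le_mul_of_nonneg_left p3 hR
  have q4 := mul_le_mul_of_nonneg_left p3 hSR
  have r1 := mul_nonneg hR (sq_nonneg x)
  have r2 := mul_nonneg hR (sq_nonneg y)
  have r3 := mul_nonneg hR (sq_nonneg z)
  have r4 := mul_nonneg hSR (sq_nonneg x)
  have r5 := mul_nonneg hSR (sq_nonneg y)
  have r6 := mul_nonneg hSR (sq_nonneg z)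
  nlinarith [sq_nonneg x]

section

variable {m : ℕ} {hm : 1 ≤ m} {u₀ : Sobolev L (m + 1)} {ω₀ : Sobolev L m} {I : Set ℝ}
  {u : ℝ → Sobolev L (m + 1)} {ω : ℝ → Sobolev L m}

/-- The derivative `Hω` and the zero mean determine the velocity, so any admissible `v` is `vel`. -/
theorem IsVelocity.wderiv_eq (hm : 1 ≤ m) {ω : Sobolev L m} {v : Sobolev L (m + 1)}
    (h : IsVelocity ω v) :
    wderiv v 0 (Nat.zero_le _) = toL (vel (wderiv ω 0 (Nat.zero_le m))) := by
  obtain ⟨h1, h2⟩ := h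
  have h3 := ((hasWeakDeriv ω 0 hm).isHilbertTransform_iff).1 h2
  have h4 := hasWeakDeriv v 0 (Nat.le_add_left 1 m)
  rw [← Lp.ext h3] at h4
  obtain ⟨F, hF, hFp⟩ := h4.exists_isPrim
  have h5 : (1 / L) * ∫ x : AddCircle L, wderiv v 0 (Nat.zero_le _) x = 0 := h1
  rw [hF, integral_toL] at h5
  rw [hF, hFp.eq_of_mean_zero (isPrim_vel _)
    ((mul_eq_zero.1 h5).resolve_left (one_div_ne_zero hL.out.ne')) (integral_vel _)]

/-- The equations of the model as evolution equations in `L²`. -/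
theorem IsSolution.hasDerivWithinAt (h : IsSolution hm u₀ ω₀ I u ω) {t : ℝ} (ht : t ∈ I) :
    ∃ H : C(AddCircle L, ℝ), toL H = hop (wderiv (ω t) 0 (Nat.zero_le m)) ∧
      ‖H‖ ≤ supConst L * ‖ω t‖ ∧
      HasDerivWithinAt (fun s => wderiv (u s) 0 (Nat.zero_le _))
        (-mulc (vel (wderiv (ω t) 0 (Nat.zero_le m))) (wderiv (u t) 1 (Nat.le_add_left 1 m))) I t ∧
      HasDerivWithinAt (fun s => wderiv (u s) 1 (Nat.le_add_left 1 m))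
        (-(mulc (vel (wderiv (ω t) 0 (Nat.zero_le m))) (wderiv (u t) 2 (Nat.succ_le_succ hm))
          + mulc H (wderiv (u t) 1 (Nat.le_add_left 1 m)))) I t ∧
      HasDerivWithinAt (fun s => wderiv (ω s) 0 (Nat.zero_le m))
        (wderiv (u t) 1 (Nat.le_add_left 1 m)
          - mulc (vel (wderiv (ω t) 0 (Nat.zero_le m))) (wderiv (ω t) 1 hm)) I t := by
  obtain ⟨v, hv, h1, h2⟩ := h.eqn t ht
  have hv0 := hv.wderiv_eq hm
  set w := wderiv (ω t) 0 (Nat.zero_le m)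
  have hw : SobB (0 + 1) (hop w) ‖ω t‖ :=
    ⟨(norm_hop_le _).trans (norm_wderiv_le _ _ _), _, (hasWeakDeriv (ω t) 0 hm).hop,
      (norm_hop_le _).trans (norm_wderiv_le (ω t) 1 hm)⟩
  obtain ⟨H, H', hH, -, -, hHb⟩ := hw.exists_rep
  have fnv : fn v =ᵐ[volume] vel w := by
    rw [fn, hv0]
    exact coeFn_toL _
  set D := derivWithin (fun s => incl (Nat.le_succ m) (u s)) I t
  set D' := derivWithin (fun s => incl (Nat.sub_le m 1) (ω s)) I t
  have hD : HasDerivWithinAt (fun s => incl (Nat.le_succ m) (u s)) D I t :=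
    (h.inClass.contDiff_u.differentiableOn (by simp) t ht).hasDerivWithinAt
  have hD' : HasDerivWithinAt (fun s => incl (Nat.sub_le m 1) (ω s)) D' I t :=
    (h.inClass.contDiff_ω.differentiableOn (by simp) t ht).hasDerivWithinAt
  have eD : wderiv D 0 (Nat.zero_le m) = -mulc (vel w) (wderiv (u t) 1 (Nat.le_add_left 1 m)) := by
    refine Lp.ext ?_
    filter_upwards [h1, fnv, Lp.coeFn_neg (mulc (vel w) (wderiv (u t) 1 (Nat.le_add_left 1 m))),
      coeFn_mulc (vel w) (wderiv (u t) 1 (Nat.le_add_left 1 m))] with z g1 g2 g3 g4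
    rw [g3, Pi.neg_apply, g4, ← g2]
    exact eq_neg_of_add_eq_zero_left g1
  -- The time derivative of `u` lies in `Hᵐ` with `m ≥ 1`, so the transport equation may be
  -- differentiated once in `z`; uniqueness of weak derivatives identifies the result.
  have eD1 : wderiv D 1 hm = -(mulc (vel w) (wderiv (u t) 2 (Nat.succ_le_succ hm))
      + mulc H (wderiv (u t) 1 (Nat.le_add_left 1 m))) := by
    have g1 := hasWeakDeriv D 0 hm
    rw [eD] at g1
    obtain ⟨G, hG, hGp⟩ := (hasWeakDeriv (u t) 1 (Nat.succ_le_succ hm)).exists_isPrim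
    have g2 := (((isPrim_vel w).mul hGp).smul (-1)).hasWeakDeriv
    rw [map_smul, ← mulc_toL, neg_one_smul, neg_one_smul, ← hG, hH, mulc_toL_comm, ← hG] at g2
    exact g1.unique g2
  have eD' : wderiv D' 0 (Nat.zero_le _) = wderiv (u t) 1 (Nat.le_add_left 1 m)
      - mulc (vel w) (wderiv (ω t) 1 hm) := by
    refine Lp.ext ?_
    filter_upwards [h2, fnv, Lp.coeFn_sub (wderiv (u t) 1 (Nat.le_add_left 1 m))
      (mulc (vel w) (wderiv (ω t) 1 hm)), coeFn_mulc (vel w) (wderiv (ω t) 1 hm)] with z g1 g2 g3 g4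
    rw [g3, Pi.sub_apply, g4, ← g2]
    exact eq_sub_of_add_eq g1
  refine ⟨H, hH.symm, (ContinuousMap.norm_le _ ?_).2 hHb, ?_, ?_, ?_⟩
  · exact mul_nonneg (zero_le_one.trans one_le_supConst) (norm_nonneg _)
  · rw [← eD]
    exact (wderivL 0 (Nat.zero_le m)).hasFDerivAt.comp_hasDerivWithinAt t hD
  · rw [← eD1]
    exact (wderivL 1 hm).hasFDerivAt.comp_hasDerivWithinAt t hD
  · rw [← eD']
    exact (wderivL 0 (Nat.zero_le (m - 1))).hasFDerivAt.comp_hasDerivWithinAt t hD'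

theorem IsSolution.mono {J : Set ℝ} (h : IsSolution hm u₀ ω₀ I u ω) (hJ : J ⊆ I)
    (hU : UniqueDiffOn ℝ J) : IsSolution hm u₀ ω₀ J u ω where
  inClass := ⟨fun t ht => h.inClass.mean_zero t (hJ ht), h.inClass.continuous_u.mono hJ,
    h.inClass.continuous_ω.mono hJ, h.inClass.contDiff_u.mono hJ, h.inClass.contDiff_ω.mono hJ⟩
  init_u := h.init_u
  init_ω := h.init_ω
  eqn t ht := by
    have h1 := (h.inClass.contDiff_u.differentiableOn (by simp) t (hJ ht)).hasDerivWithinAt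
    have h2 := (h.inClass.contDiff_ω.differentiableOn (by simp) t (hJ ht)).hasDerivWithinAt
    rw [(h1.mono hJ).derivWithin (hU t ht), (h2.mono hJ).derivWithin (hU t ht)]
    exact h.eqn t (hJ ht)

/-- On each `[0, t]` with `t < T` the solutions are bounded in their Sobolev norms by compactness.
The squared `L²` distance of `(u, u_z, ω)` then satisfies a linear differential inequality and
starts from zero. -/
theorem IsSolution.unique {T : ℝ} {u₁ u₂ : ℝ → Sobolev L (m + 1)} {ω₁ ω₂ : ℝ → Sobolev L m}
    (h₁ : IsSolution hm u₀ ω₀ (Ico 0 T) u₁ ω₁) (h₂ : IsSolution hm u₀ ω₀ (Ico 0 T) u₂ ω₂) :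
    ∀ t ∈ Ico 0 T, u₁ t = u₂ t ∧ ω₁ t = ω₂ t := by
  intro t ht
  have hsub : Icc 0 t ⊆ Ico 0 T := fun s hs => ⟨hs.1, hs.2.trans_lt ht.2⟩
  obtain ⟨R₁, hR₁⟩ := isCompact_Icc.exists_bound_of_continuousOn
    (h₁.inClass.continuous_ω.mono hsub)
  obtain ⟨R₂, hR₂⟩ := isCompact_Icc.exists_bound_of_continuousOn
    (h₂.inClass.continuous_u.mono hsub)
  obtain ⟨R₃, hR₃⟩ := isCompact_Icc.exists_bound_of_continuousOn
    (h₂.inClass.continuous_ω.mono hsub)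
  set c := supConst L
  have hc : 1 ≤ c := one_le_supConst
  -- One constant dominating the norms themselves, the velocity bound `√L * ‖ω‖` and the supremum
  -- bounds `c * ‖·‖`.
  set R := (√L + c) * (|R₁| + |R₂| + |R₃|)
  have hcR : ∀ {a r : ℝ}, a ≤ r → 0 ≤ a → r ≤ |R₁| + |R₂| + |R₃| → √L * a ≤ R ∧ c * a ≤ R ∧ a ≤ R := by
    intro a r h h0 hr
    have h3 : a ≤ |R₁| + |R₂| + |R₃| := h.trans hr
    have h4 : 0 ≤ √L := Real.sqrt_nonneg _
    refine ⟨?_, ?_, ?_⟩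
    · exact mul_le_mul (by linarith) h3 h0 (by positivity)
    · exact mul_le_mul (by linarith) h3 h0 (by positivity)
    · exact h3.trans (le_mul_of_one_le_left (h0.trans h3) (by linarith))
  set f : ℝ → ℝ := fun s =>
    ‖wderiv (u₁ s) 0 (Nat.zero_le _) - wderiv (u₂ s) 0 (Nat.zero_le _)‖ ^ 2
    + ‖wderiv (u₁ s) 1 (Nat.le_add_left 1 m) - wderiv (u₂ s) 1 (Nat.le_add_left 1 m)‖ ^ 2
    + ‖wderiv (ω₁ s) 0 (Nat.zero_le m) - wderiv (ω₂ s) 0 (Nat.zero_le m)‖ ^ 2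
  have key : ∀ s ∈ Icc 0 t, ∃ f' : ℝ, HasDerivWithinAt f f' (Ico 0 T) s ∧
      |f'| ≤ 2 * (1 + 4 * R + 3 * (√L * R)) * |f s| := by
    intro s hs
    have hs' := hsub hs
    obtain ⟨H₁, hH₁, bH₁, a₁, b₁, c₁⟩ := h₁.hasDerivWithinAt hs'
    obtain ⟨H₂, hH₂, bH₂, a₂, b₂, c₂⟩ := h₂.hasDerivWithinAt hs'
    refine ⟨_, (((a₁.sub a₂).norm_sq).add ((b₁.sub b₂).norm_sq)).add ((c₁.sub c₂).norm_sq), ?_⟩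
    have n1 : ‖ω₁ s‖ ≤ |R₁| := (hR₁ s hs).trans (le_abs_self _)
    have n2 : ‖u₂ s‖ ≤ |R₂| := (hR₂ s hs).trans (le_abs_self _)
    have n3 : ‖ω₂ s‖ ≤ |R₃| := (hR₃ s hs).trans (le_abs_self _)
    have p1 := abs_nonneg R₁
    have p2 := abs_nonneg R₂
    have p3 := abs_nonneg R₃
    have m1 := hcR n1 (norm_nonneg _) (by linarith)
    have m2 := hcR n2 (norm_nonneg _) (by linarith)
    have m3 := hcR n3 (norm_nonneg _) (by linarith)
    have hE := energy_estimate (R := R) (u₁ := wderiv (u₁ s) 0 (Nat.zero_le _))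
      (u₂ := wderiv (u₂ s) 0 (Nat.zero_le _))
      (hasWeakDeriv (u₁ s) 1 (Nat.succ_le_succ hm)) (hasWeakDeriv (u₂ s) 1 (Nat.succ_le_succ hm))
      (hasWeakDeriv (ω₁ s) 0 hm) (hasWeakDeriv (ω₂ s) 0 hm) hH₁ hH₂
      ((norm_vel_le _).trans (le_trans (by gcongr; exact norm_wderiv_le _ _ _) m1.1))
      (bH₁.trans m1.2.1)
      ((sobB_wderiv (u₂ s) 1 1 (Nat.succ_le_succ hm)).mono m2.2.2)
      (fun G hG => by
        refine (ContinuousMap.norm_le _ ((norm_nonneg _).trans m2.2.2)).2 fun x => ?_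
        obtain ⟨F, F', hF, -, -, hFb⟩ :=
          (sobB_wderiv (u₂ s) (0 + 1) 1 (Nat.succ_le_succ hm)).exists_rep
        have : G = F := toL_injective (hG.trans hF)
        rw [this]
        exact (hFb x).trans m2.2.1)
      ((norm_wderiv_le (ω₂ s) 1 hm).trans m3.2.2)
    have hf0 : 0 ≤ f s := by positivity
    rw [abs_of_nonneg hf0, ← mul_add, ← mul_add, abs_mul, abs_two, mul_assoc]
    exact mul_le_mul_of_nonneg_left hE zero_le_two
  choose! f' hf' hbound using key
  have hz := eq_zero_of_abs_deriv_le_mul_abs_self_of_eq_zero_right (f := f) (f' := f')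
    (K := 2 * (1 + 4 * R + 3 * (√L * R))) (a := 0) (b := t)
    (fun s hs => ((hf' s hs).continuousWithinAt).mono hsub)
    (fun s hs => (hf' s (Ico_subset_Icc_self hs)).mono_of_mem_nhdsWithin (by
      refine mem_of_superset (Ico_mem_nhdsGE (hs.2.trans ht.2)) fun r hr => ⟨hs.1.trans hr.1, hr.2⟩))
    (by simp [f, h₁.init_u, h₂.init_u, h₁.init_ω, h₂.init_ω])
    (fun s hs => hbound s (Ico_subset_Icc_self hs)) t ⟨ht.1, le_rfl⟩
  simp only [f] at hz
  have z1 : ‖wderiv (u₁ t) 0 (Nat.zero_le _) - wderiv (u₂ t) 0 (Nat.zero_le _)‖ ^ 2 = 0 := by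
    refine le_antisymm ?_ (sq_nonneg _)
    nlinarith [sq_nonneg ‖wderiv (u₁ t) 1 (Nat.le_add_left 1 m) - wderiv (u₂ t) 1 (Nat.le_add_left 1 m)‖,
      sq_nonneg ‖wderiv (ω₁ t) 0 (Nat.zero_le m) - wderiv (ω₂ t) 0 (Nat.zero_le m)‖]
  have z2 : ‖wderiv (ω₁ t) 0 (Nat.zero_le m) - wderiv (ω₂ t) 0 (Nat.zero_le m)‖ ^ 2 = 0 := by
    refine le_antisymm ?_ (sq_nonneg _)
    nlinarith [sq_nonneg ‖wderiv (u₁ t) 1 (Nat.le_add_left 1 m) - wderiv (u₂ t) 1 (Nat.le_add_left 1 m)‖,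
      sq_nonneg ‖wderiv (u₁ t) 0 (Nat.zero_le _) - wderiv (u₂ t) 0 (Nat.zero_le _)‖]
  exact ⟨ext_wderiv (sub_eq_zero.1 (norm_eq_zero.1 (pow_eq_zero_iff two_ne_zero |>.1 z1))),
    ext_wderiv (sub_eq_zero.1 (norm_eq_zero.1 (pow_eq_zero_iff two_ne_zero |>.1 z2)))⟩

end

/-! ### The continuation criterion -/

section

variable {m : ℕ} {hm : 1 ≤ m} {u₀ : Sobolev L (m + 1)} {ω₀ : Sobolev L m}

/-- `H` is a contraction on `L²` commuting with derivatives, hence bounded on `H¹`, which embeds in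
the bounded functions. -/
theorem eLpNorm_hilbert_le (hm : 1 ≤ m) (ω : Sobolev L m) :
    eLpNorm (hilbert (fn ω)) ∞ volume ≤ ENNReal.ofReal (supConst L * ‖ω‖) := by
  have hw : SobB (0 + 1) (hop (wderiv ω 0 (Nat.zero_le m))) ‖ω‖ :=
    ⟨(norm_hop_le _).trans (norm_wderiv_le _ _ _), _, (hasWeakDeriv ω 0 hm).hop,
      (norm_hop_le _).trans (norm_wderiv_le ω 1 hm)⟩
  obtain ⟨H, H', hH, -, -, hHb⟩ := hw.exists_rep
  have h1 := (hasWeakDeriv ω 0 hm).hilbert_ae_eq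
  rw [hH] at h1
  rw [fn, eLpNorm_congr_ae (h1.trans (coeFn_toL H)), eLpNorm_exponent_top]
  exact eLpNormEssSup_le_of_ae_bound (Eventually.of_forall hHb)

/-- The continuation is continuous into `Hᵐ` on the compact interval `[0, T']`, so the integrand is
bounded on `[0, T)`. -/
theorem lintegral_lt_top_of_continuable {T : ℝ} {u : ℝ → Sobolev L (m + 1)} {ω : ℝ → Sobolev L m}
    (h : Continuable hm u₀ ω₀ T u ω) :
    ∫⁻ t in Ico 0 T, eLpNorm (hilbert (fn (ω t))) ∞ volume < ∞ := by
  obtain ⟨T', hT', U, W, hUW, heq⟩ := h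
  obtain ⟨R, hR⟩ := isCompact_Icc.exists_bound_of_continuousOn hUW.inClass.continuous_ω
  have hs : 0 ≤ supConst L := zero_le_one.trans one_le_supConst
  have h1 : ∫⁻ t in Ico 0 T, eLpNorm (hilbert (fn (ω t))) ∞ volume
      ≤ ∫⁻ _ in Ico 0 T, ENNReal.ofReal (supConst L * R) := by
    refine setLIntegral_mono' measurableSet_Ico fun t ht => ?_
    rw [← (heq t ht).2]
    refine (eLpNorm_hilbert_le hm (W t)).trans (ENNReal.ofReal_le_ofReal ?_)
    exact mul_le_mul_of_nonneg_left (hR t ⟨ht.1, (ht.2.trans hT').le⟩) hs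
  refine h1.trans_lt ?_
  rw [setLIntegral_const, Real.volume_Ico]
  exact ENNReal.mul_lt_top ENNReal.ofReal_lt_top ENNReal.ofReal_lt_top

/-- The logarithm of the Jacobian is bounded by the time integral of the supremum norm of the
Hilbert transform of the vorticity. -/
theorem enorm_logJac_le {T ε t : ℝ} {u : ℝ → Sobolev L (m + 1)} {ω : ℝ → Sobolev L m}
    (hω₀ : ω₀ ∈ V L m) (h : IsSolution hm u₀ ω₀ (Ico 0 T) u ω) (hε : 0 < ε) (ht : 0 < t)
    (htT : t ≤ T) {X : ℝ → Sobolev L m × Sobolev L m}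
    (hX : Solves (field hm (datumDeriv u₀)) (0, ω₀) (-ε) t X) {s : ℝ} (hs : s ∈ Ico 0 t)
    (x : AddCircle L) :
    ‖logJac hm X s x‖ₑ ≤ ∫⁻ t in Ico 0 T, eLpNorm (hilbert (fn (ω t))) ∞ volume := by
  have hsub : Ico 0 t ⊆ Ioo (-ε) t := fun r hr => ⟨by linarith [hr.1], hr.2⟩
  -- On `[0, t)` the Eulerian form of `X` and the given solution coincide by uniqueness, so the
  -- strain of `X` is controlled by the Hilbert transform of the given `ω`.
  have heul := isSolution_eul hε ht hX hω₀ hsub (uniqueDiffOn_Ico 0 t)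
  have hgiven := h.mono (Ico_subset_Ico_right htT) (uniqueDiffOn_Ico 0 t)
  have hle : ∀ r ∈ Ico 0 t, ‖strain hm (datumDeriv u₀) X r x‖ₑ
      ≤ eLpNorm (hilbert (fn (ω r))) ∞ volume := by
    intro r hr
    refine (enorm_strain_le r x).trans (le_of_eq ?_)
    rw [← (heul.unique hgiven r hr).2, fn, (sobC_vort hε ht hX).wderiv_ofL2 (hsub hr)]
    exact (eLpNorm_congr_ae (hasWeakDeriv_vort r).hilbert_ae_eq).symm
  have hI : uIcc 0 s ⊆ Ioo (-ε) t := by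
    rw [uIcc_of_le hs.1]
    exact fun r hr => hsub ⟨hr.1, hr.2.trans_lt hs.2⟩
  have hc : ContinuousOn (fun r => strain hm (datumDeriv u₀) X r x) (uIcc 0 s) :=
    (ContinuousMap.evalCLM ℝ x).continuous.comp_continuousOn ((continuousOn_strain hX).mono hI)
  have hftc := intervalIntegral.integral_eq_sub_of_hasDerivAt
    (f := fun r => logJac hm X r x) (f' := fun r => strain hm (datumDeriv u₀) X r x) (fun r hr =>
      (ContinuousMap.evalCLM (M := ℝ) ℝ x).hasFDerivAt.comp_hasDerivAt r
        (hasDerivAt_logJac hX (hI hr)))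
    hc.intervalIntegrable
  rw [logJac_zero hX, ContinuousMap.zero_apply, sub_zero,
    intervalIntegral.integral_of_le hs.1] at hftc
  rw [← hftc]
  refine (enorm_integral_le_lintegral_enorm _).trans ?_
  have hsub' : Ioc 0 s ⊆ Ico 0 T := fun r hr => ⟨hr.1.le, hr.2.trans_lt (hs.2.trans_le htT)⟩
  refine (setLIntegral_mono' measurableSet_Ioc fun r hr => ?_).trans
    (lintegral_mono_set hsub')
  exact hle r ⟨hr.1.le, hr.2.trans_lt hs.2⟩

/-- A finite integral bounds `S` uniformly for every Lagrangian solution living up to a time at most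
`T`. The resulting `Hᵐ` bound carries one of them past `T`. -/
theorem continuable_of_lintegral_ne_top {T : ℝ} (hT : 0 < T) {u : ℝ → Sobolev L (m + 1)}
    {ω : ℝ → Sobolev L m} (hω₀ : ω₀ ∈ V L m) (h : IsSolution hm u₀ ω₀ (Ico 0 T) u ω)
    (hfin : ∫⁻ t in Ico 0 T, eLpNorm (hilbert (fn (ω t))) ∞ volume ≠ ∞) :
    Continuable hm u₀ ω₀ T u ω := by
  set M := (∫⁻ t in Ico 0 T, eLpNorm (hilbert (fn (ω t))) ∞ volume).toReal
  obtain ⟨R, hR0, hR⟩ := exists_norm_bound hm (datumDeriv u₀) (0, ω₀) (M := M) (T := T)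
    ENNReal.toReal_nonneg
  obtain ⟨ε, hε, t, ht, X, hX⟩ := exists_solves_beyond (F := field hm (datumDeriv u₀))
    (x₀ := (0, ω₀)) (T := T) (exists_field_lipschitz hm _) hR0
    fun ε hε t ht htT X hX => hR ε hε t htT X hX fun s hs x => by
      have h1 := enorm_logJac_le hω₀ h hε ht htT hX hs x
      rw [← ENNReal.toReal_le_toReal enorm_ne_top hfin, toReal_enorm] at h1
      exact h1
  have ht0 : 0 < t := hT.trans ht
  -- The Lagrangian solution lives on an open interval, whereas a continuation is required on a
  -- closed one.
  obtain ⟨T', hT', hT't⟩ := exists_between ht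
  have hsol : ∀ {I : Set ℝ}, I ⊆ Icc 0 T' → UniqueDiffOn ℝ I → IsSolution hm u₀ ω₀ I _ _ :=
    fun hI => isSolution_eul hε ht0 hX hω₀ fun r hr =>
      ⟨by linarith [(hI hr).1], (hI hr).2.trans_lt hT't⟩
  exact ⟨T', hT', _, _, hsol subset_rfl (uniqueDiffOn_Icc (hT.trans hT')),
    (hsol (Ico_subset_Icc_self.trans (Icc_subset_Icc_right hT'.le))
      (uniqueDiffOn_Ico 0 T)).unique h⟩

end

end OneDModel

end

theorem theorem4 (L : ℝ) [Fact (0 < L)] (m : ℕ) (hm : 1 ≤ m)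
    (u₀ : OneDModel.Sobolev L (m + 1)) (ω₀ : OneDModel.Sobolev L m) (_hω₀ : ω₀ ∈ OneDModel.V L m)
    (T : ℝ) (_hT : 0 < T)
    (u : ℝ → OneDModel.Sobolev L (m + 1)) (ω : ℝ → OneDModel.Sobolev L m)
    (_hsol : OneDModel.IsSolution hm u₀ ω₀ (Ico 0 T) u ω) :
    ¬ OneDModel.Continuable hm u₀ ω₀ T u ω ↔
      ∫⁻ t in Ico 0 T, eLpNorm (OneDModel.hilbert (OneDModel.Sobolev.fn (ω t))) ∞ volume = ∞ := by
  constructor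
  · intro h
    by_contra hfin
    exact h (OneDModel.continuable_of_lintegral_ne_top _hT _hω₀ _hsol hfin)
  · intro h hc
    exact (OneDModel.lintegral_lt_top_of_continuable hc).ne h
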